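/- Let $M^2$ be a connected smooth $2$-manifold and $H^3=\{x\in\mathbb R^4_1:\langle x,x\rangle=-1,\ x_0>0\}$ hyperbolic space in Lorentz–Minkowski space of signature $(-,+,+,+)$. A front is a smooth map $f:M^2\to H^3$ such that each point has an open neighborhood $U$ carrying a smooth unit normal field $\nu$ ($\langle\nu,\nu\rangle=1$, $\langle f,\nu\rangle=0$, $\langle df,\nu\rangle=0$) for which $(f,\nu)$ is an immersion; its parallel fronts on $U$ are $f_\delta=(\cosh\delta)f+(\sinh\delta)\nu$, with unit normal $\nu_\delta=(\cosh\delta)\nu+(\sinh\delta)f$, $\delta\in\mathbb R$. Put $I=\langle df,df\rangle$, $I\!I=-\langle df,d\nu\rangle$; at regular points of $f$ (where $df$ is injective) let $H=\frac12\operatorname{tr}(I^{-1}I\!I)$ and $K=\det I\!I/\det I-1$ be the mean and Gaussian curvature. For $\varepsilon\in\mathbb R$ let $W_\varepsilon(M^2)$ be the set of fronts $f:M^2\to H^3$ that have a regular point and for which each point has a neighborhood $U$ with a unit normal field $\nu$ such that (i) for some $\delta_0\in\mathbb R$ the parallel front $f_{\delta_0}$ is an immersion on $U$ satisfying $a(H-1)+bK=0$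 for some real constants $(a,b)\neq(0,0)$, and (ii) $2\varepsilon(H-1)+(1-\varepsilon)K=0$ at the regular points of $f$ in $U$. Let $\varepsilon>0$ and let $f\in W_\varepsilon(M^2)$, where $f(M^2)$ is not contained in a geodesic sphere. Then $f$ has a global unit normal field $\nu$, making $(f,\nu)$ an immersion, with $2\varepsilon(H-1)+(1-\varepsilon)K=0$ at all regular points, and this $\nu$ is unique. There is a real number $\delta$ such that $f_\delta:M^2\to H^3$ (with unit normal $\nu_\delta$) is a CMC-1 front, i.e. a front with regular points, at all of which its mean curvature is $1$. If $f(M^2)$ is not contained in a horosphere, then $\delta$ is the only real number with this property. Moreover: 1. The singular points of $f_\delta$ are isolated in $M^2$. 2. Call a smooth local complex coordinate $z$ of $M^2$ conformal if $I_{f_\delta}=\lambda|dz|^2$ with a function $\lambda\ge0$. Around each singular point of $f_\delta$ there is a conformal coordinate. In every conformal coordinate $z$, the Hopf differential $Q=q\,dz^2$ of $f_\delta$, that is, the $(2,0)$-part of $-I\!I_{f_\delta}$ ($q=\langle\partial_z f_\delta,\partial_z\nu_\delta\rangle$), is holomorphic, and a point of the domain of $z$ is a singular point of $f_\delta$ if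 and only if $Q$ vanishes and $d(f+\nu)\ne0$ there. In particular all singular points of $f_\delta$ are zeros of $Q$. -/

import Mathlib

open scoped Manifold ContDiff Topology

noncomputable section

namespace LWFront

/-- The vector space underlying Lorentz-Minkowski 4-space. -/
abbrev R41 : Type := Fin 4 → ℝ

/-- The Lorentz metric of signature `(-,+,+,+)`. -/
def lor (x y : R41) : ℝ := -(x 0 * y 0) + x 1 * y 1 + x 2 * y 2 + x 3 * y 3

/-- Hyperbolic 3-space as the upper sheet of the two-sheeted hyperboloid. -/
def H3 : Set R41 := {x | lor x x = -1 ∧ 0 < x 0}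

section Surface

variable {M : Type*} [TopologicalSpace M] [ChartedSpace (EuclideanSpace ℝ (Fin 2)) M]

/-- The differential at `p` of a map from a surface to `R41`. -/
def dmap (f : M → R41) (p : M) : EuclideanSpace ℝ (Fin 2) →L[ℝ] R41 :=
  mfderiv (𝓡 2) 𝓘(ℝ, R41) f p

/-- `p` is a regular point of `f`: the differential of `f` at `p` is injective. -/
def IsRegularAt (f : M → R41) (p : M) : Prop :=
  Function.Injective (dmap f p)

/-- The set of singular points of `f`. -/
def singularSet (f : M → R41) : Set M := {p | ¬ IsRegularAt f p}

/-- A basis of the tangent space of the surface. -/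
def tvec (i : Fin 2) : EuclideanSpace ℝ (Fin 2) := EuclideanSpace.single i 1

/-- The matrix of the first fundamental form `I = ⟨df, df⟩` at `p`. -/
def firstFF (f : M → R41) (p : M) : Matrix (Fin 2) (Fin 2) ℝ :=
  Matrix.of fun i j => lor (dmap f p (tvec i)) (dmap f p (tvec j))

/-- The matrix of the second fundamental form `II = -⟨df, dν⟩` at `p`. -/
def secondFF (f ν : M → R41) (p : M) : Matrix (Fin 2) (Fin 2) ℝ :=
  Matrix.of fun i j => - lor (dmap f p (tvec i)) (dmap ν p (tvec j))

/-- Mean curvature, half the trace of the shape operator `A` (where `dν = -df ∘ A`).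
It is only used at regular points of `f`. -/
def meanCurv (f ν : M → R41) (p : M) : ℝ :=
  ((firstFF f p)⁻¹ * secondFF f ν p).trace / 2

/-- Gaussian curvature of a surface in hyperbolic 3-space: by the Gauss equation it is the
product `det II / det I` of the principal curvatures plus the ambient curvature `-1`.
It is only used at regular points of `f`. -/
def gaussCurv (f ν : M → R41) (p : M) : ℝ :=
  (secondFF f ν p).det / (firstFF f p).det - 1

/-- On the open set `U` the map `f` is a front in `H3` with unit normal field `ν`:
`f` and `ν` are smooth, `ν` is de Sitter valued, `⟨f, ν⟩ = 0`, `⟨df, ν⟩ = 0`, and the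
Legendrian lift `(f, ν)` is an immersion. -/
structure IsFrontOn (f ν : M → R41) (U : Set M) : Prop where
  smooth : ContMDiffOn (𝓡 2) 𝓘(ℝ, R41) ∞ f U
  smooth_normal : ContMDiffOn (𝓡 2) 𝓘(ℝ, R41) ∞ ν U
  mem_H3 : ∀ p ∈ U, f p ∈ H3
  unit : ∀ p ∈ U, lor (ν p) (ν p) = 1
  orth : ∀ p ∈ U, lor (f p) (ν p) = 0
  normal : ∀ p ∈ U, ∀ v, lor (dmap f p v) (ν p) = 0
  immersion : ∀ p ∈ U, ∀ v, dmap f p v = 0 → dmap ν p v = 0 → v = 0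

/-- The parallel front `f_δ = (cosh δ) f + (sinh δ) ν`. -/
def parallel (f ν : M → R41) (δ : ℝ) : M → R41 :=
  fun p => Real.cosh δ • f p + Real.sinh δ • ν p

/-- The unit normal field `ν_δ = (cosh δ) ν + (sinh δ) f` of the parallel front. -/
def parallelNormal (f ν : M → R41) (δ : ℝ) : M → R41 :=
  fun p => Real.cosh δ • ν p + Real.sinh δ • f p

/-- On `U`, the map `f` with unit normal field `ν` is a horospherical linear Weingarten
immersion. -/
def IsHLWImmersionOn (f ν : M → R41) (U : Set M) : Prop :=
  (∀ p ∈ U, IsRegularAt f p) ∧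
    ∃ a b : ℝ, a ^ 2 + b ^ 2 ≠ 0 ∧
      ∀ p ∈ U, a * (meanCurv f ν p - 1) + b * gaussCurv f ν p = 0

/-- The relation `2ε(H - 1) + (1 - ε)K = 0` at the regular points of `f` in `U`. -/
def WeingartenRel (ε : ℝ) (f ν : M → R41) (U : Set M) : Prop :=
  ∀ p ∈ U, IsRegularAt f p →
    2 * ε * (meanCurv f ν p - 1) + (1 - ε) * gaussCurv f ν p = 0

/-- The class `W_ε(M)` for real `ε`: horospherical linear Weingarten fronts `f : M → H3`
(not assumed co-orientable, having regular points) with `2ε(H - 1) + (1 - ε)K = 0`. Near each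
point, with respect to a local unit normal field, some parallel front is a horospherical linear
Weingarten immersion and the relation holds at the regular points of `f`. -/
def W (ε : ℝ) : Set (M → R41) :=
  {f | (∃ p, IsRegularAt f p) ∧
    ∀ p : M, ∃ U : Set M, IsOpen U ∧ p ∈ U ∧ ∃ ν : M → R41,
      IsFrontOn f ν U ∧
      (∃ δ₀ : ℝ, IsHLWImmersionOn (parallel f ν δ₀) (parallelNormal f ν δ₀) U) ∧
      WeingartenRel ε f ν U}

/-- `ν` is a global unit normal field of `f` for which the relation of `W ε` holds. -/
def IsWeingartenNormal (ε : ℝ) (f ν : M → R41) : Prop :=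
  IsFrontOn f ν Set.univ ∧ WeingartenRel ε f ν Set.univ

/-- `f` with unit normal field `ν` is a CMC-1 front in `H3`: a front with regular points,
whose mean curvature is `1` at all of them. -/
def IsCMC1Front (f ν : M → R41) : Prop :=
  IsFrontOn f ν Set.univ ∧ (∃ p, IsRegularAt f p) ∧
    ∀ p, IsRegularAt f p → meanCurv f ν p = 1

/-- The image of `f` lies in a geodesic sphere of `H3`: the points `x` of `H3` at a fixed distance
`r` from `c` are those with `⟨x, c⟩ = -cosh r`. -/
def InGeodesicSphere (f : M → R41) : Prop :=
  ∃ c ∈ H3, ∃ r : ℝ, ∀ p, lor (f p) c = -Real.cosh r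

/-- The image of `f` lies in a horosphere of `H3`. -/
def InHorosphere (f : M → R41) : Prop :=
  ∃ c : R41, c ≠ 0 ∧ lor c c = 0 ∧ ∀ p, lor (f p) c = -1

/-- Partial derivative of `f` with respect to `x` in the coordinate `z = x + i y`. -/
def dx (z : OpenPartialHomeomorph M ℂ) (f : M → R41) (w : ℂ) : R41 :=
  fderiv ℝ (f ∘ z.symm) w 1

/-- Partial derivative of `f` with respect to `y` in the coordinate `z = x + i y`. -/
def dy (z : OpenPartialHomeomorph M ℂ) (f : M → R41) (w : ℂ) : R41 :=
  fderiv ℝ (f ∘ z.symm) w Complex.I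

/-- `z` is a smooth complex-valued local coordinate of `M` with respect to which the first
fundamental form of `f` is Hermitian, that is, a (possibly vanishing) multiple of `|dz|^2`. -/
structure IsConformalCoord (z : OpenPartialHomeomorph M ℂ) (f : M → R41) : Prop where
  smooth : ContMDiffOn (𝓡 2) 𝓘(ℝ, ℂ) ∞ z z.source
  smooth_symm : ContMDiffOn 𝓘(ℝ, ℂ) (𝓡 2) ∞ z.symm z.target
  norm_eq : ∀ w ∈ z.target, lor (dx z f w) (dx z f w) = lor (dy z f w) (dy z f w)
  orth : ∀ w ∈ z.target, lor (dx z f w) (dy z f w) = 0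

/-- The coefficient `q` of the Hopf differential `Q = q dz^2`, the `(2,0)`-part of
`-II = ⟨df, dν⟩`, in the coordinate `z`: here `q = ⟨f_z, ν_z⟩` with `∂_z = (∂_x - i ∂_y) / 2` and
the complex bilinear extension of the (symmetric) form `⟨df, dν⟩`. -/
def hopf (z : OpenPartialHomeomorph M ℂ) (f ν : M → R41) (w : ℂ) : ℂ :=
  (((lor (dx z f w) (dx z ν w) - lor (dy z f w) (dy z ν w) : ℝ) : ℂ)
    - 2 * Complex.I * ((lor (dx z f w) (dy z ν w) : ℝ) : ℂ)) / 4

end Surface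

end LWFront

end

noncomputable section

namespace LWFront

/-! ### Lorentzian linear algebra -/

/-! Write A = df, B = dν and C = A + B = d(f + ν). All three take values in the plane orthogonal to
f and ν, and `OrthoPair.exists_frame` identifies this plane with ℂ so that metric and area form
become the real and imaginary parts of conj(x)·y. With the shape operator S one has C = A(1 - S), so
the mixed area term of A, C and the area term of C are 2(1 - H) and K - 2(H - 1) times the area term
of A. The Weingarten equation therefore becomes `LinRel 1 (ε - 1)`, which keeps its meaning at
singular points. A parallel displacement multiplies C by e^δ, and by `linRel_parallel` the equation
H = 1 for f_δ is `LinRel 1 (e^(2δ) - 1)` for f. This forces the choice e^(2δ) = ε.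

For a front with H = 1, symmetry of the second fundamental form and `LinRel 1 0` together say that
conj(A u)·C v is symmetric in u and v. Hence A vanishes at each singular point, and where C ≠ 0 the
first fundamental form is a multiple of ⟨C, C⟩, the metric induced by the null vector f + ν. This
yields conformal coordinates (`PlaneFront.exists_conformal_coord`). In them the Hopf differential is
holomorphic (`differentiableOn_planeHopf`) and vanishes exactly where A = 0 or C = 0, which never
happens at the same point.

Isolation of zeros and connectedness leave three cases (`forall_or_forall_isolated`): f_δ is
constant and f lies in a geodesic sphere; f + ν is constant, so f lies in a horosphere and f_δ has
no singular points; or the zeros are isolated. A second value of δ would give two independent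
relations, hence C = 0 on an open set.

The global normal requires that regular points are dense and that ν and -ν cannot both satisfy the
relation on an open set of regular points. The degenerate configurations left to exclude have
constant principal curvatures, and `PlaneFront.cartan` restricts these. -/

theorem lor_comm (x y : R41) : lor x y = lor y x := by
  simp only [lor]; ring

theorem lor_add_left (x y z : R41) : lor (x + y) z = lor x z + lor y z := by
  simp only [lor, Pi.add_apply]; ring

theorem lor_add_right (x y z : R41) : lor x (y + z) = lor x y + lor x z := by
  simp only [lor, Pi.add_apply]; ring

theorem lor_smul_left (r : ℝ) (x y : R41) : lor (r • x) y = r * lor x y := by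
  simp only [lor, Pi.smul_apply, smul_eq_mul]; ring

theorem lor_smul_right (r : ℝ) (x y : R41) : lor x (r • y) = r * lor x y := by
  simp only [lor, Pi.smul_apply, smul_eq_mul]; ring

theorem lor_neg_left (x y : R41) : lor (-x) y = - lor x y := by
  simp only [lor, Pi.neg_apply]; ring

theorem lor_neg_right (x y : R41) : lor x (-y) = - lor x y := by
  simp only [lor, Pi.neg_apply]; ring

theorem lor_sub_right (x y z : R41) : lor x (y - z) = lor x y - lor x z := by
  simp only [lor, Pi.sub_apply]; ring

theorem lor_zero_left (x : R41) : lor 0 x = 0 := by simp [lor]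

theorem lor_zero_right (x : R41) : lor x 0 = 0 := by simp [lor]

/-- The Lorentz metric as a continuous bilinear map. -/
def lorL : R41 →L[ℝ] R41 →L[ℝ] ℝ :=
  (LinearMap.mk₂ ℝ lor lor_add_left lor_smul_left lor_add_right lor_smul_right).toContinuousBilinearMap

theorem lorL_apply (x y : R41) : lorL x y = lor x y := rfl

/-- The determinant of four vectors of `R41`. For an orthonormal pair `F, N` it restricts to an
area form on the orthogonal complement of `F` and `N`. -/
def om (F N x y : R41) : ℝ :=
  (F 0 * N 1 - F 1 * N 0) * (x 2 * y 3 - x 3 * y 2)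
  - (F 0 * N 2 - F 2 * N 0) * (x 1 * y 3 - x 3 * y 1)
  + (F 0 * N 3 - F 3 * N 0) * (x 1 * y 2 - x 2 * y 1)
  + (F 1 * N 2 - F 2 * N 1) * (x 0 * y 3 - x 3 * y 0)
  - (F 1 * N 3 - F 3 * N 1) * (x 0 * y 2 - x 2 * y 0)
  + (F 2 * N 3 - F 3 * N 2) * (x 0 * y 1 - x 1 * y 0)

theorem om_add_left (F N x y z : R41) : om F N (x + y) z = om F N x z + om F N y z := by
  simp only [om, Pi.add_apply]; ring

theorem om_add_right (F N x y z : R41) : om F N x (y + z) = om F N x y + om F N x z := by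
  simp only [om, Pi.add_apply]; ring

theorem om_smul_left (F N : R41) (r : ℝ) (x y : R41) : om F N (r • x) y = r * om F N x y := by
  simp only [om, Pi.smul_apply, smul_eq_mul]; ring

theorem om_smul_right (F N : R41) (r : ℝ) (x y : R41) : om F N x (r • y) = r * om F N x y := by
  simp only [om, Pi.smul_apply, smul_eq_mul]; ring

theorem om_swap (F N x y : R41) : om F N x y = - om F N y x := by
  simp only [om]; ring

theorem om_self (F N x : R41) : om F N x x = 0 := by
  simp only [om]; ring

theorem om_zero_left (F N x : R41) : om F N 0 x = 0 := by simp [om]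

theorem om_zero_right (F N x : R41) : om F N x 0 = 0 := by simp [om]

theorem om_neg_neg (F N x y : R41) : om F (-N) x y = - om F N x y := by
  simp only [om, Pi.neg_apply]; ring

theorem om_parallel (F N x y : R41) (c s : ℝ) (h : c ^ 2 - s ^ 2 = 1) :
    om (c • F + s • N) (c • N + s • F) x y = om F N x y := by
  have : om (c • F + s • N) (c • N + s • F) x y = (c ^ 2 - s ^ 2) * om F N x y := by
    simp only [om, Pi.add_apply, Pi.smul_apply, smul_eq_mul]; ring
  rw [this, h, one_mul]

/-- The matrix of mutual products is the product of two coordinate matrices with the metric in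
between; the sign is the determinant of the metric. -/
theorem om_gram (F N e x y z : R41) :
    om F N e x * om F N y z = - Matrix.det !![lor F F, lor F N, lor F y, lor F z;
      lor N F, lor N N, lor N y, lor N z; lor e F, lor e N, lor e y, lor e z;
      lor x F, lor x N, lor x y, lor x z] := by
  have h1 : ∀ x y, om F N x y =
      Matrix.det !![F 0, F 1, F 2, F 3; N 0, N 1, N 2, N 3; x 0, x 1, x 2, x 3;
        y 0, y 1, y 2, y 3] := by
    intro x y
    simp [om, Matrix.det_succ_row_zero, Fin.sum_univ_succ, Fin.succAbove]
    ring
  have h2 : !![lor F F, lor F N, lor F y, lor F z;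
      lor N F, lor N N, lor N y, lor N z; lor e F, lor e N, lor e y, lor e z;
      lor x F, lor x N, lor x y, lor x z] =
      !![F 0, F 1, F 2, F 3; N 0, N 1, N 2, N 3; e 0, e 1, e 2, e 3; x 0, x 1, x 2, x 3] *
      !![-1, 0, 0, 0; 0, 1, 0, 0; 0, 0, 1, 0; 0, 0, 0, 1] *
      (!![F 0, F 1, F 2, F 3; N 0, N 1, N 2, N 3; y 0, y 1, y 2, y 3;
        z 0, z 1, z 2, z 3]).transpose := by
    ext i j
    fin_cases i <;> fin_cases j <;>
      simp [lor, Matrix.mul_apply, Fin.sum_univ_succ] <;> ring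
  have h3 : Matrix.det !![(-1 : ℝ), 0, 0, 0; 0, 1, 0, 0; 0, 0, 1, 0; 0, 0, 0, 1] = -1 := by
    simp [Matrix.det_succ_row_zero, Fin.sum_univ_succ, Fin.succAbove]
  rw [h2, Matrix.det_mul, Matrix.det_mul, Matrix.det_transpose, ← h1, ← h1, h3]
  ring

/-- Cramer's relation: five vectors of a four-dimensional space are dependent with their 4×4 minors
as coefficients; the relation is paired with `v`. -/
theorem om_plucker (F N e x y v : R41) :
    lor v F * om N e x y - lor v N * om F e x y + lor v e * om F N x y - lor v x * om F N e y
      + lor v y * om F N e x = 0 := by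
  simp only [om, lor]; ring

/-- `F`, `N` is an orthonormal pair with `F` timelike and `N` spacelike. -/
structure OrthoPair (F N : R41) : Prop where
  ff : lor F F = -1
  nn : lor N N = 1
  fn : lor F N = 0

/-- `x` is orthogonal to `F` and to `N`. -/
def Perp (F N x : R41) : Prop := lor F x = 0 ∧ lor N x = 0

theorem Perp.add {F N x y : R41} (hx : Perp F N x) (hy : Perp F N y) : Perp F N (x + y) :=
  ⟨by rw [lor_add_right, hx.1, hy.1, add_zero], by rw [lor_add_right, hx.2, hy.2, add_zero]⟩

theorem Perp.smul {F N x : R41} (hx : Perp F N x) (r : ℝ) : Perp F N (r • x) :=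
  ⟨by rw [lor_smul_right, hx.1, mul_zero], by rw [lor_smul_right, hx.2, mul_zero]⟩

/-- Eliminating the time coordinate of `x` and applying Lagrange's identity to the space parts
writes (F 0)² ⟨x, x⟩ as a sum of squares that contains the squared space coordinates of `x`. -/
theorem lor_self_nonneg_of_timelike {F x : R41} (hF : lor F F = -1) (hx : lor F x = 0) :
    0 ≤ lor x x ∧ (lor x x = 0 → x = 0) := by
  simp only [lor] at *
  have e1 : F 0 ^ 2 = 1 + F 1 ^ 2 + F 2 ^ 2 + F 3 ^ 2 := by linarith
  have e2 : F 0 * x 0 = F 1 * x 1 + F 2 * x 2 + F 3 * x 3 := by linarith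
  have key : F 0 ^ 2 * (-(x 0 * x 0) + x 1 * x 1 + x 2 * x 2 + x 3 * x 3) =
      (x 1 ^ 2 + x 2 ^ 2 + x 3 ^ 2) + (F 1 * x 2 - F 2 * x 1) ^ 2
        + (F 1 * x 3 - F 3 * x 1) ^ 2 + (F 2 * x 3 - F 3 * x 2) ^ 2 := by
    have : F 0 ^ 2 * (-(x 0 * x 0) + x 1 * x 1 + x 2 * x 2 + x 3 * x 3) =
      F 0 ^ 2 * (x 1 * x 1 + x 2 * x 2 + x 3 * x 3) - (F 0 * x 0) ^ 2 := by ring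
    rw [this, e1, e2]; ring
  have hpos : 0 < F 0 ^ 2 := by rw [e1]; positivity
  constructor
  · by_contra! h
    have := mul_neg_of_pos_of_neg hpos h
    rw [key] at this
    have : 0 ≤ (x 1 ^ 2 + x 2 ^ 2 + x 3 ^ 2) + (F 1 * x 2 - F 2 * x 1) ^ 2
        + (F 1 * x 3 - F 3 * x 1) ^ 2 + (F 2 * x 3 - F 3 * x 2) ^ 2 := by positivity
    linarith
  · intro h
    rw [h, mul_zero] at key
    have q1 := sq_nonneg (x 1)
    have q2 := sq_nonneg (x 2)
    have q3 := sq_nonneg (x 3)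
    have q4 := sq_nonneg (F 1 * x 2 - F 2 * x 1)
    have q5 := sq_nonneg (F 1 * x 3 - F 3 * x 1)
    have q6 := sq_nonneg (F 2 * x 3 - F 3 * x 2)
    have z1 : x 1 = 0 := pow_eq_zero_iff (two_ne_zero) |>.1 (by linarith)
    have z2 : x 2 = 0 := pow_eq_zero_iff (two_ne_zero) |>.1 (by linarith)
    have z3 : x 3 = 0 := pow_eq_zero_iff (two_ne_zero) |>.1 (by linarith)
    have z0 : x 0 = 0 := by
      have : F 0 ≠ 0 := fun h0 => by simp [h0] at hpos
      rw [z1, z2, z3] at e2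
      simpa [this] using e2
    ext i
    fin_cases i <;> simpa

theorem Perp.om_exchange {F N e x y : R41} (he : Perp F N e) :
    lor e e * om F N x y = lor e x * om F N e y - lor e y * om F N e x := by
  have := om_plucker F N e x y e
  rw [lor_comm e F, lor_comm e N, he.1, he.2] at this
  linarith

namespace OrthoPair

variable {F N : R41}

theorem om_mul_om (h : OrthoPair F N) {e x y z : R41} (he : Perp F N e) (hx : Perp F N x) (hy : Perp F N y)
    (hz : Perp F N z) : om F N e x * om F N y z = lor e y * lor x z - lor e z * lor x y := by
  rw [om_gram]
  simp only [h.ff, h.nn, h.fn, hy.1, hy.2, hz.1, hz.2, lor_comm e F, lor_comm e N, lor_comm x F,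
    lor_comm x N, lor_comm N F, he.1, he.2, hx.1, hx.2]
  simp [Matrix.det_succ_row_zero, Fin.sum_univ_succ, Fin.succAbove]
  ring

theorem lor_self_nonneg (h : OrthoPair F N) {x : R41} (hx : Perp F N x) : 0 ≤ lor x x :=
  (lor_self_nonneg_of_timelike h.ff hx.1).1

theorem eq_zero_of_lor_self (h : OrthoPair F N) {x : R41} (hx : Perp F N x) (h0 : lor x x = 0) : x = 0 :=
  (lor_self_nonneg_of_timelike h.ff hx.1).2 h0

theorem lor_self_pos (h : OrthoPair F N) {x : R41} (hx : Perp F N x) (h0 : x ≠ 0) : 0 < lor x x :=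
  lt_of_le_of_ne (h.lor_self_nonneg hx) fun h' => h0 (h.eq_zero_of_lor_self hx h'.symm)

/-- In complex terms conj(x)·y = 0. The argument is Lagrange's identity ⟨x, y⟩² + om² = ⟨x, x⟩⟨y,
y⟩. -/
theorem eq_zero_or_eq_zero (h : OrthoPair F N) {x y : R41} (hx : Perp F N x) (hy : Perp F N y)
    (h1 : lor x y = 0) (h2 : om F N x y = 0) : x = 0 ∨ y = 0 := by
  have := h.om_mul_om hx hy hx hy
  rw [h2, h1, zero_mul, zero_mul, sub_zero] at this
  rcases mul_eq_zero.1 this.symm with h' | h'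
  · exact Or.inl (h.eq_zero_of_lor_self hx h')
  · exact Or.inr (h.eq_zero_of_lor_self hy h')

/-- The complement of an orthonormal pair is identified with `ℂ` in such a way that
`⟨x, y⟩ + i om x y` becomes `conj x * y`. -/
theorem exists_frame (h : OrthoPair F N) {e : R41} (he : Perp F N e) (he0 : e ≠ 0) :
    ∃ κ : R41 →ₗ[ℝ] ℂ, (∀ x y, Perp F N x → Perp F N y →
      (κ x).re * (κ y).re + (κ x).im * (κ y).im = lor x y ∧
      (κ x).re * (κ y).im - (κ x).im * (κ y).re = om F N x y) ∧
      ∀ x, Perp F N x → κ x = 0 → x = 0 := by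
  have hp := h.lor_self_pos he he0
  set r := Real.sqrt (lor e e) with hr
  have hr2 : r ^ 2 = lor e e := Real.sq_sqrt hp.le
  have hr0 : r ≠ 0 := (Real.sqrt_pos.2 hp).ne'
  let κ : R41 →ₗ[ℝ] ℂ :=
    { toFun := fun x => ⟨lor e x / r, om F N e x / r⟩
      map_add' := fun x y => by
        apply Complex.ext <;> simp [lor_add_right, om_add_right, add_div]
      map_smul' := fun c x => by
        apply Complex.ext <;> simp [lor_smul_right, om_smul_right, mul_div_assoc] }
  have main : ∀ x y, Perp F N x → Perp F N y →
      (κ x).re * (κ y).re + (κ x).im * (κ y).im = lor x y ∧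
      (κ x).re * (κ y).im - (κ x).im * (κ y).re = om F N x y := by
    intro x y hx hy
    have h1 := h.om_mul_om he hx he hy
    have h2 := he.om_exchange (x := x) (y := y)
    simp only [κ, LinearMap.coe_mk, AddHom.coe_mk]
    constructor
    · field_simp
      rw [h1, hr2, lor_comm x e]; ring
    · field_simp
      rw [hr2]; linarith
  refine ⟨κ, main, fun x hx h0 => h.eq_zero_of_lor_self hx ?_⟩
  rw [← (main x x hx hx).1, h0]; simp

end OrthoPair

end LWFront

namespace LWFront

/-! ### Fronts at a point -/

theorem OrthoPair.eq_zero_of_lor_eq_zero {F N : R41} (h : OrthoPair F N) {e e' y : R41}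
    (he : Perp F N e) (he' : Perp F N e') (hy : Perp F N y) (hom : om F N e e' ≠ 0)
    (h1 : lor e y = 0) (h2 : lor e' y = 0) : y = 0 := by
  have := h.om_mul_om he he' he hy
  rw [h1, h2] at this
  have h3 : om F N e y = 0 := by
    simpa [hom] using this
  rcases h.eq_zero_or_eq_zero he hy h1 h3 with h4 | h4
  · rw [h4, om_zero_left] at hom
    exact absurd rfl hom
  · exact h4

theorem OrthoPair.smul_eq_of_conformal {F N : R41} (h : OrthoPair F N) {e e' x : R41} {r : ℝ}
    (he : Perp F N e) (he' : Perp F N e') (hx : Perp F N x) (h1 : lor e e = r)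
    (h2 : lor e' e' = r) (h3 : lor e e' = 0) (hr : r ≠ 0) :
    r • x = lor x e • e + lor x e' • e' := by
  have hom : om F N e e' ≠ 0 := by
    intro h0
    have := h.om_mul_om he he' he he'
    rw [h0, h1, h2, h3] at this
    simp [hr] at this
  rw [← sub_eq_zero]
  have hp : Perp F N (r • x - (lor x e • e + lor x e' • e')) := by
    rw [sub_eq_add_neg, ← neg_one_smul ℝ]
    exact (hx.smul _).add (((he.smul _).add (he'.smul _)).smul _)
  refine h.eq_zero_of_lor_eq_zero he he' hp hom ?_ ?_
  · simp only [lor_sub_right, lor_add_right, lor_smul_right, h1, h3, lor_comm x e]; ring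
  · simp only [lor_sub_right, lor_add_right, lor_smul_right, h2, lor_comm e' e, h3,
      lor_comm x e']; ring

theorem OrthoPair.exists_relation {F N : R41} (h : OrthoPair F N) {x y : R41}
    (hx : Perp F N x) (hy : Perp F N y) (h0 : om F N x y = 0) :
    ∃ r s : ℝ, (r ≠ 0 ∨ s ≠ 0) ∧ r • x + s • y = 0 := by
  by_cases hx0 : x = 0
  · exact ⟨1, 0, Or.inl one_ne_zero, by simp [hx0]⟩
  -- This multiple of the component of `y` orthogonal to `x` has square ⟨x, x⟩ times the square of
  -- the area, which is zero.
  · refine ⟨-lor x y, lor x x, Or.inr (h.lor_self_pos hx hx0).ne', ?_⟩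
    apply h.eq_zero_of_lor_self ((hx.smul _).add (hy.smul _))
    have := h.om_mul_om hx hy hx hy
    rw [h0, lor_comm y x] at this
    simp only [lor_add_left, lor_add_right, lor_smul_left, lor_smul_right, lor_comm y x]
    linear_combination - lor x x * this

variable {E : Type*} [NormedAddCommGroup E] [NormedSpace ℝ E]

theorem OrthoPair.exists_ker {F N : R41} (h : OrthoPair F N) (hE : Module.finrank ℝ E = 2)
    {L : E →L[ℝ] R41} (hL : ∀ u, Perp F N (L u)) (h0 : ∀ u v, om F N (L u) (L v) = 0) :
    ∃ w, w ≠ 0 ∧ L w = 0 := by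
  have : FiniteDimensional ℝ E := .of_finrank_pos (by omega)
  let b := Module.finBasisOfFinrankEq ℝ E hE
  obtain ⟨r, s, hrs, hw⟩ := h.exists_relation (hL (b 0)) (hL (b 1)) (h0 _ _)
  refine ⟨r • b 0 + s • b 1, fun h' => ?_, by simpa using hw⟩
  have hli : LinearIndependent ℝ ![b 0, b 1] := by
    convert b.linearIndependent using 1
    ext i; fin_cases i <;> rfl
  have := LinearIndependent.pair_iff.1 hli r s h'
  tauto

theorem om_eq_zero_of_ker {F N : R41} (hE : Module.finrank ℝ E = 2)
    {L : E →L[ℝ] R41} {w : E} (hw : w ≠ 0) (h0 : L w = 0) (u v : E) :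
    om F N (L u) (L v) = 0 := by
  have : FiniteDimensional ℝ E := .of_finrank_pos (by omega)
  by_cases hli : LinearIndependent ℝ ![w, u]
  · have hs := hli.span_eq_top_of_card_eq_finrank' (by simp [hE])
    have hv : v ∈ Submodule.span ℝ (Set.range ![w, u]) := hs ▸ Submodule.mem_top
    simp only [Matrix.range_cons, Matrix.range_empty, Set.union_empty, Set.singleton_union] at hv
    obtain ⟨r, s, rfl⟩ := Submodule.mem_span_pair.1 hv
    simp [h0, om_smul_right, om_self]
  · rw [LinearIndependent.pair_iff' hw] at hli
    push Not at hli
    obtain ⟨r, rfl⟩ := hli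
    simp [h0, om_zero_left]

/-- The first order data at a point of a front: `A` and `B` are the differentials of the front and
of its unit normal field. -/
structure PtFront (F N : R41) (A B : E →L[ℝ] R41) : Prop where
  pair : OrthoPair F N
  perp : ∀ u, Perp F N (A u)
  perp' : ∀ u, Perp F N (B u)
  symm : ∀ u v, lor (A u) (B v) = lor (A v) (B u)
  imm : ∀ u, A u = 0 → B u = 0 → u = 0

/-- The linear Weingarten relation with coefficients `α`, `β` in a form that does not degenerate at
singular points. -/
def LinRel (α β : ℝ) (F N : R41) (A B : E →L[ℝ] R41) : Prop :=
  ∀ u v, α * (om F N (A u) (A v + B v) - om F N (A v) (A u + B u))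
    + β * om F N (A u + B u) (A v + B v) = 0

namespace PtFront

variable {F N : R41} {A B : E →L[ℝ] R41}

theorem perp_add (h : PtFront F N A B) (u : E) : Perp F N (A u + B u) :=
  (h.perp u).add (h.perp' u)

theorem symm_add (h : PtFront F N A B) (u v : E) :
    lor (A u) (A v + B v) = lor (A v) (A u + B u) := by
  rw [lor_add_right, lor_add_right, h.symm u v, lor_comm (A u) (A v)]

theorem imm_add (h : PtFront F N A B) (u : E) (h1 : A u = 0) (h2 : A u + B u = 0) : u = 0 :=
  h.imm u h1 (by rwa [h1, zero_add] at h2)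

theorem parallel (h : PtFront F N A B) {c s : ℝ} (hcs : c ^ 2 - s ^ 2 = 1) :
    PtFront (c • F + s • N) (c • N + s • F) (c • A + s • B) (c • B + s • A) where
  pair := by
    constructor <;>
    · simp only [lor_add_left, lor_add_right, lor_smul_left, lor_smul_right, h.pair.ff, h.pair.nn,
        h.pair.fn, lor_comm N F]
      linarith
  perp u := by
    constructor <;>
      simp [lor_add_left, lor_add_right, lor_smul_left, lor_smul_right, (h.perp u).1,
        (h.perp u).2, (h.perp' u).1, (h.perp' u).2]
  perp' u := by
    constructor <;>
      simp [lor_add_left, lor_add_right, lor_smul_left, lor_smul_right, (h.perp u).1,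
        (h.perp u).2, (h.perp' u).1, (h.perp' u).2]
  symm u v := by
    simp only [add_apply, smul_apply, lor_add_left,
      lor_add_right, lor_smul_left, lor_smul_right]
    rw [h.symm u v, lor_comm (B u) (A v), lor_comm (B v) (A u), h.symm u v,
      lor_comm (B u) (B v), lor_comm (A u) (A v)]
  imm u h1 h2 := by
    simp only [add_apply, smul_apply] at h1 h2
    have e1 : A u = c • (c • A u + s • B u) - s • (c • B u + s • A u) := by
      have : c • (c • A u + s • B u) - s • (c • B u + s • A u) = (c ^ 2 - s ^ 2) • A u := by
        module
      rw [this, hcs, one_smul]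
    have e2 : B u = c • (c • B u + s • A u) - s • (c • A u + s • B u) := by
      have : c • (c • B u + s • A u) - s • (c • A u + s • B u) = (c ^ 2 - s ^ 2) • B u := by
        module
      rw [this, hcs, one_smul]
    rw [h1, h2] at e1 e2
    exact h.imm u (by simpa using e1) (by simpa using e2)

/-- At a singular point of a front with mean curvature one the differential vanishes. -/
theorem eq_zero_of_singular (h : PtFront F N A B) (hr : LinRel 1 0 F N A B)
    (hs : ¬ Function.Injective A) : A = 0 := by
  rw [injective_iff_map_eq_zero] at hs
  push Not at hs
  obtain ⟨u, h1, h2⟩ := hs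
  ext1 v
  have e1 := hr u v
  have e2 := h.symm_add u v
  rw [h1, om_zero_left] at e1
  rw [h1, lor_zero_left] at e2
  rw [← h1] at e1 e2
  -- For `u` in the kernel of A, symmetry of conj(A u)·C v gives conj(A v)·C u = 0, and C u ≠ 0
  -- because the lift is an immersion.
  rcases h.pair.eq_zero_or_eq_zero (h.perp v) (h.perp_add u) e2.symm (by linarith) with h3 | h3
  · exact h3
  · exact absurd (h.imm_add u h1 h3) h2

/-- The second relation gives a vector w with C w = 0. The first, with the symmetry, then gives
conj(A w)·C v = 0 for all v, while A w ≠ 0 by the immersion property. -/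
theorem add_eq_zero_of_linRel (h : PtFront F N A B) (hE : Module.finrank ℝ E = 2)
    (hr : LinRel 1 0 F N A B) (hr' : LinRel 0 1 F N A B) : A + B = 0 := by
  obtain ⟨w, hw, hw'⟩ := h.pair.exists_ker hE (L := A + B) (fun u => h.perp_add u)
    (fun u v => by simpa using hr' u v)
  rw [add_apply] at hw'
  ext1 v
  have e1 := hr w v
  have e2 := h.symm_add w v
  rw [hw'] at e1 e2
  rw [lor_zero_right] at e2
  rw [om_zero_left, om_zero_right] at e1
  rcases h.pair.eq_zero_or_eq_zero (h.perp w) (h.perp_add v) e2 (by linarith) with h3 | h3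
  · exact absurd (h.imm_add w h3 hw') hw
  · exact h3

/-- Symmetry of conj(A u)·C v makes conj(A v) a fixed complex multiple of C v, namely by conj(A
u₀)/C u₀; the factor is the squared modulus of this quotient. -/
theorem exists_conformal_factor (h : PtFront F N A B) (hr : LinRel 1 0 F N A B)
    {u₀ : E} (h0 : A u₀ + B u₀ ≠ 0) :
    ∃ μ : ℝ, ∀ u v, lor (A u) (A v) = μ * lor (A u + B u) (A v + B v) := by
  obtain ⟨κ, hκ, -⟩ := h.pair.exists_frame (h.perp_add u₀) h0
  set c := κ (A u₀ + B u₀)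
  set a := κ (A u₀)
  have hc : lor (A u₀ + B u₀) (A u₀ + B u₀) = c.re ^ 2 + c.im ^ 2 := by
    rw [← (hκ _ _ (h.perp_add u₀) (h.perp_add u₀)).1]; ring
  have hc0 := h.pair.lor_self_pos (h.perp_add u₀) h0
  have key : ∀ v, (κ (A v)).re * (c.re ^ 2 + c.im ^ 2) =
      (a.re * c.re - a.im * c.im) * (κ (A v + B v)).re
        + (a.re * c.im + a.im * c.re) * (κ (A v + B v)).im ∧
      (κ (A v)).im * (c.re ^ 2 + c.im ^ 2) =
      (a.re * c.im + a.im * c.re) * (κ (A v + B v)).re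
        - (a.re * c.re - a.im * c.im) * (κ (A v + B v)).im := by
    intro v
    have e1 := hr u₀ v
    have e2 := h.symm_add u₀ v
    rw [← (hκ _ _ (h.perp u₀) (h.perp_add v)).2, ← (hκ _ _ (h.perp v) (h.perp_add u₀)).2] at e1
    rw [← (hκ _ _ (h.perp u₀) (h.perp_add v)).1, ← (hκ _ _ (h.perp v) (h.perp_add u₀)).1] at e2
    constructor
    · linear_combination -c.re * e2 - c.im * e1
    · linear_combination -c.im * e2 + c.re * e1
  rw [hc] at hc0
  refine ⟨(a.re ^ 2 + a.im ^ 2) / (c.re ^ 2 + c.im ^ 2), fun u v => ?_⟩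
  rw [← (hκ _ _ (h.perp u) (h.perp v)).1, ← (hκ _ _ (h.perp_add u) (h.perp_add v)).1]
  obtain ⟨k1, k2⟩ := key u
  obtain ⟨k3, k4⟩ := key v
  rw [← eq_div_iff hc0.ne'] at k1 k2 k3 k4
  rw [k1, k2, k3, k4]
  field_simp
  ring

end PtFront

/-- The new A is (c - s)A + sC and the new C is (c + s)C. Since (c - s)(c + s) = 1, the mixed term
only gains 2s(c + s) = (c + s)² - 1 times the area term of C, which itself scales by (c + s)². -/
theorem linRel_parallel {F N : R41} {A B : E →L[ℝ] R41} {c s : ℝ} (hcs : c ^ 2 - s ^ 2 = 1)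
    (α β : ℝ) :
    LinRel α β (c • F + s • N) (c • N + s • F) (c • A + s • B) (c • B + s • A) ↔
      LinRel α (α * ((c + s) ^ 2 - 1) + β * (c + s) ^ 2) F N A B := by
  refine forall_congr' fun u => forall_congr' fun v => ?_
  have hC : ∀ w, (c • A + s • B) w + (c • B + s • A) w = (c + s) • (A w + B w) := by
    intro w
    simp only [add_apply, smul_apply]
    module
  rw [hC u, hC v]
  simp only [om_parallel _ _ _ _ _ _ hcs, add_apply,
    smul_apply, om_add_left, om_add_right, om_smul_left, om_smul_right]
  rw [om_swap F N (A v) (A u), om_swap F N (A v) (B u), om_swap F N (B v) (A u),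
    om_swap F N (B v) (B u)]
  refine Eq.congr ?_ rfl
  linear_combination (α * (om F N (A u) (A v) - om F N (B u) (B v))) * hcs

theorem linRel_comp {E' : Type*} [NormedAddCommGroup E'] [NormedSpace ℝ E'] {α β : ℝ}
    {F N : R41} {A B : E →L[ℝ] R41} (h : LinRel α β F N A B) (T : E' →L[ℝ] E) :
    LinRel α β F N (A.comp T) (B.comp T) :=
  fun u v => h (T u) (T v)

theorem PtFront.comp {E' : Type*} [NormedAddCommGroup E'] [NormedSpace ℝ E']
    {F N : R41} {A B : E →L[ℝ] R41} (h : PtFront F N A B) (T : E' ≃L[ℝ] E) :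
    PtFront F N (A.comp (T : E' →L[ℝ] E)) (B.comp (T : E' →L[ℝ] E)) where
  pair := h.pair
  perp u := h.perp _
  perp' u := h.perp' _
  symm u v := h.symm _ _
  imm u h1 h2 := by
    have := h.imm (T u) h1 h2
    simpa using this

/-! ### Curvatures and the linear Weingarten relation -/

theorem eq_tvec (u : EuclideanSpace ℝ (Fin 2)) : u = u 0 • tvec 0 + u 1 • tvec 1 := by
  ext i; fin_cases i <;> simp [tvec]

section Curvature

variable {F N : R41} {A B : EuclideanSpace ℝ (Fin 2) →L[ℝ] R41}

theorem linRel_iff_tvec {α β : ℝ} : LinRel α β F N A B ↔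
    α * (om F N (A (tvec 0)) (A (tvec 1) + B (tvec 1))
      - om F N (A (tvec 1)) (A (tvec 0) + B (tvec 0)))
    + β * om F N (A (tvec 0) + B (tvec 0)) (A (tvec 1) + B (tvec 1)) = 0 := by
  refine ⟨fun h => h _ _, fun h u v => ?_⟩
  rw [eq_tvec u, eq_tvec v]
  simp only [map_add, map_smul, om_add_left, om_add_right, om_smul_left, om_smul_right,
    om_self] at h ⊢
  rw [om_swap F N (A (tvec 1)) (A (tvec 0)), om_swap F N (A (tvec 1)) (B (tvec 0)),
    om_swap F N (B (tvec 1)) (A (tvec 0)), om_swap F N (B (tvec 1)) (B (tvec 0)),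
    om_swap F N (B (tvec 0)) (A (tvec 0)), om_swap F N (B (tvec 1)) (A (tvec 1))] at *
  linear_combination (u 0 * v 1 - u 1 * v 0) * h

theorem PtFront.om_tvec_ne_zero (h : PtFront F N A B) (hA : Function.Injective A) :
    om F N (A (tvec 0)) (A (tvec 1)) ≠ 0 := by
  intro h0
  obtain ⟨r, s, hrs, hw⟩ := h.pair.exists_relation (h.perp _) (h.perp _) h0
  rw [← map_smul, ← map_smul, ← map_add, map_eq_zero_iff A hA] at hw
  have h1 : r = 0 := by simpa [tvec] using congrArg (fun x : EuclideanSpace ℝ (Fin 2) => x 0) hw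
  have h2 : s = 0 := by simpa [tvec] using congrArg (fun x : EuclideanSpace ℝ (Fin 2) => x 1) hw
  tauto

/-- From C = A(1 - S), the mixed term is tr(1 - S) and the area term of C is det(1 - S), each times
the area term of A. The identities are verified in complex coordinates of the tangent plane. -/
theorem PtFront.curvature_eq (h : PtFront F N A B) (hA : Function.Injective A)
    (I II : Matrix (Fin 2) (Fin 2) ℝ) (hI : ∀ i j, I i j = lor (A (tvec i)) (A (tvec j)))
    (hII : ∀ i j, II i j = - lor (A (tvec i)) (B (tvec j))) :
    (I⁻¹ * II).trace / 2 - 1 = - (om F N (A (tvec 0)) (A (tvec 1) + B (tvec 1))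
      - om F N (A (tvec 1)) (A (tvec 0) + B (tvec 0))) / (2 * om F N (A (tvec 0)) (A (tvec 1))) ∧
    II.det / I.det - 1 = (om F N (A (tvec 0) + B (tvec 0)) (A (tvec 1) + B (tvec 1))
      - (om F N (A (tvec 0)) (A (tvec 1) + B (tvec 1))
      - om F N (A (tvec 1)) (A (tvec 0) + B (tvec 0)))) / om F N (A (tvec 0)) (A (tvec 1)) := by
  have hd := h.om_tvec_ne_zero hA
  have hA0 : A (tvec 0) ≠ 0 := fun h0 => hd (by rw [h0, om_zero_left])
  obtain ⟨κ, hκ, -⟩ := h.pair.exists_frame (h.perp (tvec 0)) hA0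
  have pA := h.perp
  have pB := h.perp'
  have hIdet : I.det = om F N (A (tvec 0)) (A (tvec 1)) ^ 2 := by
    rw [Matrix.det_fin_two, hI, hI, hI, hI, sq, h.pair.om_mul_om (pA _) (pA _) (pA _) (pA _)]
  have e1 : (I⁻¹ * II).trace = (I 1 1 * II 0 0 - I 0 1 * II 1 0 - I 1 0 * II 0 1
      + I 0 0 * II 1 1) / om F N (A (tvec 0)) (A (tvec 1)) ^ 2 := by
    rw [Matrix.inv_def, hIdet, Matrix.adjugate_fin_two, Matrix.trace_fin_two]
    simp [Matrix.mul_apply, Fin.sum_univ_two]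
    field_simp
    ring
  rw [e1, hIdet, Matrix.det_fin_two]
  simp only [hI, hII, om_add_left, om_add_right]
  have hκd := (hκ _ _ (pA (tvec 0)) (pA (tvec 1))).2
  rw [om_swap F N (A (tvec 1)) (A (tvec 0))]
  generalize om F N (A (tvec 0)) (A (tvec 1)) = d at *
  simp only [← (hκ _ _ (pA _) (pA _)).1, ← (hκ _ _ (pA _) (pB _)).1,
    ← (hκ _ _ (pA _) (pB _)).2, ← (hκ _ _ (pB _) (pA _)).2, ← (hκ _ _ (pB _) (pB _)).2]
  constructor
  · field_simp
    rw [← hκd]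
    ring
  · field_simp
    rw [← hκd]
    ring

end Curvature

end LWFront

namespace LWFront

/-! ### Partial derivatives in the plane -/

section Calculus

variable {G : Type*} [NormedAddCommGroup G] [NormedSpace ℝ G] {V : Set ℂ}

/-- The derivative of `F` in the direction `e`. -/
def pd (e : ℂ) (F : ℂ → G) (w : ℂ) : G := fderiv ℝ F w e

theorem fderiv_eq_pd (F : ℂ → G) (w e : ℂ) : fderiv ℝ F w e = pd e F w := rfl

theorem differentiableAt_of_smooth (hV : IsOpen V) {F : ℂ → G} (hF : ContDiffOn ℝ ∞ F V) {w : ℂ}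
    (hw : w ∈ V) : DifferentiableAt ℝ F w :=
  (hF.contDiffAt (hV.mem_nhds hw)).differentiableAt (by simp)

theorem smooth_fderiv (hV : IsOpen V) {F : ℂ → G} (hF : ContDiffOn ℝ ∞ F V) :
    ContDiffOn ℝ ∞ (fderiv ℝ F) V :=
  hF.fderiv_of_isOpen hV le_rfl

theorem smooth_pd (hV : IsOpen V) {F : ℂ → G} (hF : ContDiffOn ℝ ∞ F V) (e : ℂ) :
    ContDiffOn ℝ ∞ (pd e F) V :=
  (smooth_fderiv hV hF).clm_apply contDiffOn_const

theorem pd_congr (hV : IsOpen V) {F F' : ℂ → G} (h : ∀ w ∈ V, F w = F' w) {w : ℂ} (hw : w ∈ V)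
    (e : ℂ) : pd e F w = pd e F' w := by
  have : F =ᶠ[𝓝 w] F' := Filter.eventuallyEq_of_mem (hV.mem_nhds hw) h
  rw [pd, pd, this.fderiv_eq]

theorem pd_comm (hV : IsOpen V) {F : ℂ → G} (hF : ContDiffOn ℝ ∞ F V) {w : ℂ} (hw : w ∈ V)
    (e e' : ℂ) : pd e (pd e' F) w = pd e' (pd e F) w := by
  have h1 : ∀ e e', pd e (pd e' F) w = fderiv ℝ (fderiv ℝ F) w e e' := by
    intro e e'
    have hd := differentiableAt_of_smooth hV (smooth_fderiv hV hF) hw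
    change fderiv ℝ (fun w => fderiv ℝ F w e') w e = _
    rw [fderiv_clm_apply hd (differentiableAt_const _)]
    simp
  rw [h1, h1]
  exact (hF.contDiffAt (hV.mem_nhds hw)).isSymmSndFDerivAt
    (by simpa using (WithTop.coe_le_coe.2 le_top : ((2 : ℕ∞) : ℕ∞ω) ≤ ∞)) e e'

theorem hasFDerivAt_lor {F F' : ℂ → R41} {w : ℂ} (hF : DifferentiableAt ℝ F w)
    (hF' : DifferentiableAt ℝ F' w) :
    HasFDerivAt (fun w => lor (F w) (F' w))
      (lorL.precompR ℂ (F w) (fderiv ℝ F' w) + lorL.precompL ℂ (fderiv ℝ F w) (F' w)) w :=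
  lorL.hasFDerivAt_of_bilinear hF.hasFDerivAt hF'.hasFDerivAt

theorem smooth_lor {F F' : ℂ → R41} (hF : ContDiffOn ℝ ∞ F V) (hF' : ContDiffOn ℝ ∞ F' V) :
    ContDiffOn ℝ ∞ (fun w => lor (F w) (F' w)) V :=
  (lorL.contDiff.comp_contDiffOn hF).clm_apply hF'

theorem pd_lor' {F F' : ℂ → R41} {w : ℂ} (hF : DifferentiableAt ℝ F w)
    (hF' : DifferentiableAt ℝ F' w) (e : ℂ) :
    pd e (fun w => lor (F w) (F' w)) w = lor (pd e F w) (F' w) + lor (F w) (pd e F' w) := by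
  rw [pd, (hasFDerivAt_lor hF hF').fderiv]
  simp [ContinuousLinearMap.precompR_apply, ContinuousLinearMap.precompL_apply, lorL_apply, pd,
    add_comm]

theorem pd_lor (hV : IsOpen V) {F F' : ℂ → R41} (hF : ContDiffOn ℝ ∞ F V)
    (hF' : ContDiffOn ℝ ∞ F' V) {w : ℂ} (hw : w ∈ V) (e : ℂ) :
    pd e (fun w => lor (F w) (F' w)) w = lor (pd e F w) (F' w) + lor (F w) (pd e F' w) :=
  pd_lor' (differentiableAt_of_smooth hV hF hw) (differentiableAt_of_smooth hV hF' hw) e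

theorem pd_const (c : G) (w e : ℂ) : pd e (fun _ => c) w = 0 := by
  simp [pd]

theorem lor_pd_add_of_const (hV : IsOpen V) {F F' : ℂ → R41} (hF : ContDiffOn ℝ ∞ F V)
    (hF' : ContDiffOn ℝ ∞ F' V) {c : ℝ} (hc : ∀ w ∈ V, lor (F w) (F' w) = c) {w : ℂ} (hw : w ∈ V)
    (e : ℂ) : lor (pd e F w) (F' w) + lor (F w) (pd e F' w) = 0 := by
  rw [← pd_lor hV hF hF' hw, pd_congr hV hc hw, pd_const]

theorem clm_complex_apply (L : ℂ →L[ℝ] G) (v : ℂ) : L v = v.re • L 1 + v.im • L Complex.I := by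
  have : v = v.re • (1 : ℂ) + v.im • Complex.I := by
    apply Complex.ext <;> simp
  conv_lhs => rw [this]
  rw [map_add, map_smul, map_smul]

theorem clm_complex_eq_zero {L : ℂ →L[ℝ] G} (h1 : L 1 = 0) (h2 : L Complex.I = 0) : L = 0 := by
  ext1 v
  rw [clm_complex_apply, h1, h2]
  simp

/-- The inverse function theorem for smooth maps of the plane. -/
theorem exists_local_inverse (hV : IsOpen V) {W : ℂ → ℂ} (hW : ContDiffOn ℝ ∞ W V) {w₀ : ℂ}
    (hw₀ : w₀ ∈ V) (hinj : Function.Injective (fderiv ℝ W w₀)) :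
    ∃ e : OpenPartialHomeomorph ℂ ℂ, w₀ ∈ e.source ∧ e.source ⊆ V ∧ (∀ w, e w = W w) ∧
      ContDiffOn ℝ ∞ e.symm e.target := by
  have hequiv : ∀ w, Function.Injective (fderiv ℝ W w) →
      ∃ T : ℂ ≃L[ℝ] ℂ, (T : ℂ →L[ℝ] ℂ) = fderiv ℝ W w := by
    intro w hw
    refine ⟨(LinearEquiv.ofInjectiveEndo (fderiv ℝ W w).toLinearMap hw).toContinuousLinearEquiv, ?_⟩
    ext; simp
  obtain ⟨T, hT⟩ := hequiv w₀ hinj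
  have hc := hW.contDiffAt (hV.mem_nhds hw₀)
  have hd : HasFDerivAt W (T : ℂ →L[ℝ] ℂ) w₀ := by
    rw [hT]; exact (differentiableAt_of_smooth hV hW hw₀).hasFDerivAt
  let e₀ := hc.toOpenPartialHomeomorph W hd (by simp)
  -- The domain is shrunk to points with invertible derivative, so that the inverse is smooth on its
  -- whole domain and not only at the image of `w₀`.
  have hnhds : {w | w ∈ V ∧ Function.Injective (fderiv ℝ W w)} ∈ 𝓝 w₀ := by
    have h1 : ContinuousAt (fderiv ℝ W) w₀ :=
      (smooth_fderiv hV hW).continuousOn.continuousAt (hV.mem_nhds hw₀)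
    have h2 : {L : ℂ →L[ℝ] ℂ | Function.Injective L} ∈ 𝓝 (fderiv ℝ W w₀) := by
      rw [← hT]
      filter_upwards [ContinuousLinearEquiv.nhds T] with L hL
      obtain ⟨T', rfl⟩ := hL
      exact T'.injective
    filter_upwards [hV.mem_nhds hw₀, h1 h2] with w ha hb using ⟨ha, hb⟩
  obtain ⟨S, hS, hSo, hwS⟩ := mem_nhds_iff.1 hnhds
  have hsrc : ∀ w ∈ (e₀.restrOpen S hSo).source, w ∈ S := by
    intro w hw
    rw [OpenPartialHomeomorph.restrOpen_source] at hw
    exact hw.2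
  refine ⟨e₀.restrOpen S hSo, ?_, fun w hw => (hS (hsrc w hw)).1, fun w => rfl, ?_⟩
  · rw [OpenPartialHomeomorph.restrOpen_source]
    exact ⟨hc.mem_toOpenPartialHomeomorph_source hd (by simp), hwS⟩
  · intro ζ hζ
    have hm := hsrc _ ((e₀.restrOpen S hSo).map_target hζ)
    obtain ⟨T', hT'⟩ := hequiv _ (hS hm).2
    refine ContDiffAt.contDiffWithinAt ?_
    refine OpenPartialHomeomorph.contDiffAt_symm _ (f₀' := T') hζ ?_ ?_
    · rw [hT']; exact (differentiableAt_of_smooth hV hW (hS hm).1).hasFDerivAt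
    · exact hW.contDiffAt (hV.mem_nhds (hS hm).1)

end Calculus

end LWFront

namespace LWFront

/-! ### Fronts in the plane and the Hopf differential -/

/-- A front `F` with unit normal field `N`, defined on an open set of the plane. -/
structure PlaneFront (F N : ℂ → R41) (V : Set ℂ) : Prop where
  isOpen : IsOpen V
  smooth : ContDiffOn ℝ ∞ F V
  smooth' : ContDiffOn ℝ ∞ N V
  pair : ∀ w ∈ V, OrthoPair (F w) (N w)
  normal : ∀ w ∈ V, ∀ v, lor (fderiv ℝ F w v) (N w) = 0
  imm : ∀ w ∈ V, ∀ v, fderiv ℝ F w v = 0 → fderiv ℝ N w v = 0 → v = 0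

namespace PlaneFront

variable {F N : ℂ → R41} {V : Set ℂ}

theorem mono (h : PlaneFront F N V) {V' : Set ℂ} (hV' : IsOpen V') (hs : V' ⊆ V) :
    PlaneFront F N V' :=
  ⟨hV', h.smooth.mono hs, h.smooth'.mono hs, fun w hw => h.pair w (hs hw),
    fun w hw => h.normal w (hs hw), fun w hw => h.imm w (hs hw)⟩

theorem ptFront (h : PlaneFront F N V) {w : ℂ} (hw : w ∈ V) :
    PtFront (F w) (N w) (fderiv ℝ F w) (fderiv ℝ N w) where
  pair := h.pair w hw
  perp u := by
    have h1 := lor_pd_add_of_const h.isOpen h.smooth h.smooth (fun w hw => (h.pair w hw).ff) hw u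
    rw [lor_comm (F w), ← two_mul] at h1
    exact ⟨by rw [lor_comm]; simpa [pd] using h1, by rw [lor_comm]; exact h.normal w hw u⟩
  perp' u := by
    have h1 := lor_pd_add_of_const h.isOpen h.smooth' h.smooth' (fun w hw => (h.pair w hw).nn) hw u
    have h2 := lor_pd_add_of_const h.isOpen h.smooth h.smooth' (fun w hw => (h.pair w hw).fn) hw u
    have h3 : lor (pd u F w) (N w) = 0 := h.normal w hw u
    rw [lor_comm (pd u N w), ← two_mul] at h1
    rw [h3, zero_add] at h2
    exact ⟨h2, by simpa [pd] using h1⟩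
  symm u v := by
    have key : ∀ u v, lor (fderiv ℝ F w u) (fderiv ℝ N w v) = - lor (pd v (pd u F) w) (N w) := by
      intro u v
      have := lor_pd_add_of_const h.isOpen (smooth_pd h.isOpen h.smooth u) h.smooth'
        (fun w hw => h.normal w hw u) hw v
      simp only [pd] at this ⊢
      linarith
    rw [key, key, pd_comm h.isOpen h.smooth hw]
  imm := h.imm w hw

theorem smooth_sum (h : PlaneFront F N V) : ContDiffOn ℝ ∞ (fun w => F w + N w) V :=
  h.smooth.add h.smooth'

theorem pd_sum (h : PlaneFront F N V) {w : ℂ} (hw : w ∈ V) (e : ℂ) :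
    pd e (fun w => F w + N w) w = pd e F w + pd e N w := by
  simp only [pd]
  rw [fderiv_fun_add (differentiableAt_of_smooth h.isOpen h.smooth hw)
    (differentiableAt_of_smooth h.isOpen h.smooth' hw)]
  rfl

end PlaneFront

/-- The coefficient of the Hopf differential of a front in the plane. -/
def planeHopf (F N : ℂ → R41) (w : ℂ) : ℂ :=
  (((lor (pd 1 F w) (pd 1 N w) - lor (pd Complex.I F w) (pd Complex.I N w) : ℝ) : ℂ)
    - 2 * Complex.I * ((lor (pd 1 F w) (pd Complex.I N w) : ℝ) : ℂ)) / 4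

/-- The first fundamental form of `F` is a multiple of `|dw|^2`. -/
def PlaneConformal (F : ℂ → R41) (V : Set ℂ) : Prop :=
  ∀ w ∈ V, lor (pd 1 F w) (pd 1 F w) = lor (pd Complex.I F w) (pd Complex.I F w) ∧
    lor (pd 1 F w) (pd Complex.I F w) = 0

/-- In a conformal basis the mixed area term is proportional to the trace of ⟨A, C⟩. Where A
vanishes the trace is trivially zero. -/
theorem PtFront.trace_eq_zero {F N : R41} {A B : ℂ →L[ℝ] R41} (h : PtFront F N A B)
    (hr : LinRel 1 0 F N A B) (h1 : lor (A 1) (A 1) = lor (A Complex.I) (A Complex.I))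
    (h2 : lor (A 1) (A Complex.I) = 0) :
    lor (A 1) (A 1 + B 1) + lor (A Complex.I) (A Complex.I + B Complex.I) = 0 := by
  by_cases h0 : A 1 = 0
  · rw [h0, lor_zero_left] at h1
    have h3 := h.pair.eq_zero_of_lor_self (h.perp _) h1.symm
    rw [h0, h3, lor_zero_left, lor_zero_left, add_zero]
  · have hpos := h.pair.lor_self_pos (h.perp 1) h0
    have e1 := h.pair.om_mul_om (h.perp 1) (h.perp Complex.I) (h.perp 1) (h.perp_add Complex.I)
    have e2 := h.pair.om_mul_om (h.perp 1) (h.perp Complex.I) (h.perp Complex.I) (h.perp_add 1)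
    have e3 := hr 1 Complex.I
    rw [lor_comm (A Complex.I) (A 1), h2] at e1
    rw [h2, ← h1] at e2
    have : lor (A 1) (A 1) *
      (lor (A 1) (A 1 + B 1) + lor (A Complex.I) (A Complex.I + B Complex.I)) = 0 := by
      linear_combination om F N (A 1) (A Complex.I) * e3 - e1 + e2
    simpa [hpos.ne'] using this

namespace PlaneFront

variable {F N : ℂ → R41} {V : Set ℂ}

/-- Conformality says ⟨F_z, F_z⟩ = 0, so N_z may be replaced by (F + N)_z; vanishing of the trace
then merges the two diagonal terms. -/
theorem planeHopf_eq (h : PlaneFront F N V)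
    (hr : ∀ w ∈ V, LinRel 1 0 (F w) (N w) (fderiv ℝ F w) (fderiv ℝ N w))
    (hc : PlaneConformal F V) {w : ℂ} (hw : w ∈ V) :
    planeHopf F N w = ((lor (pd 1 F w) (pd 1 F w + pd 1 N w) : ℝ) / 2 : ℂ)
      - Complex.I * ((lor (pd 1 F w) (pd Complex.I F w + pd Complex.I N w) : ℝ) / 2 : ℂ) := by
  have h1 := (h.ptFront hw).trace_eq_zero (hr w hw) (hc w hw).1 (hc w hw).2
  have h2 := (hc w hw).1
  have h3 := (hc w hw).2
  simp only [fderiv_eq_pd] at h1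
  rw [planeHopf]
  simp only [lor_add_right] at h1 ⊢
  rw [h3, zero_add]
  have : lor (pd 1 F w) (pd 1 N w) - lor (pd Complex.I F w) (pd Complex.I N w)
      = 2 * (lor (pd 1 F w) (pd 1 F w) + lor (pd 1 F w) (pd 1 N w)) := by linarith
  rw [this]
  push_cast
  ring

/-- If q = 0, trace and symmetry make all four products ⟨A, C⟩ vanish. At a regular point the image
of A spans the plane, so C = 0; at a singular point A = 0 already. -/
theorem planeHopf_eq_zero_iff (h : PlaneFront F N V)
    (hr : ∀ w ∈ V, LinRel 1 0 (F w) (N w) (fderiv ℝ F w) (fderiv ℝ N w))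
    (hc : PlaneConformal F V) {w : ℂ} (hw : w ∈ V) :
    planeHopf F N w = 0 ↔ fderiv ℝ F w = 0 ∨ fderiv ℝ F w + fderiv ℝ N w = 0 := by
  rw [h.planeHopf_eq hr hc hw]
  have hp := h.ptFront hw
  constructor
  · intro h0
    by_cases hinj : Function.Injective (fderiv ℝ F w)
    · right
      have e1 : lor (pd 1 F w) (pd 1 F w + pd 1 N w) = 0 := by
        have := congrArg Complex.re h0
        simpa using this
      have e2 : lor (pd 1 F w) (pd Complex.I F w + pd Complex.I N w) = 0 := by
        have := congrArg Complex.im h0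
        simpa using this
      have e3 : lor (pd Complex.I F w) (pd 1 F w + pd 1 N w) = 0 := by
        rw [← e2]; exact (hp.symm_add 1 Complex.I).symm
      have e4 : lor (pd Complex.I F w) (pd Complex.I F w + pd Complex.I N w) = 0 := by
        have := hp.trace_eq_zero (hr w hw) (hc w hw).1 (hc w hw).2
        simp only [fderiv_eq_pd] at this
        linarith
      have hom : om (F w) (N w) (pd 1 F w) (pd Complex.I F w) ≠ 0 := by
        intro hom
        obtain ⟨r, s, hrs, h5⟩ := hp.pair.exists_relation (hp.perp 1) (hp.perp Complex.I) hom
        rw [← map_smul, ← map_smul, ← map_add, map_eq_zero_iff _ hinj] at h5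
        have h6 := congrArg Complex.re h5
        have h7 := congrArg Complex.im h5
        simp at h6 h7
        tauto
      exact clm_complex_eq_zero
        (hp.pair.eq_zero_of_lor_eq_zero (hp.perp 1) (hp.perp Complex.I) (hp.perp_add _) hom e1 e3)
        (hp.pair.eq_zero_of_lor_eq_zero (hp.perp 1) (hp.perp Complex.I) (hp.perp_add _) hom e2 e4)
    · exact Or.inl (hp.eq_zero_of_singular (hr w hw) hinj)
  · rintro (h0 | h0)
    · have : ∀ e, pd e F w = 0 := fun e => by rw [pd, h0]; rfl
      simp [this, lor_zero_left]
    · have : ∀ e, pd e F w + pd e N w = 0 := fun e => by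
        rw [pd, pd, ← add_apply, h0]; rfl
      simp [this, lor_zero_right]

/-- Here q = (s - i t)/2, so the Cauchy–Riemann equations read s_y = t_x and t_y = -s_x. Each of s
and t has two expressions, by trace and by symmetry. Choosing suitably, the mixed second derivative
of P = F + N cancels and only the two identities in `key` remain. They are checked pointwise, also
at singular points. -/
theorem differentiableOn_planeHopf (h : PlaneFront F N V)
    (hr : ∀ w ∈ V, LinRel 1 0 (F w) (N w) (fderiv ℝ F w) (fderiv ℝ N w))
    (hc : PlaneConformal F V) : DifferentiableOn ℂ (planeHopf F N) V := by
  have hV := h.isOpen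
  set P : ℂ → R41 := fun w => F w + N w with hP
  set s : ℂ → ℝ := fun w => lor (pd 1 F w) (pd 1 P w) with hs
  set t : ℂ → ℝ := fun w => lor (pd 1 F w) (pd Complex.I P w) with ht
  have sF := h.smooth
  have sP : ContDiffOn ℝ ∞ P V := h.smooth_sum
  have sF' := smooth_pd hV sF
  have sP' := smooth_pd hV sP
  intro w hw
  have heq : planeHopf F N =ᶠ[𝓝 w] fun w => ((s w : ℝ) / 2 : ℂ) - Complex.I * ((t w : ℝ) / 2 : ℂ) := by
    filter_upwards [hV.mem_nhds hw] with w hw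
    rw [h.planeHopf_eq hr hc hw, ← h.pd_sum hw, ← h.pd_sum hw]
  refine DifferentiableAt.differentiableWithinAt ?_
  rw [heq.differentiableAt_iff]
  have hds : HasFDerivAt s (fderiv ℝ s w) w :=
    (differentiableAt_of_smooth hV (smooth_lor (sF' 1) (sP' 1)) hw).hasFDerivAt
  have hdt : HasFDerivAt t (fderiv ℝ t w) w :=
    (differentiableAt_of_smooth hV (smooth_lor (sF' 1) (sP' Complex.I)) hw).hasFDerivAt
  have hd : HasFDerivAt (fun w => ((s w : ℝ) / 2 : ℂ) - Complex.I * ((t w : ℝ) / 2 : ℂ))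
      ((1 / 2 : ℝ) • (Complex.ofRealCLM.comp (fderiv ℝ s w))
        - (Complex.I / 2) • (Complex.ofRealCLM.comp (fderiv ℝ t w))) w := by
    have := ((Complex.ofRealCLM.hasFDerivAt.comp w hds).const_smul (1 / 2 : ℝ)).sub
      ((Complex.ofRealCLM.hasFDerivAt.comp w hdt).const_smul (Complex.I / 2))
    refine this.congr_of_eventuallyEq (Filter.Eventually.of_forall fun w => ?_)
    simp
    ring
  rw [differentiableAt_complex_iff_differentiableAt_real]
  refine ⟨hd.differentiableAt, ?_⟩
  rw [hd.fderiv]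
  -- alternative expressions of `s` and `t`
  have hs2 : ∀ w ∈ V, s w = lor (- pd Complex.I F w) (pd Complex.I P w) := by
    intro w hw
    have := (h.ptFront hw).trace_eq_zero (hr w hw) (hc w hw).1 (hc w hw).2
    simp only [fderiv_eq_pd] at this
    rw [hs, lor_neg_left]
    simp only [hP]
    rw [h.pd_sum hw, h.pd_sum hw]
    linarith
  have ht2 : ∀ w ∈ V, t w = lor (pd Complex.I F w) (pd 1 P w) := by
    intro w hw
    have := (h.ptFront hw).symm_add 1 Complex.I
    simp only [fderiv_eq_pd] at this
    simp only [ht, hP]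
    rw [h.pd_sum hw, h.pd_sum hw, this]
  have sFn : ContDiffOn ℝ ∞ (fun w => - pd Complex.I F w) V := (sF' Complex.I).neg
  have hneg : ∀ e, pd e (fun w => - pd Complex.I F w) w = - pd e (pd Complex.I F) w := by
    intro e
    simp only [pd]
    rw [fderiv_fun_neg]; rfl
  have hFc := pd_comm hV sF hw Complex.I 1
  have hPc := pd_comm hV sP hw Complex.I 1
  have sx : fderiv ℝ s w 1 = - lor (pd 1 (pd Complex.I F) w) (pd Complex.I P w)
      - lor (pd Complex.I F w) (pd 1 (pd Complex.I P) w) := by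
    have := (pd_congr hV hs2 hw 1).trans (pd_lor hV sFn (sP' Complex.I) hw 1)
    rw [hneg, lor_neg_left, lor_neg_left] at this
    rw [← sub_eq_add_neg] at this
    exact this
  have ty : fderiv ℝ t w Complex.I = lor (pd Complex.I (pd Complex.I F) w) (pd 1 P w)
      + lor (pd Complex.I F w) (pd 1 (pd Complex.I P) w) := by
    have := (pd_congr hV ht2 hw Complex.I).trans (pd_lor hV (sF' Complex.I) (sP' 1) hw Complex.I)
    rw [hPc] at this
    exact this
  have tx : fderiv ℝ t w 1 = lor (pd 1 (pd 1 F) w) (pd Complex.I P w)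
      + lor (pd 1 F w) (pd 1 (pd Complex.I P) w) :=
    pd_lor hV (sF' 1) (sP' Complex.I) hw 1
  have sy : fderiv ℝ s w Complex.I = lor (pd 1 (pd Complex.I F) w) (pd 1 P w)
      + lor (pd 1 F w) (pd 1 (pd Complex.I P) w) := by
    have := pd_lor hV (sF' 1) (sP' 1) hw Complex.I
    rw [hPc, hFc] at this
    exact this
  have key : lor (pd Complex.I (pd Complex.I F) w) (pd 1 P w)
        = lor (pd 1 (pd Complex.I F) w) (pd Complex.I P w) ∧
      lor (pd 1 (pd 1 F) w) (pd Complex.I P w) = lor (pd 1 (pd Complex.I F) w) (pd 1 P w) := by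
    have hp := h.ptFront hw
    by_cases h0 : pd 1 F w = 0
    -- At a singular point F_x = F_y = 0, so differentiating t = ⟨F_x, P_y⟩ = ⟨F_y, P_x⟩ leaves only
    -- second derivatives of F; comparing the two results gives both identities.
    · have h0' : pd Complex.I F w = 0 := by
        have := (hc w hw).1
        rw [h0, lor_zero_left] at this
        exact hp.pair.eq_zero_of_lor_self (hp.perp _) this.symm
      have e1 := pd_lor hV (sF' 1) (sP' Complex.I) hw Complex.I
      have e2 := pd_lor hV (sF' 1) (sP' Complex.I) hw 1
      have e3 := pd_lor hV (sF' Complex.I) (sP' 1) hw Complex.I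
      have e4 := pd_lor hV (sF' Complex.I) (sP' 1) hw 1
      rw [← pd_congr hV ht2 hw] at e3 e4
      rw [h0, lor_zero_left, add_zero] at e1 e2
      rw [h0', lor_zero_left, add_zero] at e3 e4
      rw [hFc] at e1
      exact ⟨e3.symm.trans e1, e2.symm.trans e4⟩
    · have hpos := hp.pair.lor_self_pos (hp.perp 1) h0
      -- At a regular point, with λ = ⟨F_x, F_x⟩, one has λP_x = sF_x + tF_y and λP_y = tF_x - sF_y.
      -- What remains follows from the derivatives of the conformality conditions, `g1` and `g2`.
      have hE : ∀ e, lor (pd 1 F w) (pd 1 F w) • pd e P w = lor (pd 1 F w) (pd e P w) • pd 1 F w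
          + lor (pd Complex.I F w) (pd e P w) • pd Complex.I F w := by
        intro e
        have := hp.pair.smul_eq_of_conformal (hp.perp 1) (hp.perp Complex.I)
          (hp.perp_add e) rfl (hc w hw).1.symm (hc w hw).2 hpos.ne'
        simp only [fderiv_eq_pd] at this
        rw [← h.pd_sum hw] at this
        rw [lor_comm _ (pd e P w), lor_comm _ (pd e P w)]
        exact this
      have hI := hE Complex.I
      have h1 := hE 1
      simp only [fderiv_eq_pd] at hpos
      have f1 := hs2 w hw
      have f2 := ht2 w hw
      rw [lor_neg_left] at f1
      simp only [hs, ht] at f1 f2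
      rw [← f2] at h1
      have f3 : lor (pd Complex.I F w) (pd Complex.I P w) = - lor (pd 1 F w) (pd 1 P w) := by
        linarith
      rw [f3] at hI
      have g0 : ∀ w ∈ V, lor (pd 1 F w) (pd 1 F w) = lor (pd Complex.I F w) (pd Complex.I F w) :=
        fun w hw => (hc w hw).1
      have g1 : ∀ e, lor (pd e (pd 1 F) w) (pd 1 F w)
          = lor (pd e (pd Complex.I F) w) (pd Complex.I F w) := by
        intro e
        have := pd_congr hV g0 hw e
        rw [pd_lor hV (sF' _) (sF' _) hw, pd_lor hV (sF' _) (sF' _) hw,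
          lor_comm (pd 1 F w), lor_comm (pd Complex.I F w)] at this
        linarith
      have g2 : ∀ e, lor (pd e (pd 1 F) w) (pd Complex.I F w)
          + lor (pd e (pd Complex.I F) w) (pd 1 F w) = 0 := by
        intro e
        have := lor_pd_add_of_const hV (sF' 1) (sF' Complex.I) (fun w hw => (hc w hw).2) hw e
        rwa [lor_comm (pd 1 F w)] at this
      have g3 := g1 1
      have g4 := g1 Complex.I
      have g5 := g2 1
      have g6 := g2 Complex.I
      rw [hFc] at g4 g6
      have hm := hpos.ne'
      constructor
      · apply mul_left_cancel₀ hm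
        rw [← lor_smul_right, ← lor_smul_right, h1, hI]
        simp only [lor_add_right, lor_smul_right]
        linear_combination lor (pd 1 F w) (pd 1 P w) * g6 - lor (pd 1 F w) (pd Complex.I P w) * g4
      · apply mul_left_cancel₀ hm
        rw [← lor_smul_right, ← lor_smul_right, h1, hI]
        simp only [lor_add_right, lor_smul_right]
        linear_combination lor (pd 1 F w) (pd Complex.I P w) * g3 - lor (pd 1 F w) (pd 1 P w) * g5
  have c1 : fderiv ℝ s w Complex.I = fderiv ℝ t w 1 := by rw [sy, tx, key.2]
  have c2 : fderiv ℝ t w Complex.I = - fderiv ℝ s w 1 := by rw [ty, sx, key.1]; ring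
  simp [c1, c2]
  ring_nf
  simp
  ring

end PlaneFront

end LWFront

namespace LWFront

/-! ### Conformal coordinates of fronts with mean curvature one -/

section ChangeOfCoordinates

variable {V : Set ℂ} {W : ℂ → ℂ} {e : OpenPartialHomeomorph ℂ ℂ}

theorem fderiv_comp_symm {G : Type*} [NormedAddCommGroup G] [NormedSpace ℝ G] {F : ℂ → G}
    (hV : IsOpen V) (hF : ContDiffOn ℝ ∞ F V)
    (heV : e.source ⊆ V) (hes : ContDiffOn ℝ ∞ e.symm e.target) {ζ : ℂ}
    (hζ : ζ ∈ e.target) : fderiv ℝ (F ∘ e.symm) ζ =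
      (fderiv ℝ F (e.symm ζ)).comp (fderiv ℝ e.symm ζ) := by
  have hd := differentiableAt_of_smooth e.open_target hes hζ
  have hw := heV (e.map_target hζ)
  exact fderiv_comp ζ (differentiableAt_of_smooth hV hF hw) hd

theorem fderiv_fderiv_symm (hV : IsOpen V) (hW : ContDiffOn ℝ ∞ W V)
    (heV : e.source ⊆ V) (heW : ∀ w, e w = W w) (hes : ContDiffOn ℝ ∞ e.symm e.target) {ζ : ℂ}
    (hζ : ζ ∈ e.target) (u : ℂ) :
    fderiv ℝ W (e.symm ζ) (fderiv ℝ e.symm ζ u) = u := by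
  have h1 := fderiv_comp_symm hV hW heV hes hζ
  have h2 : (W ∘ e.symm) =ᶠ[𝓝 ζ] id := by
    filter_upwards [e.open_target.mem_nhds hζ] with x hx
    rw [Function.comp_apply, ← heW, e.right_inv hx, id]
  rw [h2.fderiv_eq, fderiv_id] at h1
  exact (congrArg (fun L : ℂ →L[ℝ] ℂ => L u) h1).symm

theorem exists_conformal_coord_of_conformal {F : ℂ → R41} (hV : IsOpen V)
    (hF : ContDiffOn ℝ ∞ F V) (hW : ContDiffOn ℝ ∞ W V) {w₀ : ℂ} (hw₀ : w₀ ∈ V)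
    (hinj : Function.Injective (fderiv ℝ W w₀))
    (hμ : ∀ w ∈ V, ∃ μ : ℝ, ∀ u v, lor (fderiv ℝ F w u) (fderiv ℝ F w v)
      = μ * ((fderiv ℝ W w u).re * (fderiv ℝ W w v).re
        + (fderiv ℝ W w u).im * (fderiv ℝ W w v).im)) :
    ∃ e : OpenPartialHomeomorph ℂ ℂ, w₀ ∈ e.source ∧ e.source ⊆ V ∧
      ContDiffOn ℝ ∞ e e.source ∧ ContDiffOn ℝ ∞ e.symm e.target ∧
      PlaneConformal (F ∘ e.symm) e.target := by
  obtain ⟨e, h1, h2, h3, h4⟩ := exists_local_inverse hV hW hw₀ hinj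
  refine ⟨e, h1, h2, ?_, h4, ?_⟩
  · have : (e : ℂ → ℂ) = W := funext h3
    rw [this]; exact hW.mono h2
  · intro ζ hζ
    obtain ⟨μ, hμ⟩ := hμ _ (h2 (e.map_target hζ))
    have hk : ∀ u v, lor (pd u (F ∘ e.symm) ζ) (pd v (F ∘ e.symm) ζ)
        = μ * (u.re * v.re + u.im * v.im) := by
      intro u v
      rw [pd, pd, fderiv_comp_symm hV hF h2 h4 hζ]
      have := hμ (fderiv ℝ e.symm ζ u) (fderiv ℝ e.symm ζ v)
      rwa [fderiv_fderiv_symm hV hW h2 h3 h4 hζ, fderiv_fderiv_symm hV hW h2 h3 h4 hζ] at this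
    rw [hk, hk, hk]
    simp

end ChangeOfCoordinates

/-! ### Null vectors and conformal maps to the plane -/

/-- For a null vector `P`, the map `tau σ P` is a similarity from the orthogonal complement of `P`,
modulo `P`, to the complex plane. -/
def tau (σ : ℝ) (P X : R41) : ℂ :=
  ⟨(P 0 - σ * P 3) * X 1 - P 1 * (X 0 - σ * X 3), (P 0 - σ * P 3) * X 2 - P 2 * (X 0 - σ * X 3)⟩

/-- `tau` as a continuous bilinear map. -/
def tauL (σ : ℝ) : R41 →L[ℝ] R41 →L[ℝ] ℂ :=
  (LinearMap.mk₂ ℝ (tau σ)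
    (fun x y z => by apply Complex.ext <;> simp [tau] <;> ring)
    (fun c x y => by apply Complex.ext <;> simp [tau] <;> ring)
    (fun x y z => by apply Complex.ext <;> simp [tau] <;> ring)
    (fun c x y => by apply Complex.ext <;> simp [tau] <;> ring)).toContinuousBilinearMap

theorem tauL_apply (σ : ℝ) (P X : R41) : tauL σ P X = tau σ P X := rfl

theorem tauL_swap (σ : ℝ) (P X : R41) : tauL σ P X = - tauL σ X P := by
  rw [tauL_apply, tauL_apply]
  apply Complex.ext <;> simp [tau] <;> ring

theorem tau_inner {σ : ℝ} (hσ : σ = 1 ∨ σ = -1) {P X Y : R41} (hP : lor P P = 0)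
    (hX : lor P X = 0) (hY : lor P Y = 0) :
    (tau σ P X).re * (tau σ P Y).re + (tau σ P X).im * (tau σ P Y).im
      = (P 0 - σ * P 3) ^ 2 * lor X Y := by
  simp only [lor, tau] at *
  have hσ2 : σ ^ 2 = 1 := by rcases hσ with rfl | rfl <;> norm_num
  linear_combination (X 0 - σ * X 3) * (Y 0 - σ * Y 3) * hP
    - (P 0 - σ * P 3) * (Y 0 - σ * Y 3) * hX - (P 0 - σ * P 3) * (X 0 - σ * X 3) * hY
    + (P 0 * P 0 * X 3 * Y 3 - P 0 * P 3 * X 0 * Y 3 - P 0 * P 3 * X 3 * Y 0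
      + P 3 * P 3 * X 0 * Y 0) * hσ2

/-- Chooses the pole of a stereographic projection away from the null direction of `P`: if both
signs failed, `P 0` and `P 3` would vanish, and nullity would kill the rest. -/
theorem exists_sign {P : R41} (hP : lor P P = 0) (hP0 : P ≠ 0) :
    ∃ σ : ℝ, (σ = 1 ∨ σ = -1) ∧ P 0 - σ * P 3 ≠ 0 := by
  by_contra! h
  have h1 := h 1 (Or.inl rfl)
  have h2 := h (-1) (Or.inr rfl)
  have h0 : P 0 = 0 := by linarith
  have h3 : P 3 = 0 := by linarith
  simp only [lor, h0, h3] at hP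
  have q1 := sq_nonneg (P 1)
  have q2 := sq_nonneg (P 2)
  have h4 : P 1 = 0 := pow_eq_zero_iff two_ne_zero |>.1 (by linarith)
  have h5 : P 2 = 0 := pow_eq_zero_iff two_ne_zero |>.1 (by linarith)
  apply hP0
  ext i
  fin_cases i <;> simpa

theorem OrthoPair.null_sum {F N : R41} (h : OrthoPair F N) : lor (F + N) (F + N) = 0 := by
  simp only [lor_add_left, lor_add_right, h.ff, h.nn, h.fn, lor_comm N F]; norm_num

theorem OrthoPair.sum_ne_zero {F N : R41} (h : OrthoPair F N) : F + N ≠ 0 := by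
  intro h0
  have : lor F (F + N) = -1 := by rw [lor_add_right, h.ff, h.fn, add_zero]
  rw [h0, lor_zero_right] at this
  norm_num at this

theorem Perp.lor_sum {F N x : R41} (h : Perp F N x) : lor (F + N) x = 0 := by
  rw [lor_add_left, h.1, h.2, add_zero]

/-- The combination is orthogonal to `x`, `y` and `z`, hence to itself, and the metric on the plane
is definite. -/
theorem OrthoPair.plane_identity {F N : R41} (h : OrthoPair F N) {x y z : R41} (hx : Perp F N x)
    (hy : Perp F N y) (hz : Perp F N z) :
    om F N x y • z + om F N y z • x + om F N z x • y = 0 := by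
  set T := om F N x y • z + om F N y z • x + om F N z x • y with hT
  have k : ∀ {x y z : R41}, Perp F N x →
      om F N x y * lor x z + om F N y z * lor x x + om F N z x * lor x y = 0 := by
    intro x y z hx
    have := hx.om_exchange (x := y) (y := z)
    rw [om_swap F N z x]
    linarith
  have h1 : lor x T = 0 := by
    simp only [hT, lor_add_right, lor_smul_right]; exact k hx
  have h2 : lor y T = 0 := by
    simp only [hT, lor_add_right, lor_smul_right]
    have := k (x := y) (y := z) (z := x) hy
    linarith
  have h3 : lor z T = 0 := by
    simp only [hT, lor_add_right, lor_smul_right]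
    have := k (x := z) (y := x) (z := y) hz
    linarith
  refine h.eq_zero_of_lor_self (((hz.smul _).add (hx.smul _)).add (hy.smul _)) ?_
  have h4 : ∀ Z, lor T Z = om F N x y * lor z Z + om F N y z * lor x Z + om F N z x * lor y Z := by
    intro Z
    simp only [hT, lor_add_left, lor_smul_left]
  rw [h4, h1, h2, h3]
  ring

/-- Two linear maps into the plane orthogonal to `F` and `N` which are conjugate with respect to the
area form are conjugate with respect to every alternating form. -/
theorem OrthoPair.alternating_eq {F N : R41} (h : OrthoPair F N) {G : Type*} [AddCommGroup G]
    [Module ℝ G] {a₁ a₂ c₁ c₂ : R41} (ha₁ : Perp F N a₁) (ha₂ : Perp F N a₂)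
    (hc₁ : Perp F N c₁) (hc₂ : Perp F N c₂) (h0 : om F N a₁ a₂ ≠ 0)
    (hom : om F N a₁ c₂ = om F N a₂ c₁) (β : R41 →ₗ[ℝ] R41 →ₗ[ℝ] G)
    (hβ : ∀ x y, β x y = - β y x) : β c₁ a₂ = β c₂ a₁ := by
  have hβ0 : ∀ x, β x x = 0 := by
    intro x
    have : (2 : ℝ) • β x x = 0 := by
      rw [two_smul]; nth_rewrite 1 [hβ x x]; simp
    simpa using this
  have e1 := congrArg (fun x => β x a₂) (h.plane_identity ha₁ ha₂ hc₁)
  have e2 := congrArg (fun x => β x a₁) (h.plane_identity ha₁ ha₂ hc₂)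
  simp only [map_add, map_smul, LinearMap.add_apply, LinearMap.smul_apply, hβ0, map_zero,
    LinearMap.zero_apply, smul_zero, add_zero] at e1 e2
  have e3 : om F N a₁ a₂ • (β c₁ a₂ - β c₂ a₁) = 0 := by
    rw [smul_sub, eq_neg_of_add_eq_zero_left e1, eq_neg_of_add_eq_zero_left e2, hβ a₂ a₁,
      om_swap F N c₂ a₁, hom]
    simp
  rcases smul_eq_zero.1 e3 with h' | h'
  · exact absurd h' h0
  · exact sub_eq_zero.1 h'

namespace PlaneFront

variable {F N : ℂ → R41} {V : Set ℂ}

/-- The coordinate is a primitive of the complex-valued 1-form `tau` of F + N with dF. Its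
derivative is a similarity applied to dF, so it is conformal for the first fundamental form;
closedness of the form is where H = 1 enters. -/
theorem exists_conformal_coord_of_regular (h : PlaneFront F N V)
    (hr : ∀ w ∈ V, LinRel 1 0 (F w) (N w) (fderiv ℝ F w) (fderiv ℝ N w)) {w₀ : ℂ} (hw₀ : w₀ ∈ V)
    (hinj : Function.Injective (fderiv ℝ F w₀)) :
    ∃ e : OpenPartialHomeomorph ℂ ℂ, w₀ ∈ e.source ∧ e.source ⊆ V ∧
      ContDiffOn ℝ ∞ e e.source ∧ ContDiffOn ℝ ∞ e.symm e.target ∧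
      PlaneConformal (F ∘ e.symm) e.target := by
  have hV := h.isOpen
  obtain ⟨σ, hσ, hσ0⟩ := exists_sign (h.pair w₀ hw₀).null_sum (h.pair w₀ hw₀).sum_ne_zero
  have hcP : ContinuousOn (fun w => F w + N w) V := h.smooth_sum.continuousOn
  have hom0 : om (F w₀) (N w₀) (pd 1 F w₀) (pd Complex.I F w₀) ≠ 0 := by
    intro h0
    obtain ⟨u, hu, hu'⟩ := (h.pair w₀ hw₀).exists_ker (L := fderiv ℝ F w₀) Complex.finrank_real_complex
      (h.ptFront hw₀).perp (fun u v => by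
        rw [clm_complex_apply _ u, clm_complex_apply _ v]
        simp only [fderiv_eq_pd, om_add_left, om_add_right, om_smul_left, om_smul_right, om_self]
        rw [om_swap (F w₀) (N w₀) (pd Complex.I F w₀), h0]; ring)
    exact hu (hinj (by rw [hu', map_zero]))
  have hnhds : {w | w ∈ V ∧ (F w + N w) 0 - σ * (F w + N w) 3 ≠ 0 ∧
      om (F w) (N w) (pd 1 F w) (pd Complex.I F w) ≠ 0} ∈ 𝓝 w₀ := by
    have c1 : ContinuousAt (fun w => (F w + N w) 0 - σ * (F w + N w) 3) w₀ := by
      have := hcP.continuousAt (hV.mem_nhds hw₀)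
      exact ((continuous_apply 0).continuousAt.comp this).sub
        (continuousAt_const.mul ((continuous_apply 3).continuousAt.comp this))
    have c2 : ContinuousAt (fun w => om (F w) (N w) (pd 1 F w) (pd Complex.I F w)) w₀ := by
      have k1 := h.smooth.continuousOn.continuousAt (hV.mem_nhds hw₀)
      have k2 := h.smooth'.continuousOn.continuousAt (hV.mem_nhds hw₀)
      have k3 := (smooth_pd hV h.smooth 1).continuousOn.continuousAt (hV.mem_nhds hw₀)
      have k4 := (smooth_pd hV h.smooth Complex.I).continuousOn.continuousAt (hV.mem_nhds hw₀)
      rw [continuousAt_pi] at k1 k2 k3 k4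
      unfold om
      fun_prop (disch := assumption)
    filter_upwards [hV.mem_nhds hw₀, c1.eventually_ne hσ0, c2.eventually_ne hom0] with w a b c
      using ⟨a, b, c⟩
  obtain ⟨r, hr0, hball⟩ := Metric.mem_nhds_iff.1 hnhds
  have hB : IsOpen (Metric.ball w₀ r) := Metric.isOpen_ball
  have hB' := h.mono hB (fun w hw => (hball hw).1)
  let θ : ℂ → ℂ →L[ℝ] ℂ := fun w => (tauL σ (F w + N w)).comp (fderiv ℝ F w)
  have hθ : ContDiffOn ℝ ∞ θ (Metric.ball w₀ r) :=
    ((tauL σ).contDiff.comp_contDiffOn hB'.smooth_sum).clm_comp (smooth_fderiv hB hB'.smooth)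
  -- Poincaré lemma on a ball. The second derivatives of F are symmetric, and the remaining term
  -- pairs C with A by an alternating form; `alternating_eq` makes it symmetric because A and C are
  -- conjugate for the area form.
  obtain ⟨W, hW⟩ := (convex_ball w₀ r).exists_forall_hasFDerivAt_of_fderiv_symmetric hB
    (hθ.differentiableOn (by simp)) (by
      intro w hw
      have hp := hB'.ptFront hw
      have hθ' : ∀ x y, fderiv ℝ θ w x y = tauL σ (pd x F w + pd x N w) (pd y F w)
          + tauL σ (F w + N w) (pd x (pd y F) w) := by
        intro x y
        have d1 : DifferentiableAt ℝ θ w := differentiableAt_of_smooth hB hθ hw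
        have d2 : fderiv ℝ θ w x y = fderiv ℝ (fun w => θ w y) w x := by
          rw [fderiv_clm_apply d1 (differentiableAt_const _)]
          simp
        rw [d2]
        change fderiv ℝ (fun w => tauL σ (F w + N w) (pd y F w)) w x = _
        rw [(tauL σ).fderiv_of_bilinear (differentiableAt_of_smooth hB hB'.smooth_sum hw)
          (differentiableAt_of_smooth hB (smooth_pd hB hB'.smooth y) hw)]
        change tauL σ (F w + N w) (pd x (pd y F) w)
          + tauL σ (pd x (fun w => F w + N w) w) (pd y F w) = _
        rw [hB'.pd_sum hw, add_comm]
      have hsym : tauL σ (pd 1 F w + pd 1 N w) (pd Complex.I F w)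
          = tauL σ (pd Complex.I F w + pd Complex.I N w) (pd 1 F w) := by
        have hmix := hr w (hball hw).1 1 Complex.I
        let β : R41 →ₗ[ℝ] R41 →ₗ[ℝ] ℂ :=
          LinearMap.mk₂ ℝ (fun x y => tauL σ x y) (by simp) (by simp) (by simp) (by simp)
        exact hp.pair.alternating_eq (hp.perp 1) (hp.perp Complex.I) (hp.perp_add 1)
          (hp.perp_add Complex.I) (hball hw).2.2 (by linarith) β (tauL_swap σ)
      have hsym' : fderiv ℝ θ w 1 Complex.I = fderiv ℝ θ w Complex.I 1 := by
        rw [hθ', hθ', hsym, pd_comm hB hB'.smooth hw]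
      intro x y
      rw [clm_complex_apply (fderiv ℝ θ w) x, clm_complex_apply (fderiv ℝ θ w) y]
      simp only [add_apply, smul_apply]
      rw [clm_complex_apply (fderiv ℝ θ w 1) y, clm_complex_apply (fderiv ℝ θ w Complex.I) y,
        clm_complex_apply (fderiv ℝ θ w 1) x, clm_complex_apply (fderiv ℝ θ w Complex.I) x, hsym']
      module)
  have hWs : ContDiffOn ℝ ∞ W (Metric.ball w₀ r) := by
    rw [contDiffOn_infty_iff_fderiv_of_isOpen hB]
    exact ⟨fun w hw => (hW w hw).differentiableAt.differentiableWithinAt,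
      hθ.congr fun w hw => (hW w hw).fderiv⟩
  have hinner : ∀ w ∈ Metric.ball w₀ r, ∀ u v,
      (fderiv ℝ W w u).re * (fderiv ℝ W w v).re + (fderiv ℝ W w u).im * (fderiv ℝ W w v).im
      = ((F w + N w) 0 - σ * (F w + N w) 3) ^ 2 * lor (fderiv ℝ F w u) (fderiv ℝ F w v) := by
    intro w hw u v
    rw [(hW w hw).fderiv]
    have hp := hB'.ptFront hw
    exact tau_inner hσ hp.pair.null_sum (hp.perp u).lor_sum (hp.perp v).lor_sum
  obtain ⟨e, h1, h2, h3⟩ := exists_conformal_coord_of_conformal hB hB'.smooth hWs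
    (Metric.mem_ball_self hr0) (by
      rw [injective_iff_map_eq_zero]
      intro u hu
      have := hinner w₀ (Metric.mem_ball_self hr0) u u
      rw [hu] at this
      have h0 : lor (fderiv ℝ F w₀ u) (fderiv ℝ F w₀ u) = 0 := by
        have hsq := pow_ne_zero 2 hσ0
        simp only [Complex.zero_re, Complex.zero_im, mul_zero, add_zero] at this
        exact (mul_eq_zero.1 this.symm).resolve_left hsq
      have h5 := (h.pair w₀ hw₀).eq_zero_of_lor_self ((h.ptFront hw₀).perp u) h0
      exact hinj (by rw [map_zero, h5]))
    (fun w hw => by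
      refine ⟨(((F w + N w) 0 - σ * (F w + N w) 3) ^ 2)⁻¹, fun u v => ?_⟩
      rw [hinner w hw, inv_mul_cancel_left₀ (pow_ne_zero 2 (hball hw).2.1)])
  exact ⟨e, h1, fun w hw => (hball (h2 hw)).1, h3⟩

/-- The coordinate is the null direction of F + N in a stereographic chart. It is conformal for ⟨C,
C⟩, hence for ⟨A, A⟩ by `exists_conformal_factor`, even where A vanishes. -/
theorem exists_conformal_coord_of_gauss_regular (h : PlaneFront F N V)
    (hr : ∀ w ∈ V, LinRel 1 0 (F w) (N w) (fderiv ℝ F w) (fderiv ℝ N w)) {w₀ : ℂ} (hw₀ : w₀ ∈ V)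
    (hinj : Function.Injective (fderiv ℝ F w₀ + fderiv ℝ N w₀)) :
    ∃ e : OpenPartialHomeomorph ℂ ℂ, w₀ ∈ e.source ∧ e.source ⊆ V ∧
      ContDiffOn ℝ ∞ e e.source ∧ ContDiffOn ℝ ∞ e.symm e.target ∧
      PlaneConformal (F ∘ e.symm) e.target := by
  have hV := h.isOpen
  obtain ⟨σ, hσ, hσ0⟩ := exists_sign (h.pair w₀ hw₀).null_sum (h.pair w₀ hw₀).sum_ne_zero
  have sP := h.smooth_sum
  set P : ℂ → R41 := fun w => F w + N w with hP
  let κL : R41 →L[ℝ] ℝ := ContinuousLinearMap.proj 0 - σ • ContinuousLinearMap.proj 3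
  let mL : R41 →L[ℝ] ℂ := Complex.equivRealProdCLM.symm.toContinuousLinearMap.comp
    ((ContinuousLinearMap.proj 1).prod (ContinuousLinearMap.proj 2))
  have hκL : ∀ x, κL x = x 0 - σ * x 3 := fun x => rfl
  have hmL : ∀ x, mL x = ⟨x 1, x 2⟩ := fun x => by
    simp [mL, Complex.ext_iff]
  have hC : ∀ w ∈ V, ∀ u, pd u P w = fderiv ℝ F w u + fderiv ℝ N w u := fun w hw u => h.pd_sum hw u
  have hnhds : {w | w ∈ V ∧ κL (P w) ≠ 0 ∧ pd 1 P w ≠ 0} ∈ 𝓝 w₀ := by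
    have c1 : ContinuousAt (fun w => κL (P w)) w₀ :=
      κL.continuous.continuousAt.comp (sP.continuousOn.continuousAt (hV.mem_nhds hw₀))
    have c2 : ContinuousAt (pd 1 P) w₀ :=
      (smooth_pd hV sP 1).continuousOn.continuousAt (hV.mem_nhds hw₀)
    have h1 : pd 1 P w₀ ≠ 0 := by
      rw [hC w₀ hw₀]
      intro h0
      have := hinj (a₁ := 1) (a₂ := 0) (by rw [map_zero]; exact h0)
      norm_num at this
    filter_upwards [hV.mem_nhds hw₀, c1.eventually_ne (y := 0) hσ0, c2.eventually_ne h1] with w a b c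
      using ⟨a, b, c⟩
  obtain ⟨S, hS, hB, hw₀S⟩ := mem_nhds_iff.1 hnhds
  have hB' := h.mono hB (fun w hw => (hS hw).1)
  have sP' : ContDiffOn ℝ ∞ P S := hB'.smooth_sum
  -- By the quotient rule the derivative of this projection is `tau` of P with dP, divided by the
  -- square of the denominator.
  let W : ℂ → ℂ := fun w => (κL (P w))⁻¹ • mL (P w)
  have hWs : ContDiffOn ℝ ∞ W S :=
    ((κL.contDiff.comp_contDiffOn sP').inv fun w hw => (hS hw).2.1).smul
      (mL.contDiff.comp_contDiffOn sP')
  have hdW : ∀ w ∈ S, ∀ u, fderiv ℝ W w u = ((κL (P w)) ^ 2)⁻¹ • tau σ (P w) (pd u P w) := by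
    intro w hw u
    have dP := (differentiableAt_of_smooth hB sP' hw).hasFDerivAt
    have d1 := (hasDerivAt_inv (hS hw).2.1).comp_hasFDerivAt w (κL.hasFDerivAt.comp w dP)
    have d2 := mL.hasFDerivAt.comp w dP
    have d3 : HasFDerivAt W _ w := d1.smul d2
    rw [d3.fderiv]
    have hk := (hS hw).2.1
    simp only [hκL] at hk
    change (κL (P w))⁻¹ • mL (pd u P w) + (-(κL (P w) ^ 2)⁻¹ • κL (pd u P w)) • mL (P w) = _
    simp only [hκL, hmL, tau]
    apply Complex.ext <;>
    · simp only [Complex.add_re, Complex.add_im, Complex.smul_re, Complex.smul_im, smul_eq_mul]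
      field_simp
      ring
  have hinner : ∀ w ∈ S, ∀ u v,
      (fderiv ℝ W w u).re * (fderiv ℝ W w v).re + (fderiv ℝ W w u).im * (fderiv ℝ W w v).im
      = ((κL (P w)) ^ 2)⁻¹ * lor (pd u P w) (pd v P w) := by
    intro w hw u v
    have hp := hB'.ptFront hw
    have := tau_inner hσ hp.pair.null_sum (hp.perp_add u).lor_sum (hp.perp_add v).lor_sum
    rw [← hC w (hS hw).1, ← hC w (hS hw).1] at this
    change _ = (κL (P w)) ^ 2 * _ at this
    rw [hdW w hw, hdW w hw]
    have hk := (hS hw).2.1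
    rw [Complex.smul_re, Complex.smul_re, Complex.smul_im, Complex.smul_im]
    simp only [smul_eq_mul]
    have e : ∀ a b c d k : ℝ, k * a * (k * b) + k * c * (k * d) = k ^ 2 * (a * b + c * d) := by
      intros; ring
    rw [e]
    change _ * ((tau σ (F w + N w) (pd u P w)).re * (tau σ (F w + N w) (pd v P w)).re +
      (tau σ (F w + N w) (pd u P w)).im * (tau σ (F w + N w) (pd v P w)).im) = _
    rw [this]
    field_simp
  obtain ⟨e, h1, h2, h3⟩ := exists_conformal_coord_of_conformal hB hB'.smooth hWs hw₀S (by
      rw [injective_iff_map_eq_zero]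
      intro u hu
      have := hinner w₀ hw₀S u u
      rw [hu] at this
      have h0 : lor (pd u P w₀) (pd u P w₀) = 0 := by
        have hsq := inv_ne_zero (pow_ne_zero 2 (hS hw₀S).2.1)
        simp only [Complex.zero_re, Complex.zero_im, mul_zero, add_zero] at this
        exact (mul_eq_zero.1 this.symm).resolve_left hsq
      rw [hC w₀ hw₀] at h0
      have h5 := (h.pair w₀ hw₀).eq_zero_of_lor_self ((h.ptFront hw₀).perp_add u) h0
      exact hinj (by rw [map_zero, add_apply, h5]))
    (fun w hw => by
      obtain ⟨μ, hμ⟩ := (hB'.ptFront hw).exists_conformal_factor (hr w (hS hw).1) (u₀ := 1)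
        (by rw [← hC w (hS hw).1]; exact (hS hw).2.2)
      refine ⟨μ * (κL (P w)) ^ 2, fun u v => ?_⟩
      rw [hinner w hw, hμ, ← hC w (hS hw).1, ← hC w (hS hw).1, mul_assoc,
        mul_inv_cancel_left₀ (pow_ne_zero 2 (hS hw).2.1)])
  exact ⟨e, h1, fun w hw => (hS (h2 hw)).1, h3⟩

/-- A front with mean curvature one has conformal coordinates around every point. -/
theorem exists_conformal_coord (h : PlaneFront F N V)
    (hr : ∀ w ∈ V, LinRel 1 0 (F w) (N w) (fderiv ℝ F w) (fderiv ℝ N w)) {w₀ : ℂ} (hw₀ : w₀ ∈ V) :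
    ∃ e : OpenPartialHomeomorph ℂ ℂ, w₀ ∈ e.source ∧ e.source ⊆ V ∧
      ContDiffOn ℝ ∞ e e.source ∧ ContDiffOn ℝ ∞ e.symm e.target ∧
      PlaneConformal (F ∘ e.symm) e.target := by
  by_cases hinj : Function.Injective (fderiv ℝ F w₀)
  · exact h.exists_conformal_coord_of_regular hr hw₀ hinj
  · refine h.exists_conformal_coord_of_gauss_regular hr hw₀ ?_
    have hA := (h.ptFront hw₀).eq_zero_of_singular (hr w₀ hw₀) hinj
    rw [injective_iff_map_eq_zero]
    intro u hu
    rw [hA, zero_add] at hu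
    exact h.imm w₀ hw₀ u (by rw [hA]; rfl) hu

end PlaneFront

end LWFront

namespace LWFront

/-! ### Fronts with constant principal curvatures -/

theorem eq_smul_of_ker {G : Type*} [NormedAddCommGroup G] [NormedSpace ℝ G] {L : ℂ →L[ℝ] G}
    {v u : ℂ} (hv : v ≠ 0) (hLv : L v = 0) (hu : L u ≠ 0) (u' : ℂ) : ∃ r : ℝ, L u' = r • L u := by
  have hli : LinearIndependent ℝ ![v, u] := by
    rw [LinearIndependent.pair_iff' hv]
    rintro r rfl
    rw [map_smul, hLv, smul_zero] at hu
    exact hu rfl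
  have hs := hli.span_eq_top_of_card_eq_finrank' (by simp [Complex.finrank_real_complex])
  have hu' : u' ∈ Submodule.span ℝ (Set.range ![v, u]) := hs ▸ Submodule.mem_top
  simp only [Matrix.range_cons, Matrix.range_empty, Set.union_empty, Set.singleton_union] at hu'
  obtain ⟨r, s, rfl⟩ := Submodule.mem_span_pair.1 hu'
  exact ⟨s, by rw [map_add, map_smul, map_smul, hLv, smul_zero, zero_add]⟩

/-- The orthogonal complement of a₁, a₂ has dimension 4 - 2 = 2. It contains b and the independent
vectors b₁, b₂, so b is a combination of b₁ and b₂, both orthogonal to a. -/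
theorem lor_eq_zero_of_orthogonal_frames {a b a₁ a₂ b₁ b₂ : R41}
    (h11 : lor a₁ b₁ = 0) (h12 : lor a₁ b₂ = 0) (h21 : lor a₂ b₁ = 0) (h22 : lor a₂ b₂ = 0)
    (h1b : lor a₁ b = 0) (h2b : lor a₂ b = 0) (ha1 : lor a b₁ = 0) (ha2 : lor a b₂ = 0)
    (ha : lor a₁ a = 0) (ha' : lor a₂ a ≠ 0) (haa : lor a₁ a₁ ≠ 0)
    (hb : lor b₁ b = 0) (hb' : lor b₂ b ≠ 0) (hbb : lor b₁ b₁ ≠ 0) : lor a b = 0 := by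
  let φ : R41 →ₗ[ℝ] ℝ × ℝ := ((lorL a₁).prod (lorL a₂)).toLinearMap
  have hφ : ∀ x, φ x = (lor a₁ x, lor a₂ x) := fun x => rfl
  have hsurj : Function.Surjective φ := by
    rintro ⟨p, q⟩
    refine ⟨(p / lor a₁ a₁) • a₁ + ((q - p / lor a₁ a₁ * lor a₂ a₁) / lor a₂ a) • a, ?_⟩
    rw [hφ, lor_add_right, lor_add_right, lor_smul_right, lor_smul_right, lor_smul_right,
      lor_smul_right, ha]
    ext
    · simp only; field_simp; ring
    · simp only; field_simp; ring
  have hdim := LinearMap.finrank_range_add_finrank_ker φ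
  rw [LinearMap.range_eq_top.2 hsurj, finrank_top] at hdim
  simp only [Module.finrank_prod, Module.finrank_self, Module.finrank_fintype_fun_eq_card,
    Fintype.card_fin] at hdim
  have hK : ∀ x, lor a₁ x = 0 → lor a₂ x = 0 → x ∈ LinearMap.ker φ := by
    intro x h1 h2
    rw [LinearMap.mem_ker, hφ, h1, h2]; rfl
  let k₁ : LinearMap.ker φ := ⟨b₁, hK _ h11 h21⟩
  let k₂ : LinearMap.ker φ := ⟨b₂, hK _ h12 h22⟩
  have hli : LinearIndependent ℝ ![k₁, k₂] := by
    rw [LinearIndependent.pair_iff]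
    intro r s hrs
    have hrs' : r • b₁ + s • b₂ = 0 := congrArg Subtype.val hrs
    have e1 := congrArg (fun x => lor x b) hrs'
    simp only [lor_add_left, lor_smul_left, hb, lor_zero_left, mul_zero, zero_add] at e1
    have hs : s = 0 := (mul_eq_zero.1 e1).resolve_right hb'
    rw [hs, zero_smul, add_zero] at hrs'
    have e2 := congrArg (fun x => lor x b₁) hrs'
    simp only [lor_smul_left, lor_zero_left] at e2
    exact ⟨(mul_eq_zero.1 e2).resolve_right hbb, hs⟩
  have hs := hli.span_eq_top_of_card_eq_finrank' (by rw [Fintype.card_fin]; omega)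
  have hbK : (⟨b, hK _ h1b h2b⟩ : LinearMap.ker φ) ∈ Submodule.span ℝ (Set.range ![k₁, k₂]) :=
    hs ▸ Submodule.mem_top
  simp only [Matrix.range_cons, Matrix.range_empty, Set.union_empty, Set.singleton_union] at hbK
  obtain ⟨r, s, hrs⟩ := Submodule.mem_span_pair.1 hbK
  have hrs' : r • b₁ + s • b₂ = b := congrArg Subtype.val hrs
  rw [← hrs', lor_add_right, lor_smul_right, lor_smul_right, ha1, ha2]
  ring

/-- Here a depends on x only and b on y only. Differentiating ⟨a_x, b⟩ = 0 makes a_x, a_xx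
orthogonal to b, b_y, b_yy. From ⟨a_x, a⟩ = 0 one gets ⟨a_xx, a⟩ = -⟨a_x, a_x⟩ ≠ 0, and likewise for
b, which is the independence needed in `lor_eq_zero_of_orthogonal_frames`. -/
theorem lor_eq_zero_of_separated {a b : ℂ → R41} {T : Set ℂ} (hT : IsOpen T)
    (sa : ContDiffOn ℝ ∞ a T) (sb : ContDiffOn ℝ ∞ b T)
    (ha : ∀ w ∈ T, pd Complex.I a w = 0) (hb : ∀ w ∈ T, pd 1 b w = 0)
    (haa : ∀ w ∈ T, lor (pd 1 a w) (a w) = 0) (hab : ∀ w ∈ T, lor (pd 1 a w) (b w) = 0)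
    (hba : ∀ w ∈ T, lor (pd Complex.I b w) (a w) = 0)
    (hbb : ∀ w ∈ T, lor (pd Complex.I b w) (b w) = 0) {w : ℂ} (hw : w ∈ T)
    (hpa : lor (pd 1 a w) (pd 1 a w) ≠ 0)
    (hpb : lor (pd Complex.I b w) (pd Complex.I b w) ≠ 0) : lor (a w) (b w) = 0 := by
  have sa1 := smooth_pd hT sa 1
  have sa11 := smooth_pd hT sa1 1
  have sb2 := smooth_pd hT sb Complex.I
  have sb22 := smooth_pd hT sb2 Complex.I
  have za : ∀ w ∈ T, pd Complex.I (pd 1 a) w = 0 := fun w hw => by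
    rw [pd_comm hT sa hw, pd_congr hT ha hw, pd_const]
  have zb : ∀ w ∈ T, pd 1 (pd Complex.I b) w = 0 := fun w hw => by
    rw [pd_comm hT sb hw, pd_congr hT hb hw, pd_const]
  have za1 : ∀ w ∈ T, pd Complex.I (pd 1 (pd 1 a)) w = 0 := fun w hw => by
    rw [pd_comm hT sa1 hw, pd_congr hT za hw, pd_const]
  have r1b : ∀ w ∈ T, lor (pd 1 (pd 1 a) w) (b w) = 0 := fun w hw => by
    have := lor_pd_add_of_const hT sa1 sb hab hw 1
    rwa [hb w hw, lor_zero_right, add_zero] at this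
  have r12 : ∀ w ∈ T, lor (pd 1 a w) (pd Complex.I b w) = 0 := fun w hw => by
    have := lor_pd_add_of_const hT sa1 sb hab hw Complex.I
    rwa [za w hw, lor_zero_left, zero_add] at this
  have r112 : ∀ w ∈ T, lor (pd 1 (pd 1 a) w) (pd Complex.I b w) = 0 := fun w hw => by
    have := lor_pd_add_of_const hT sa1 sb2 r12 hw 1
    rwa [zb w hw, lor_zero_right, add_zero] at this
  have r122 : lor (pd 1 a w) (pd Complex.I (pd Complex.I b) w) = 0 := by
    have := lor_pd_add_of_const hT sa1 sb2 r12 hw Complex.I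
    rwa [za w hw, lor_zero_left, zero_add] at this
  have r1122 : lor (pd 1 (pd 1 a) w) (pd Complex.I (pd Complex.I b) w) = 0 := by
    have := lor_pd_add_of_const hT sa11 sb2 r112 hw Complex.I
    rwa [za1 w hw, lor_zero_left, zero_add] at this
  have ra2 : lor (a w) (pd Complex.I (pd Complex.I b) w) = 0 := by
    have := lor_pd_add_of_const hT sb2 sa hba hw Complex.I
    rwa [ha w hw, lor_zero_right, add_zero, lor_comm] at this
  have raa := lor_pd_add_of_const hT sa1 sa haa hw 1
  have rbb := lor_pd_add_of_const hT sb2 sb hbb hw Complex.I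
  refine lor_eq_zero_of_orthogonal_frames (r12 w hw) r122 (r112 w hw) r1122 (hab w hw) (r1b w hw)
    (by rw [lor_comm]; exact hba w hw) ra2 (haa w hw) (fun h0 => hpa ?_) hpa
    (hbb w hw) (fun h0 => hpb ?_) hpb
  · rwa [h0, zero_add] at raa
  · rwa [h0, zero_add] at rbb

/-- The kernels of da and db are lines meeting only in zero, so coordinates exist in which a and b
depend on one variable each, and `lor_eq_zero_of_separated` applies. -/
theorem lor_eq_zero_of_rank_one {a b : ℂ → R41} {V : Set ℂ} (hV : IsOpen V)
    (sa : ContDiffOn ℝ ∞ a V) (sb : ContDiffOn ℝ ∞ b V)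
    (haa : ∀ w ∈ V, ∀ u, lor (pd u a w) (a w) = 0) (hab : ∀ w ∈ V, ∀ u, lor (pd u a w) (b w) = 0)
    (hba : ∀ w ∈ V, ∀ u, lor (pd u b w) (a w) = 0) (hbb : ∀ w ∈ V, ∀ u, lor (pd u b w) (b w) = 0)
    (hka : ∀ w ∈ V, ∃ u, u ≠ 0 ∧ pd u a w = 0) (hkb : ∀ w ∈ V, ∃ u, u ≠ 0 ∧ pd u b w = 0)
    (himm : ∀ w ∈ V, ∀ u, pd u a w = 0 → pd u b w = 0 → u = 0)
    (hpa : ∀ w ∈ V, ∀ u, pd u a w ≠ 0 → lor (pd u a w) (pd u a w) ≠ 0)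
    (hpb : ∀ w ∈ V, ∀ u, pd u b w ≠ 0 → lor (pd u b w) (pd u b w) ≠ 0)
    {w₀ : ℂ} (hw₀ : w₀ ∈ V) : lor (a w₀) (b w₀) = 0 := by
  obtain ⟨u₀, hu₀, hbu₀⟩ := hkb w₀ hw₀
  obtain ⟨v₀, hv₀, hav₀⟩ := hka w₀ hw₀
  have hA0 : pd u₀ a w₀ ≠ 0 := fun h0 => hu₀ (himm w₀ hw₀ _ h0 hbu₀)
  have hB0 : pd v₀ b w₀ ≠ 0 := fun h0 => hv₀ (himm w₀ hw₀ _ hav₀ h0)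
  set A₀ := pd u₀ a w₀
  set B₀ := pd v₀ b w₀
  have hA1 := hpa w₀ hw₀ u₀ hA0
  have hB1 := hpb w₀ hw₀ v₀ hB0
  let ℓ : R41 →L[ℝ] ℂ := Complex.ofRealCLM.comp (lorL A₀)
  let m : R41 →L[ℝ] ℂ := Complex.I • Complex.ofRealCLM.comp (lorL B₀)
  -- The real part depends on a alone and the imaginary part on b alone. As da and db have rank one,
  -- their kernels near `w₀` are those of the differentials of the real and imaginary parts.
  let W : ℂ → ℂ := fun w => ℓ (a w) + m (b w)
  have sW : ContDiffOn ℝ ∞ W V :=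
    (ℓ.contDiff.comp_contDiffOn sa).add (m.contDiff.comp_contDiffOn sb)
  have hdW : ∀ w ∈ V, ∀ u, fderiv ℝ W w u =
      (lor A₀ (pd u a w) : ℝ) + Complex.I * (lor B₀ (pd u b w) : ℝ) := by
    intro w hw u
    have d1 := ℓ.hasFDerivAt.comp w (differentiableAt_of_smooth hV sa hw).hasFDerivAt
    have d2 := m.hasFDerivAt.comp w (differentiableAt_of_smooth hV sb hw).hasFDerivAt
    have d3 : HasFDerivAt W _ w := d1.add d2
    rw [d3.fderiv]
    rfl
  have hnhds : {w | w ∈ V ∧ lor A₀ (pd u₀ a w) ≠ 0 ∧ lor B₀ (pd v₀ b w) ≠ 0} ∈ 𝓝 w₀ := by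
    have c1 : ContinuousAt (fun w => lorL A₀ (pd u₀ a w)) w₀ := (lorL A₀).continuous.continuousAt.comp
      ((smooth_pd hV sa u₀).continuousOn.continuousAt (hV.mem_nhds hw₀))
    have c2 : ContinuousAt (fun w => lorL B₀ (pd v₀ b w)) w₀ := (lorL B₀).continuous.continuousAt.comp
      ((smooth_pd hV sb v₀).continuousOn.continuousAt (hV.mem_nhds hw₀))
    filter_upwards [hV.mem_nhds hw₀, c1.eventually_ne (y := 0) hA1, c2.eventually_ne (y := 0) hB1]
      with w a b c using ⟨a, b, c⟩
  obtain ⟨S, hS, hSo, hw₀S⟩ := mem_nhds_iff.1 hnhds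
  have hSV : S ⊆ V := fun w hw => (hS hw).1
  have hre : ∀ w ∈ S, ∀ u, (fderiv ℝ W w u).re = 0 → pd u a w = 0 := by
    intro w hw u h0
    rw [hdW w (hSV hw)] at h0
    obtain ⟨v, hv, hav⟩ := hka w (hSV hw)
    have hne := (hS hw).2.1
    obtain ⟨r, hr⟩ := eq_smul_of_ker hv hav (u := u₀)
      (fun h1 => hne (by change lor A₀ (fderiv ℝ a w u₀) = 0; rw [h1, lor_zero_right])) u
    simp only [fderiv_eq_pd] at hr
    rw [hr, lor_smul_right] at h0
    have hr0 : r = 0 := by simpa [hne] using h0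
    rw [hr, hr0, zero_smul]
  have him : ∀ w ∈ S, ∀ u, (fderiv ℝ W w u).im = 0 → pd u b w = 0 := by
    intro w hw u h0
    rw [hdW w (hSV hw)] at h0
    obtain ⟨v, hv, hbv⟩ := hkb w (hSV hw)
    have hne := (hS hw).2.2
    obtain ⟨r, hr⟩ := eq_smul_of_ker hv hbv (u := v₀)
      (fun h1 => hne (by change lor B₀ (fderiv ℝ b w v₀) = 0; rw [h1, lor_zero_right])) u
    simp only [fderiv_eq_pd] at hr
    rw [hr, lor_smul_right] at h0
    have hr0 : r = 0 := by simpa [hne] using h0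
    rw [hr, hr0, zero_smul]
  have hinj : Function.Injective (fderiv ℝ W w₀) := by
    rw [injective_iff_map_eq_zero]
    intro u hu
    exact himm w₀ hw₀ u (hre w₀ hw₀S u (by rw [hu]; rfl)) (him w₀ hw₀S u (by rw [hu]; rfl))
  obtain ⟨e, h1, h2, h3, h4⟩ := exists_local_inverse hSo (sW.mono hSV) hw₀S hinj
  have hmaps : Set.MapsTo e.symm e.target S := fun ζ hζ => h2 (e.map_target hζ)
  have hca : ∀ ζ ∈ e.target, ∀ u, pd u (a ∘ e.symm) ζ = pd (fderiv ℝ e.symm ζ u) a (e.symm ζ) := by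
    intro ζ hζ u
    rw [pd, fderiv_comp_symm hSo (sa.mono hSV) h2 h4 hζ]; rfl
  have hcb : ∀ ζ ∈ e.target, ∀ u, pd u (b ∘ e.symm) ζ = pd (fderiv ℝ e.symm ζ u) b (e.symm ζ) := by
    intro ζ hζ u
    rw [pd, fderiv_comp_symm hSo (sb.mono hSV) h2 h4 hζ]; rfl
  have hWe : ∀ ζ ∈ e.target, ∀ u, fderiv ℝ W (e.symm ζ) (fderiv ℝ e.symm ζ u) = u :=
    fun ζ hζ u => fderiv_fderiv_symm hSo (sW.mono hSV) h2 h3 h4 hζ u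
  have hζ₀ : e w₀ ∈ e.target := e.map_source h1
  have key := lor_eq_zero_of_separated (a := a ∘ e.symm) (b := b ∘ e.symm) e.open_target
    ((sa.mono hSV).comp h4 hmaps) ((sb.mono hSV).comp h4 hmaps)
    (fun ζ hζ => by
      rw [hca ζ hζ]; exact hre _ (hmaps hζ) _ (by rw [hWe ζ hζ]; exact Complex.I_re))
    (fun ζ hζ => by
      rw [hcb ζ hζ]; exact him _ (hmaps hζ) _ (by rw [hWe ζ hζ]; exact Complex.one_im))
    (fun ζ hζ => by rw [hca ζ hζ]; exact haa _ (hSV (hmaps hζ)) _)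
    (fun ζ hζ => by rw [hca ζ hζ]; exact hab _ (hSV (hmaps hζ)) _)
    (fun ζ hζ => by rw [hcb ζ hζ]; exact hba _ (hSV (hmaps hζ)) _)
    (fun ζ hζ => by rw [hcb ζ hζ]; exact hbb _ (hSV (hmaps hζ)) _) hζ₀
    (by
      rw [hca _ hζ₀]
      refine hpa _ (hSV (hmaps hζ₀)) _ fun h0 => ?_
      have h5 := hWe _ hζ₀ 1
      rw [hdW _ (hSV (hmaps hζ₀)), h0, lor_zero_right] at h5
      simpa using congrArg Complex.re h5)
    (by
      rw [hcb _ hζ₀]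
      refine hpb _ (hSV (hmaps hζ₀)) _ fun h0 => ?_
      have h5 := hWe _ hζ₀ Complex.I
      rw [hdW _ (hSV (hmaps hζ₀)), h0, lor_zero_right] at h5
      simpa using congrArg Complex.im h5)
  rwa [Function.comp_apply, Function.comp_apply, e.left_inv h1] at key

/-- If two independent constant combinations of a front and its unit normal field have differentials
of rank at most one, then these combinations are orthogonal. -/
theorem PlaneFront.cartan {F N : ℂ → R41} {V : Set ℂ} (h : PlaneFront F N V) (hne : V.Nonempty)
    {p₁ q₁ p₂ q₂ : ℝ} (hdet : p₁ * q₂ - p₂ * q₁ ≠ 0)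
    (h1 : ∀ w ∈ V, ∀ u v, om (F w) (N w) ((p₁ • fderiv ℝ F w + q₁ • fderiv ℝ N w) u)
      ((p₁ • fderiv ℝ F w + q₁ • fderiv ℝ N w) v) = 0)
    (h2 : ∀ w ∈ V, ∀ u v, om (F w) (N w) ((p₂ • fderiv ℝ F w + q₂ • fderiv ℝ N w) u)
      ((p₂ • fderiv ℝ F w + q₂ • fderiv ℝ N w) v) = 0) :
    q₁ * q₂ - p₁ * p₂ = 0 := by
  obtain ⟨w₀, hw₀⟩ := hne
  have hV := h.isOpen
  have hs : ∀ p q : ℝ, ContDiffOn ℝ ∞ (fun w => p • F w + q • N w) V := fun p q =>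
    (h.smooth.const_smul p).add (h.smooth'.const_smul q)
  have hd : ∀ p q : ℝ, ∀ w ∈ V, ∀ u, pd u (fun w => p • F w + q • N w) w
      = (p • fderiv ℝ F w + q • fderiv ℝ N w) u := by
    intro p q w hw u
    have d1 := (differentiableAt_of_smooth hV h.smooth hw).hasFDerivAt.const_smul p
    have d2 := (differentiableAt_of_smooth hV h.smooth' hw).hasFDerivAt.const_smul q
    have d3 : HasFDerivAt (fun w => p • F w + q • N w) _ w := d1.add d2
    rw [pd, d3.fderiv]
  have hperp : ∀ p q : ℝ, ∀ w ∈ V, ∀ u,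
      Perp (F w) (N w) ((p • fderiv ℝ F w + q • fderiv ℝ N w) u) := by
    intro p q w hw u
    have hp := h.ptFront hw
    exact ((hp.perp u).smul p).add ((hp.perp' u).smul q)
  have horth : ∀ p q p' q' : ℝ, ∀ w ∈ V, ∀ u,
      lor (pd u (fun w => p • F w + q • N w) w) (p' • F w + q' • N w) = 0 := by
    intro p q p' q' w hw u
    rw [hd p q w hw, lor_add_right, lor_smul_right, lor_smul_right, lor_comm _ (F w),
      lor_comm _ (N w), (hperp p q w hw u).1, (hperp p q w hw u).2]
    ring
  have hpos : ∀ p q : ℝ, ∀ w ∈ V, ∀ u, pd u (fun w => p • F w + q • N w) w ≠ 0 →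
      lor (pd u (fun w => p • F w + q • N w) w) (pd u (fun w => p • F w + q • N w) w) ≠ 0 := by
    intro p q w hw u h0
    rw [hd p q w hw] at h0 ⊢
    exact ((h.pair w hw).lor_self_pos (hperp p q w hw u) h0).ne'
  have hker : ∀ p q : ℝ, (∀ w ∈ V, ∀ u v, om (F w) (N w) ((p • fderiv ℝ F w + q • fderiv ℝ N w) u)
      ((p • fderiv ℝ F w + q • fderiv ℝ N w) v) = 0) →
      ∀ w ∈ V, ∃ u, u ≠ 0 ∧ pd u (fun w => p • F w + q • N w) w = 0 := by
    intro p q h0 w hw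
    obtain ⟨u, hu, hu'⟩ := (h.pair w hw).exists_ker Complex.finrank_real_complex
      (hperp p q w hw) (h0 w hw)
    exact ⟨u, hu, by rw [hd p q w hw, hu']⟩
  have key := lor_eq_zero_of_rank_one hV (hs p₁ q₁) (hs p₂ q₂) (horth p₁ q₁ p₁ q₁)
    (horth p₁ q₁ p₂ q₂) (horth p₂ q₂ p₁ q₁) (horth p₂ q₂ p₂ q₂) (hker p₁ q₁ h1) (hker p₂ q₂ h2)
    (fun w hw u e1 e2 => by
      rw [hd p₁ q₁ w hw] at e1
      rw [hd p₂ q₂ w hw] at e2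
      simp only [add_apply, smul_apply] at e1 e2
      have e3 : (p₁ * q₂ - p₂ * q₁) • fderiv ℝ F w u = q₂ • (p₁ • fderiv ℝ F w u
        + q₁ • fderiv ℝ N w u) - q₁ • (p₂ • fderiv ℝ F w u + q₂ • fderiv ℝ N w u) := by module
      have e4 : (p₁ * q₂ - p₂ * q₁) • fderiv ℝ N w u = p₁ • (p₂ • fderiv ℝ F w u
        + q₂ • fderiv ℝ N w u) - p₂ • (p₁ • fderiv ℝ F w u + q₁ • fderiv ℝ N w u) := by module
      rw [e1, e2, smul_zero, smul_zero, sub_zero, smul_eq_zero] at e3 e4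
      exact h.imm w hw u (e3.resolve_left hdet) (e4.resolve_left hdet))
    (hpos p₁ q₁) (hpos p₂ q₂) hw₀
  have hp := h.pair w₀ hw₀
  simp only [lor_add_left, lor_add_right, lor_smul_left, lor_smul_right, hp.ff, hp.nn, hp.fn,
    lor_comm (N w₀) (F w₀)] at key
  linarith

end LWFront

namespace LWFront

/-! ### Smooth complex coordinates of a surface -/

section Manifold

variable {M : Type*} [TopologicalSpace M] [ChartedSpace (EuclideanSpace ℝ (Fin 2)) M]

/-- `z` is a smooth complex-valued local coordinate. -/
structure SmoothCoord (z : OpenPartialHomeomorph M ℂ) : Prop where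
  smooth : ContMDiffOn (𝓡 2) 𝓘(ℝ, ℂ) ∞ z z.source
  smooth_symm : ContMDiffOn 𝓘(ℝ, ℂ) (𝓡 2) ∞ z.symm z.target

theorem exists_smoothCoord [IsManifold (𝓡 2) ∞ M] (p : M) :
    ∃ z : OpenPartialHomeomorph M ℂ, p ∈ z.source ∧ SmoothCoord z := by
  let Φ : EuclideanSpace ℝ (Fin 2) ≃L[ℝ] ℂ :=
    Complex.orthonormalBasisOneI.repr.symm.toContinuousLinearEquiv
  let c := chartAt (EuclideanSpace ℝ (Fin 2)) p
  refine ⟨c.transHomeomorph Φ.toHomeomorph, mem_chart_source _ p, ?_, ?_⟩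
  · exact Φ.contDiff.contMDiff.comp_contMDiffOn (contMDiffOn_chart (I := 𝓡 2) (x := p))
  · exact (contMDiffOn_chart_symm (I := 𝓡 2) (x := p)).comp
      Φ.symm.contDiff.contMDiff.contMDiffOn (fun x hx => by simpa using hx)

theorem SmoothCoord.trans {z : OpenPartialHomeomorph M ℂ} (hz : SmoothCoord z)
    {e : OpenPartialHomeomorph ℂ ℂ} (he : ContDiffOn ℝ ∞ e e.source)
    (he' : ContDiffOn ℝ ∞ e.symm e.target) : SmoothCoord (z.trans e) where
  smooth := he.contMDiffOn.comp (hz.smooth.mono fun x hx => by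
      rw [OpenPartialHomeomorph.trans_source] at hx; exact hx.1)
    fun x hx => by rw [OpenPartialHomeomorph.trans_source] at hx; exact hx.2
  smooth_symm := hz.smooth_symm.comp (he'.contMDiffOn.mono fun x hx => by
      rw [OpenPartialHomeomorph.trans_target] at hx; exact hx.1)
    fun x hx => by rw [OpenPartialHomeomorph.trans_target] at hx; exact hx.2

theorem IsConformalCoord.smoothCoord {z : OpenPartialHomeomorph M ℂ} {f : M → R41}
    (hz : IsConformalCoord z f) : SmoothCoord z :=
  ⟨hz.smooth, hz.smooth_symm⟩

/-- One isomorphism serves all maps at once, so conditions involving df and dν together can be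
transported to the plane. -/
theorem SmoothCoord.exists_equiv [IsManifold (𝓡 2) ∞ M] {z : OpenPartialHomeomorph M ℂ}
    (hz : SmoothCoord z) {p : M} (hp : p ∈ z.source) :
    ∃ T : EuclideanSpace ℝ (Fin 2) ≃L[ℝ] ℂ, ∀ f : M → R41,
      ContMDiffAt (𝓡 2) 𝓘(ℝ, R41) ∞ f p →
      dmap f p = (fderiv ℝ (f ∘ z.symm) (z p)).comp
        (T : EuclideanSpace ℝ (Fin 2) →L[ℝ] ℂ) := by
  have hm : z.MDifferentiable (𝓡 2) 𝓘(ℝ, ℂ) :=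
    ⟨hz.smooth.mdifferentiableOn (by simp), hz.smooth_symm.mdifferentiableOn (by simp)⟩
  refine ⟨hm.mfderiv hp, fun f hf => ?_⟩
  have hf' : MDifferentiableAt (𝓡 2) 𝓘(ℝ, R41) f (z.symm (z p)) := by
    rw [z.left_inv hp]; exact hf.mdifferentiableAt (by simp)
  have h1 : f =ᶠ[𝓝 p] (f ∘ z.symm) ∘ z := by
    filter_upwards [z.open_source.mem_nhds hp] with x hx
    rw [Function.comp_apply, Function.comp_apply, z.left_inv hx]
  have h2 : MDifferentiableAt 𝓘(ℝ, ℂ) 𝓘(ℝ, R41) (f ∘ z.symm) (z p) :=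
    hf'.comp _ (hm.mdifferentiableAt_symm (z.map_source hp))
  rw [dmap, h1.mfderiv_eq, mfderiv_comp p h2 (hm.mdifferentiableAt hp), mfderiv_eq_fderiv]
  rfl

theorem SmoothCoord.smooth_comp {z : OpenPartialHomeomorph M ℂ} (hz : SmoothCoord z) {f : M → R41}
    {U : Set M} (hf : ContMDiffOn (𝓡 2) 𝓘(ℝ, R41) ∞ f U) :
    ContDiffOn ℝ ∞ (f ∘ z.symm) (z.target ∩ z.symm ⁻¹' U) :=
  contMDiffOn_iff_contDiffOn.1 (hf.comp (hz.smooth_symm.mono Set.inter_subset_left)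
    fun _ hx => hx.2)

/-! ### Fronts on the surface read in coordinates -/

theorem IsFrontOn.contMDiffAt {f ν : M → R41} {U : Set M} (h : IsFrontOn f ν U) (hU : IsOpen U)
    {p : M} (hp : p ∈ U) : ContMDiffAt (𝓡 2) 𝓘(ℝ, R41) ∞ f p :=
  h.smooth.contMDiffAt (hU.mem_nhds hp)

theorem IsFrontOn.contMDiffAt_normal {f ν : M → R41} {U : Set M} (h : IsFrontOn f ν U)
    (hU : IsOpen U) {p : M} (hp : p ∈ U) : ContMDiffAt (𝓡 2) 𝓘(ℝ, R41) ∞ ν p :=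
  h.smooth_normal.contMDiffAt (hU.mem_nhds hp)

theorem IsFrontOn.mono {f ν : M → R41} {U U' : Set M} (h : IsFrontOn f ν U) (hs : U' ⊆ U) :
    IsFrontOn f ν U' :=
  ⟨h.smooth.mono hs, h.smooth_normal.mono hs, fun p hp => h.mem_H3 p (hs hp),
    fun p hp => h.unit p (hs hp), fun p hp => h.orth p (hs hp), fun p hp => h.normal p (hs hp),
    fun p hp => h.immersion p (hs hp)⟩

/-- The first order relation `LinRel` at a point of a surface. -/
def RelAt (α β : ℝ) (f ν : M → R41) (p : M) : Prop :=
  LinRel α β (f p) (ν p) (dmap f p) (dmap ν p)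

theorem dmap_add {f ν : M → R41} {p : M} (hf : ContMDiffAt (𝓡 2) 𝓘(ℝ, R41) ∞ f p)
    (hν : ContMDiffAt (𝓡 2) 𝓘(ℝ, R41) ∞ ν p) (a b : ℝ) :
    dmap (fun x => a • f x + b • ν x) p = a • dmap f p + b • dmap ν p := by
  have h1 := (hf.mdifferentiableAt (by simp)).hasMFDerivAt
  have h2 := (hν.mdifferentiableAt (by simp)).hasMFDerivAt
  exact ((h1.const_smul a).add (h2.const_smul b)).mfderiv

variable [IsManifold (𝓡 2) ∞ M] {f ν : M → R41} {U : Set M}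

theorem IsFrontOn.planeFront (h : IsFrontOn f ν U) (hU : IsOpen U)
    {z : OpenPartialHomeomorph M ℂ} (hz : SmoothCoord z) :
    PlaneFront (f ∘ z.symm) (ν ∘ z.symm) (z.target ∩ z.symm ⁻¹' U) where
  isOpen := z.symm.isOpen_inter_preimage hU
  smooth := hz.smooth_comp h.smooth
  smooth' := hz.smooth_comp h.smooth_normal
  pair w hw := ⟨(h.mem_H3 _ hw.2).1, h.unit _ hw.2, h.orth _ hw.2⟩
  normal w hw v := by
    obtain ⟨T, hT⟩ := hz.exists_equiv (z.map_target hw.1)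
    have := h.normal _ hw.2 (T.symm v)
    rw [hT f (h.contMDiffAt hU hw.2), z.right_inv hw.1] at this
    simpa using this
  imm w hw v h1 h2 := by
    obtain ⟨T, hT⟩ := hz.exists_equiv (z.map_target hw.1)
    have := h.immersion _ hw.2 (T.symm v)
    rw [hT f (h.contMDiffAt hU hw.2), hT ν (h.contMDiffAt_normal hU hw.2),
      z.right_inv hw.1] at this
    simpa [h1, h2] using this

theorem IsFrontOn.ptFront (h : IsFrontOn f ν U) (hU : IsOpen U) {p : M} (hp : p ∈ U) :
    PtFront (f p) (ν p) (dmap f p) (dmap ν p) := by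
  obtain ⟨z, hz, hzs⟩ := exists_smoothCoord p
  obtain ⟨T, hT⟩ := hzs.exists_equiv hz
  rw [hT f (h.contMDiffAt hU hp), hT ν (h.contMDiffAt_normal hU hp)]
  have hw : z p ∈ z.target ∩ z.symm ⁻¹' U := ⟨z.map_source hz, by
    rw [Set.mem_preimage, z.left_inv hz]; exact hp⟩
  have := ((h.planeFront hU hzs).ptFront hw).comp T
  rwa [Function.comp_apply, Function.comp_apply, z.left_inv hz] at this

/-- The first order data of a front in a coordinate. -/
theorem IsFrontOn.coord_iff (h : IsFrontOn f ν U) (hU : IsOpen U)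
    {z : OpenPartialHomeomorph M ℂ} (hz : SmoothCoord z) {p : M} (hp : p ∈ U) (hpz : p ∈ z.source) :
    (∀ α β, RelAt α β f ν p ↔ LinRel α β ((f ∘ z.symm) (z p)) ((ν ∘ z.symm) (z p))
      (fderiv ℝ (f ∘ z.symm) (z p)) (fderiv ℝ (ν ∘ z.symm) (z p))) ∧
    (IsRegularAt f p ↔ Function.Injective (fderiv ℝ (f ∘ z.symm) (z p))) ∧
    (dmap f p = 0 ↔ fderiv ℝ (f ∘ z.symm) (z p) = 0) ∧
    (dmap f p + dmap ν p = 0 ↔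
      fderiv ℝ (f ∘ z.symm) (z p) + fderiv ℝ (ν ∘ z.symm) (z p) = 0) := by
  obtain ⟨T, hT⟩ := hz.exists_equiv hpz
  have h1 := hT f (h.contMDiffAt hU hp)
  have h2 := hT ν (h.contMDiffAt_normal hU hp)
  have hzero : ∀ L : ℂ →L[ℝ] R41, L.comp (T : EuclideanSpace ℝ (Fin 2) →L[ℝ] ℂ) = 0 ↔ L = 0 := by
    refine fun L => ⟨fun h0 => ?_, fun h0 => by rw [h0]; rfl⟩
    ext1 v
    have := congrArg (fun K : EuclideanSpace ℝ (Fin 2) →L[ℝ] R41 => K (T.symm v)) h0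
    simpa using this
  refine ⟨fun α β => ?_, ?_, ?_, ?_⟩
  · rw [RelAt, h1, h2, Function.comp_apply, Function.comp_apply, z.left_inv hpz]
    refine ⟨fun h0 => ?_, fun h0 => linRel_comp h0 _⟩
    intro u v
    simpa using h0 (T.symm u) (T.symm v)
  · rw [IsRegularAt, h1]
    exact Function.Injective.of_comp_iff' (fderiv ℝ (f ∘ z.symm) (z p)) T.bijective
  · rw [h1, hzero]
  · rw [h1, h2, ← ContinuousLinearMap.add_comp, hzero]

end Manifold

end LWFront

namespace LWFront

section Local

/-! ### Openness of nondegeneracy conditions -/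

theorem continuousAt_om {F N x y : ℂ → R41} {w : ℂ} (hF : ContinuousAt F w)
    (hN : ContinuousAt N w) (hx : ContinuousAt x w) (hy : ContinuousAt y w) :
    ContinuousAt (fun w => om (F w) (N w) (x w) (y w)) w := by
  rw [continuousAt_pi] at hF hN hx hy
  unfold om
  fun_prop (disch := assumption)

theorem PlaneFront.injective_iff {F N : ℂ → R41} {V : Set ℂ} (h : PlaneFront F N V) {w : ℂ}
    (hw : w ∈ V) : Function.Injective (fderiv ℝ F w) ↔
      om (F w) (N w) (pd 1 F w) (pd Complex.I F w) ≠ 0 := by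
  constructor
  · intro hinj h0
    obtain ⟨r, s, hrs, h1⟩ := (h.pair w hw).exists_relation ((h.ptFront hw).perp 1)
      ((h.ptFront hw).perp Complex.I) h0
    rw [← map_smul, ← map_smul, ← map_add, map_eq_zero_iff _ hinj] at h1
    have h6 := congrArg Complex.re h1
    have h7 := congrArg Complex.im h1
    simp at h6 h7
    tauto
  · intro h0
    rw [injective_iff_map_eq_zero]
    intro u hu
    by_contra hu0
    exact h0 (om_eq_zero_of_ker Complex.finrank_real_complex hu0 hu 1 Complex.I)

variable {M : Type*} [TopologicalSpace M] [ChartedSpace (EuclideanSpace ℝ (Fin 2)) M]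
  [IsManifold (𝓡 2) ∞ M] {f ν : M → R41} {U : Set M}

theorem IsFrontOn.exists_coord (h : IsFrontOn f ν U) (hU : IsOpen U) {p : M} (hp : p ∈ U) :
    ∃ z : OpenPartialHomeomorph M ℂ, SmoothCoord z ∧ p ∈ z.source ∧
      PlaneFront (f ∘ z.symm) (ν ∘ z.symm) (z.target ∩ z.symm ⁻¹' U) ∧
      (∀ x ∈ z.source ∩ U, z x ∈ z.target ∩ z.symm ⁻¹' U) ∧
      ∀ Q : ℂ → Prop, (∀ᶠ w in 𝓝 (z p), Q w) → ∀ᶠ x in 𝓝 p, x ∈ z.source ∩ U ∧ Q (z x) := by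
  obtain ⟨z, hz, hzs⟩ := exists_smoothCoord p
  refine ⟨z, hzs, hz, h.planeFront hU hzs, ?_, ?_⟩
  · rintro x ⟨hx, hxU⟩
    exact ⟨z.map_source hx, by rw [Set.mem_preimage, z.left_inv hx]; exact hxU⟩
  · intro Q hQ
    filter_upwards [z.open_source.mem_nhds hz, hU.mem_nhds hp,
      (z.continuousAt hz).eventually hQ] with x h1 h2 h3 using ⟨⟨h1, h2⟩, h3⟩

theorem IsFrontOn.eventually_isRegularAt (h : IsFrontOn f ν U) (hU : IsOpen U) {p : M}
    (hp : p ∈ U) (hreg : IsRegularAt f p) : ∀ᶠ x in 𝓝 p, IsRegularAt f x := by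
  obtain ⟨z, hzs, hz, hpl, hV, hev⟩ := h.exists_coord hU hp
  have hw := hV p ⟨hz, hp⟩
  have hn := hpl.isOpen.mem_nhds hw
  have hreg' := (hpl.injective_iff hw).1 ((h.coord_iff hU hzs hp hz).2.1.1 hreg)
  have hc := (continuousAt_om (hpl.smooth.continuousOn.continuousAt hn)
    (hpl.smooth'.continuousOn.continuousAt hn)
    ((smooth_pd hpl.isOpen hpl.smooth 1).continuousOn.continuousAt hn)
    ((smooth_pd hpl.isOpen hpl.smooth Complex.I).continuousOn.continuousAt hn)).eventually_ne hreg'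
  filter_upwards [hev _ hc] with x hx
  exact (h.coord_iff hU hzs hx.1.2 hx.1.1).2.1.2 ((hpl.injective_iff (hV x hx.1)).2 hx.2)

theorem IsFrontOn.eventually_dmap_ne_zero (h : IsFrontOn f ν U) (hU : IsOpen U) {p : M}
    (hp : p ∈ U) (h0 : dmap f p ≠ 0) : ∀ᶠ x in 𝓝 p, dmap f x ≠ 0 := by
  obtain ⟨z, hzs, hz, hpl, hV, hev⟩ := h.exists_coord hU hp
  have hw := hV p ⟨hz, hp⟩
  have hn := hpl.isOpen.mem_nhds hw
  have hc := ((smooth_fderiv hpl.isOpen hpl.smooth).continuousOn.continuousAt hn).eventually_ne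
    (fun h1 => h0 ((h.coord_iff hU hzs hp hz).2.2.1.2 h1))
  filter_upwards [hev _ hc] with x hx h1
  exact hx.2 ((h.coord_iff hU hzs hx.1.2 hx.1.1).2.2.1.1 h1)

theorem IsFrontOn.eventually_dmap_add_ne_zero (h : IsFrontOn f ν U) (hU : IsOpen U) {p : M}
    (hp : p ∈ U) (h0 : dmap f p + dmap ν p ≠ 0) : ∀ᶠ x in 𝓝 p, dmap f x + dmap ν x ≠ 0 := by
  obtain ⟨z, hzs, hz, hpl, hV, hev⟩ := h.exists_coord hU hp
  have hw := hV p ⟨hz, hp⟩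
  have hn := hpl.isOpen.mem_nhds hw
  have hc := (((smooth_fderiv hpl.isOpen hpl.smooth).continuousOn.continuousAt hn).add
    ((smooth_fderiv hpl.isOpen hpl.smooth').continuousOn.continuousAt hn)).eventually_ne
    (fun h1 => h0 ((h.coord_iff hU hzs hp hz).2.2.2.2 h1))
  filter_upwards [hev _ hc] with x hx h1
  exact hx.2 ((h.coord_iff hU hzs hx.1.2 hx.1.1).2.2.2.1 h1)

theorem IsFrontOn.eventually_not_relAt (h : IsFrontOn f ν U) (hU : IsOpen U) {p : M}
    (hp : p ∈ U) {α β : ℝ} (h0 : ¬ RelAt α β f ν p) : ∀ᶠ x in 𝓝 p, ¬ RelAt α β f ν x := by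
  obtain ⟨z, hzs, hz, hpl, hV, hev⟩ := h.exists_coord hU hp
  have hw := hV p ⟨hz, hp⟩
  have hn := hpl.isOpen.mem_nhds hw
  rw [(h.coord_iff hU hzs hp hz).1] at h0
  unfold LinRel at h0
  push Not at h0
  obtain ⟨u, v, huv⟩ := h0
  have c1 := hpl.smooth.continuousOn.continuousAt hn
  have c2 := hpl.smooth'.continuousOn.continuousAt hn
  have c3 := fun e => (smooth_pd hpl.isOpen hpl.smooth e).continuousOn.continuousAt hn
  have c4 := fun e => (smooth_pd hpl.isOpen hpl.smooth' e).continuousOn.continuousAt hn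
  have hc := ((continuousAt_const (y := α)).mul
    ((continuousAt_om c1 c2 (c3 u) ((c3 v).add (c4 v))).sub
      (continuousAt_om c1 c2 (c3 v) ((c3 u).add (c4 u))))).add ((continuousAt_const (y := β)).mul
      (continuousAt_om c1 c2 ((c3 u).add (c4 u)) ((c3 v).add (c4 v))))
  filter_upwards [hev _ (hc.eventually_ne huv)] with x hx h1
  exact hx.2 (((h.coord_iff hU hzs hx.1.2 hx.1.1).1 α β).1 h1 u v)

/-! ### Curvature relations and parallel fronts -/

/-- If d, X, Y denote the area term of A, the mixed term and the area term of C, then H - 1 =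
-X/(2d) and K = (Y - X)/d; clearing d gives the coefficients. -/
theorem IsFrontOn.curvature_rel_iff (h : IsFrontOn f ν U) (hU : IsOpen U) {p : M}
    (hp : p ∈ U) (hreg : IsRegularAt f p) (a b : ℝ) :
    a * (meanCurv f ν p - 1) + b * gaussCurv f ν p = 0 ↔ RelAt (a / 2 + b) (-b) f ν p := by
  have hpt := h.ptFront hU hp
  have hd := hpt.om_tvec_ne_zero hreg
  obtain ⟨h1, h2⟩ := hpt.curvature_eq hreg (firstFF f p) (secondFF f ν p) (fun _ _ => rfl)
    (fun _ _ => rfl)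
  rw [RelAt, linRel_iff_tvec, meanCurv, gaussCurv, h1, h2]
  generalize om (f p) (ν p) (dmap f p (tvec 0)) (dmap f p (tvec 1)) = d at *
  field_simp
  constructor <;> intro h3 <;> linarith

theorem IsFrontOn.weingartenRel_iff (h : IsFrontOn f ν U) (hU : IsOpen U) (ε : ℝ) :
    WeingartenRel ε f ν U ↔ ∀ p ∈ U, IsRegularAt f p → RelAt 1 (ε - 1) f ν p := by
  refine forall₂_congr fun p hp => forall_congr' fun hreg => ?_
  rw [h.curvature_rel_iff hU hp hreg]
  have e1 : 2 * ε / 2 + (1 - ε) = 1 := by ring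
  have e2 : -(1 - ε) = ε - 1 := by ring
  rw [e1, e2]

theorem IsFrontOn.meanCurv_eq_one_iff (h : IsFrontOn f ν U) (hU : IsOpen U) {p : M}
    (hp : p ∈ U) (hreg : IsRegularAt f p) : meanCurv f ν p = 1 ↔ RelAt 1 0 f ν p := by
  have := h.curvature_rel_iff hU hp hreg 2 0
  norm_num at this
  rw [← this, sub_eq_zero]

omit [IsManifold (𝓡 2) ∞ M] in
theorem IsFrontOn.dmap_parallel (h : IsFrontOn f ν U) (hU : IsOpen U) {p : M} (hp : p ∈ U)
    (δ : ℝ) : dmap (parallel f ν δ) p = Real.cosh δ • dmap f p + Real.sinh δ • dmap ν p ∧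
      dmap (parallelNormal f ν δ) p = Real.cosh δ • dmap ν p + Real.sinh δ • dmap f p :=
  ⟨dmap_add (h.contMDiffAt hU hp) (h.contMDiffAt_normal hU hp) _ _,
    dmap_add (h.contMDiffAt_normal hU hp) (h.contMDiffAt hU hp) _ _⟩

/-- The only issue is the upper sheet: Lagrange's identity gives (F 0)² - (N 0)² ≥ 1, so the cosh
term dominates the sinh term. -/
theorem parallel_mem_H3 {F N : R41} (hF : F ∈ H3) (hN : lor N N = 1) (hFN : lor F N = 0) (δ : ℝ) :
    Real.cosh δ • F + Real.sinh δ • N ∈ H3 := by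
  have hcs := Real.cosh_sq_sub_sinh_sq δ
  obtain ⟨hFF, hF0⟩ := hF
  refine ⟨?_, ?_⟩
  · simp only [lor_add_left, lor_add_right, lor_smul_left, lor_smul_right, hFF, hN, hFN,
      lor_comm N F]
    linarith
  · have h1 : N 0 ^ 2 < F 0 ^ 2 := by
      simp only [lor] at *
      have e : F 0 ^ 2 - N 0 ^ 2 = 1 + (F 1 * N 2 - F 2 * N 1) ^ 2 + (F 1 * N 3 - F 3 * N 1) ^ 2
          + (F 2 * N 3 - F 3 * N 2) ^ 2 := by
        have e1 : F 0 * N 0 = F 1 * N 1 + F 2 * N 2 + F 3 * N 3 := by linarith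
        have e2 : (F 0 ^ 2 - 1) * (N 0 ^ 2 + 1) = (F 1 ^ 2 + F 2 ^ 2 + F 3 ^ 2)
            * (N 1 ^ 2 + N 2 ^ 2 + N 3 ^ 2) := by
          congr 1 <;> linarith
        have e3 : (F 0 * N 0) ^ 2 = (F 1 * N 1 + F 2 * N 2 + F 3 * N 3) ^ 2 := by rw [e1]
        linear_combination e2 - e3
      have : 0 ≤ (F 1 * N 2 - F 2 * N 1) ^ 2 + (F 1 * N 3 - F 3 * N 1) ^ 2
          + (F 2 * N 3 - F 3 * N 2) ^ 2 := by positivity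
      linarith
    have h2 : (Real.sinh δ * N 0) ^ 2 < (Real.cosh δ * F 0) ^ 2 := by
      rw [mul_pow, mul_pow]
      have e1 : Real.sinh δ ^ 2 * N 0 ^ 2 ≤ Real.sinh δ ^ 2 * F 0 ^ 2 :=
        mul_le_mul_of_nonneg_left h1.le (sq_nonneg _)
      have e2 : 0 < F 0 ^ 2 := by positivity
      have e3 : Real.cosh δ ^ 2 = 1 + Real.sinh δ ^ 2 := by linarith
      rw [e3]
      linarith
    have h3 := abs_lt_of_sq_lt_sq h2 (mul_pos (Real.cosh_pos δ) hF0).le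
    have h4 := (abs_lt.1 h3).1
    simp only [Pi.add_apply, Pi.smul_apply, smul_eq_mul]
    linarith

theorem IsFrontOn.parallel (h : IsFrontOn f ν U) (hU : IsOpen U) (δ : ℝ) :
    IsFrontOn (parallel f ν δ) (parallelNormal f ν δ) U := by
  have hcs := Real.cosh_sq_sub_sinh_sq δ
  have key : ∀ p ∈ U, PtFront (LWFront.parallel f ν δ p) (parallelNormal f ν δ p)
      (dmap (LWFront.parallel f ν δ) p) (dmap (parallelNormal f ν δ) p) := by
    intro p hp
    rw [(h.dmap_parallel hU hp δ).1, (h.dmap_parallel hU hp δ).2]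
    exact (h.ptFront hU hp).parallel hcs
  have hsmul : ∀ c : ℝ, ContMDiff 𝓘(ℝ, R41) 𝓘(ℝ, R41) ∞ fun x : R41 => c • x := fun c =>
    (contDiff_id.const_smul c).contMDiff
  refine ⟨?_, ?_, fun p hp => parallel_mem_H3 (h.mem_H3 p hp) (h.unit p hp) (h.orth p hp) δ,
    fun p hp => (key p hp).pair.nn, fun p hp => (key p hp).pair.fn,
    fun p hp v => ?_, fun p hp => (key p hp).imm⟩
  · exact ((hsmul _).comp_contMDiffOn h.smooth).add ((hsmul _).comp_contMDiffOn h.smooth_normal)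
  · exact ((hsmul _).comp_contMDiffOn h.smooth_normal).add ((hsmul _).comp_contMDiffOn h.smooth)
  · rw [lor_comm]; exact ((key p hp).perp v).2

omit [IsManifold (𝓡 2) ∞ M] in
theorem IsFrontOn.relAt_parallel (h : IsFrontOn f ν U) (hU : IsOpen U) {p : M} (hp : p ∈ U)
    (δ α β : ℝ) : RelAt α β (LWFront.parallel f ν δ) (parallelNormal f ν δ) p ↔
      RelAt α (α * (Real.exp (2 * δ) - 1) + β * Real.exp (2 * δ)) f ν p := by
  have hcs := Real.cosh_sq_sub_sinh_sq δ
  have he : Real.exp (2 * δ) = (Real.cosh δ + Real.sinh δ) ^ 2 := by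
    rw [Real.cosh_add_sinh, ← Real.exp_nat_mul]; norm_num
  rw [RelAt, (h.dmap_parallel hU hp δ).1, (h.dmap_parallel hU hp δ).2, he]
  exact linRel_parallel hcs α β

/-! ### Isolated zeros -/

theorem IsFrontOn.exists_conformalCoord (h : IsFrontOn f ν U) (hU : IsOpen U)
    (hr : ∀ p ∈ U, RelAt 1 0 f ν p) {p : M} (hp : p ∈ U) :
    ∃ z : OpenPartialHomeomorph M ℂ, p ∈ z.source ∧ z.source ⊆ U ∧ IsConformalCoord z f := by
  obtain ⟨z, hzs, hz, hpl, hV, -⟩ := h.exists_coord hU hp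
  have hr' : ∀ w ∈ z.target ∩ z.symm ⁻¹' U, LinRel 1 0 ((f ∘ z.symm) w) ((ν ∘ z.symm) w)
      (fderiv ℝ (f ∘ z.symm) w) (fderiv ℝ (ν ∘ z.symm) w) := by
    intro w hw
    have := ((h.coord_iff hU hzs hw.2 (z.map_target hw.1)).1 1 0).1 (hr _ hw.2)
    rwa [z.right_inv hw.1] at this
  obtain ⟨e, h1, h2, h3, h4, h5⟩ := hpl.exists_conformal_coord hr' (hV p ⟨hz, hp⟩)
  have hs := hzs.trans h3 h4
  have ht : (z.trans e).target ⊆ e.target := fun w hw => by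
    rw [OpenPartialHomeomorph.trans_target] at hw; exact hw.1
  refine ⟨z.trans e, ?_, ?_, hs.smooth, hs.smooth_symm, fun w hw => (h5 w (ht hw)).1,
    fun w hw => (h5 w (ht hw)).2⟩
  · rw [OpenPartialHomeomorph.trans_source]; exact ⟨hz, h1⟩
  · intro x hx
    rw [OpenPartialHomeomorph.trans_source] at hx
    have := (h2 hx.2).2
    rwa [Set.mem_preimage, z.left_inv hx.1] at this

theorem IsFrontOn.hopf_properties (h : IsFrontOn f ν U) (hU : IsOpen U)
    (hr : ∀ p ∈ U, RelAt 1 0 f ν p) {z : OpenPartialHomeomorph M ℂ} (hz : IsConformalCoord z f)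
    (hzU : z.source ⊆ U) : DifferentiableOn ℂ (hopf z f ν) z.target ∧
      ∀ p ∈ z.source, hopf z f ν (z p) = 0 ↔ dmap f p = 0 ∨ dmap f p + dmap ν p = 0 := by
  have hV : z.target ∩ z.symm ⁻¹' U = z.target :=
    Set.inter_eq_left.2 fun w hw => hzU (z.map_target hw)
  have hpl := h.planeFront hU hz.smoothCoord
  rw [hV] at hpl
  have hr' : ∀ w ∈ z.target, LinRel 1 0 ((f ∘ z.symm) w) ((ν ∘ z.symm) w)
      (fderiv ℝ (f ∘ z.symm) w) (fderiv ℝ (ν ∘ z.symm) w) := by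
    intro w hw
    have hm := z.map_target hw
    have := ((h.coord_iff hU hz.smoothCoord (hzU hm) hm).1 1 0).1 (hr _ (hzU hm))
    rwa [z.right_inv hw] at this
  have hc : PlaneConformal (f ∘ z.symm) z.target := fun w hw => ⟨hz.norm_eq w hw, hz.orth w hw⟩
  refine ⟨hpl.differentiableOn_planeHopf hr' hc, fun p hp => ?_⟩
  have hi := h.coord_iff hU hz.smoothCoord (hzU hp) hp
  rw [hi.2.2.1, hi.2.2.2]
  exact hpl.planeHopf_eq_zero_iff hr' hc (z.map_source hp)

/-- Near a point of a front with mean curvature one the Hopf differential either vanishes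
identically or has at most one zero. -/
theorem IsFrontOn.dichotomy (h : IsFrontOn f ν U) (hU : IsOpen U)
    (hr : ∀ p ∈ U, RelAt 1 0 f ν p) {p : M} (hp : p ∈ U) :
    (∀ᶠ x in 𝓝 p, dmap f x = 0 ∨ dmap f x + dmap ν x = 0) ∨
      ∀ᶠ x in 𝓝[≠] p, ¬ (dmap f x = 0 ∨ dmap f x + dmap ν x = 0) := by
  obtain ⟨z, hz, hzU, hzc⟩ := h.exists_conformalCoord hU hr hp
  obtain ⟨hd, hiff⟩ := h.hopf_properties hU hr hzc hzU
  have ha := hd.analyticAt (z.open_target.mem_nhds (z.map_source hz))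
  have hsrc := z.open_source.mem_nhds hz
  rcases ha.eventually_eq_zero_or_eventually_ne_zero with h0 | h0
  · left
    filter_upwards [hsrc, (z.continuousAt hz).eventually h0] with x hx h1
    exact (hiff x hx).1 h1
  · right
    rw [eventually_nhdsWithin_iff] at h0 ⊢
    filter_upwards [hsrc, (z.continuousAt hz).eventually h0] with x hx h1 hxp h2
    exact h1 (fun h3 => hxp (z.injOn hx hz h3)) ((hiff x hx).2 h2)

theorem IsFrontOn.not_isRegularAt_iff (h : IsFrontOn f ν U) (hU : IsOpen U) {p : M} (hp : p ∈ U)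
    (hr : RelAt 1 0 f ν p) : ¬ IsRegularAt f p ↔ dmap f p = 0 := by
  refine ⟨(h.ptFront hU hp).eq_zero_of_singular hr, fun h0 hinj => ?_⟩
  have := hinj (a₁ := tvec 0) (a₂ := 0) (by rw [h0]; rfl)
  have := congrArg (fun x : EuclideanSpace ℝ (Fin 2) => x 0) this
  simp [tvec] at this

omit [IsManifold (𝓡 2) ∞ M] in
theorem IsFrontOn.isRegularAt_of_dmap_add_eq_zero (h : IsFrontOn f ν U) {p : M} (hp : p ∈ U)
    (h0 : dmap f p + dmap ν p = 0) : IsRegularAt f p := by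
  rw [IsRegularAt, injective_iff_map_eq_zero]
  intro v hv
  refine h.immersion p hp v hv ?_
  have := congrArg (fun L : EuclideanSpace ℝ (Fin 2) →L[ℝ] R41 => L v) h0
  simpa [hv] using this

end Local

end LWFront

namespace LWFront

section Global

/-! ### Regular points are dense and unit normal fields agree -/

/-- At an immersed point this is |Su|² = -det(S)|u|² for a trace-free symmetric S. In general conj(A
u)·B v is symmetric; multiplying it by A u·conj(B u) and taking imaginary parts gives the claim. -/
theorem PtFront.lor_mul_om_add {E : Type*} [NormedAddCommGroup E] [NormedSpace ℝ E] {F N : R41}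
    {A B : E →L[ℝ] R41} (h : PtFront F N A B) {u v : E} (hu : A u ≠ 0)
    (h0 : om F N (A u) (B v) = om F N (A v) (B u)) :
    lor (A u) (A u) * om F N (B u) (B v) + lor (B u) (B u) * om F N (A u) (A v) = 0 := by
  obtain ⟨κ, hκ, -⟩ := h.pair.exists_frame (h.perp u) hu
  have hs := h.symm u v
  rw [← (hκ _ _ (h.perp u) (h.perp' v)).2, ← (hκ _ _ (h.perp v) (h.perp' u)).2] at h0
  rw [← (hκ _ _ (h.perp u) (h.perp' v)).1, ← (hκ _ _ (h.perp v) (h.perp' u)).1] at hs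
  rw [← (hκ _ _ (h.perp u) (h.perp u)).1, ← (hκ _ _ (h.perp' u) (h.perp' v)).2,
    ← (hκ _ _ (h.perp' u) (h.perp' u)).1, ← (hκ _ _ (h.perp u) (h.perp v)).2]
  linear_combination
    ((κ (A u)).re * (κ (B u)).re + (κ (A u)).im * (κ (B u)).im) * h0
    + ((κ (B u)).re * (κ (A u)).im - (κ (B u)).im * (κ (A u)).re) * hs

variable {M : Type*} [TopologicalSpace M] [ChartedSpace (EuclideanSpace ℝ (Fin 2)) M]
  [IsManifold (𝓡 2) ∞ M] {f ν : M → R41} {U : Set M} {ε : ℝ}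

/-- If A has rank at most one throughout, the relation makes -εA + (1 - ε)B degenerate too. The two
combinations are independent as ε ≠ 1, and `PlaneFront.cartan` then forces ε = 0. -/
theorem IsFrontOn.not_forall_singular (h : IsFrontOn f ν U) (hU : IsOpen U) (hne : U.Nonempty)
    (hε : ε ≠ 0) (hε1 : ε ≠ 1) (hr : ∀ p ∈ U, RelAt 1 (ε - 1) f ν p)
    (hs : ∀ p ∈ U, ¬ IsRegularAt f p) : False := by
  obtain ⟨p, hp⟩ := hne
  obtain ⟨z, hzs, hz, hpl, hV, -⟩ := h.exists_coord hU hp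
  have hA : ∀ w ∈ z.target ∩ z.symm ⁻¹' U, ∀ u v, om ((f ∘ z.symm) w) ((ν ∘ z.symm) w)
      (fderiv ℝ (f ∘ z.symm) w u) (fderiv ℝ (f ∘ z.symm) w v) = 0 := by
    intro w hw u v
    have h1 := hs _ hw.2
    rw [(h.coord_iff hU hzs hw.2 (z.map_target hw.1)).2.1, z.right_inv hw.1,
      injective_iff_map_eq_zero] at h1
    push Not at h1
    obtain ⟨a, ha, ha0⟩ := h1
    exact om_eq_zero_of_ker Complex.finrank_real_complex ha0 ha u v
  have := hpl.cartan ⟨z p, hV p ⟨hz, hp⟩⟩ (p₁ := 1) (q₁ := 0) (p₂ := -ε) (q₂ := 1 - ε)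
    (by rw [mul_zero, sub_zero, one_mul]; exact sub_ne_zero.2 hε1.symm)
    (fun w hw u v => by simpa using hA w hw u v)
    (fun w hw u v => by
      have h1 := ((h.coord_iff hU hzs hw.2 (z.map_target hw.1)).1 1 (ε - 1)).1 (hr _ hw.2) u v
      rw [z.right_inv hw.1] at h1
      have h2 := hA w hw u v
      simp only [add_apply, smul_apply, om_add_left, om_add_right, om_smul_left,
        om_smul_right] at h1 ⊢
      rw [om_swap _ _ (fderiv ℝ (f ∘ z.symm) w v) (fderiv ℝ (f ∘ z.symm) w u),
        om_swap _ _ (fderiv ℝ (f ∘ z.symm) w v) (fderiv ℝ (ν ∘ z.symm) w u)] at h1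
      linear_combination (ε - 1) * h1 + (1 - ε ^ 2 + ε ^ 2) * h2)
  apply hε
  linarith

omit [IsManifold (𝓡 2) ∞ M] in
theorem dmap_neg (p : M) : dmap (fun x => - ν x) p = - dmap ν p :=
  mfderiv_neg

/-- Both signs together give H = 0 and det S = (1 + ε)/(1 - ε) when ε ≠ 1, that is, constant
principal curvatures ±c. `PlaneFront.cartan` applied to cA + B and -cA + B would give 1 + c² = 0. -/
theorem IsFrontOn.not_rel_neg (h : IsFrontOn f ν U) (hU : IsOpen U) (hne : U.Nonempty)
    (hε : 0 < ε) (hreg : ∀ p ∈ U, IsRegularAt f p) (hr : ∀ p ∈ U, RelAt 1 (ε - 1) f ν p)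
    (hr' : ∀ p ∈ U, RelAt 1 (ε - 1) f (fun x => - ν x) p) : False := by
  obtain ⟨p, hp⟩ := hne
  obtain ⟨z, hzs, hz, hpl, hV, -⟩ := h.exists_coord hU hp
  set F := f ∘ z.symm
  set N := ν ∘ z.symm
  have hDA : ∀ p ∈ U, ∀ u v, om (f p) (ν p) (dmap f p u) (dmap ν p v)
        = om (f p) (ν p) (dmap f p v) (dmap ν p u) ∧
      (1 + ε) * om (f p) (ν p) (dmap f p u) (dmap f p v)
        + (ε - 1) * om (f p) (ν p) (dmap ν p u) (dmap ν p v) = 0 := by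
    intro p hp u v
    have e1 := hr p hp u v
    have e2 := hr' p hp u v
    rw [dmap_neg] at e2
    simp only [om_neg_neg, neg_apply, om_add_left, om_add_right] at e1 e2
    have hneg : ∀ x y, om (f p) (ν p) x (-y) = - om (f p) (ν p) x y := fun x y => by
      simpa using om_smul_right (f p) (ν p) (-1) x y
    have hneg' : ∀ x y, om (f p) (ν p) (-x) y = - om (f p) (ν p) x y := fun x y => by
      simpa using om_smul_left (f p) (ν p) (-1) x y
    simp only [hneg, hneg'] at e2
    have s1 := om_swap (f p) (ν p) (dmap f p v) (dmap f p u)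
    have s2 := om_swap (f p) (ν p) (dmap ν p u) (dmap f p v)
    rw [s1, s2] at e1 e2
    have e3 : ε * (om (f p) (ν p) (dmap f p u) (dmap ν p v)
        - om (f p) (ν p) (dmap f p v) (dmap ν p u)) = 0 := by linarith
    have e4 : om (f p) (ν p) (dmap f p u) (dmap ν p v)
        - om (f p) (ν p) (dmap f p v) (dmap ν p u) = 0 := by simpa [hε.ne'] using e3
    exact ⟨by linarith, by linarith⟩
  have hpt := h.ptFront hU hp
  have hd := hpt.om_tvec_ne_zero (hreg p hp)
  have hA0 : dmap f p (tvec 0) ≠ 0 := fun h0 => hd (by rw [h0, om_zero_left])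
  have hpos := hpt.pair.lor_self_pos (hpt.perp (tvec 0)) hA0
  -- With H = 0 the determinant of S is nonpositive, which is incompatible with the second relation
  -- when 0 < ε ≤ 1.
  have hε1 : 1 < ε := by
    have e1 := hpt.lor_mul_om_add hA0 (hDA p hp (tvec 0) (tvec 1)).1
    have e2 := (hDA p hp (tvec 0) (tvec 1)).2
    have hB := hpt.pair.lor_self_nonneg (hpt.perp' (tvec 0))
    have e3 : om (f p) (ν p) (dmap f p (tvec 0)) (dmap f p (tvec 1)) *
        ((1 + ε) * lor (dmap f p (tvec 0)) (dmap f p (tvec 0))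
          - (ε - 1) * lor (dmap ν p (tvec 0)) (dmap ν p (tvec 0))) = 0 := by
      linear_combination lor (dmap f p (tvec 0)) (dmap f p (tvec 0)) * e2 - (ε - 1) * e1
    have e4 := (mul_eq_zero.1 e3).resolve_left hd
    by_contra! hle
    have e5 : 0 < (1 + ε) * lor (dmap f p (tvec 0)) (dmap f p (tvec 0)) := by positivity
    have e6 : (ε - 1) * lor (dmap ν p (tvec 0)) (dmap ν p (tvec 0)) ≤ 0 :=
      mul_nonpos_of_nonpos_of_nonneg (by linarith) hB
    linarith
  set c := Real.sqrt ((ε + 1) / (ε - 1)) with hc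
  have hq : 0 < (ε + 1) / (ε - 1) := div_pos (by linarith) (by linarith)
  have hc2 : c ^ 2 = (ε + 1) / (ε - 1) := Real.sq_sqrt hq.le
  have hc0 : 0 < c := Real.sqrt_pos.2 hq
  have hcmul : c ^ 2 * (ε - 1) = ε + 1 := by
    rw [hc2, div_mul_cancel₀]; linarith
  have hpl2 : ∀ w ∈ z.target ∩ z.symm ⁻¹' U, ∀ u v,
      om (F w) (N w) (fderiv ℝ F w u) (fderiv ℝ N w v)
        = om (F w) (N w) (fderiv ℝ F w v) (fderiv ℝ N w u) ∧
      c ^ 2 * om (F w) (N w) (fderiv ℝ F w u) (fderiv ℝ F w v)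
        + om (F w) (N w) (fderiv ℝ N w u) (fderiv ℝ N w v) = 0 := by
    intro w hw u v
    obtain ⟨T, hT⟩ := hzs.exists_equiv (z.map_target hw.1)
    have := hDA _ hw.2 (T.symm u) (T.symm v)
    rw [hT f (h.contMDiffAt hU hw.2), hT ν (h.contMDiffAt_normal hU hw.2), z.right_inv hw.1] at this
    simp only [ContinuousLinearMap.comp_apply, ContinuousLinearEquiv.coe_coe,
      ContinuousLinearEquiv.apply_symm_apply] at this
    refine ⟨this.1, ?_⟩
    have h3 : (ε - 1) * (c ^ 2 * om (F w) (N w) (fderiv ℝ F w u) (fderiv ℝ F w v)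
        + om (F w) (N w) (fderiv ℝ N w u) (fderiv ℝ N w v)) = 0 := by
      have h4 : (1 + ε) * om (F w) (N w) (fderiv ℝ F w u) (fderiv ℝ F w v)
        + (ε - 1) * om (F w) (N w) (fderiv ℝ N w u) (fderiv ℝ N w v) = 0 := this.2
      linear_combination h4 + om (F w) (N w) (fderiv ℝ F w u) (fderiv ℝ F w v) * hcmul
    exact (mul_eq_zero.1 h3).resolve_left (by linarith)
  have hcomb : ∀ d : ℝ, d ^ 2 = c ^ 2 → ∀ w ∈ z.target ∩ z.symm ⁻¹' U, ∀ u v,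
      om (F w) (N w) ((d • fderiv ℝ F w + (1 : ℝ) • fderiv ℝ N w) u)
        ((d • fderiv ℝ F w + (1 : ℝ) • fderiv ℝ N w) v) = 0 := by
    intro d hd2 w hw u v
    obtain ⟨e1, e2⟩ := hpl2 w hw u v
    simp only [add_apply, smul_apply, om_add_left, om_add_right, om_smul_left, om_smul_right]
    rw [om_swap _ _ (fderiv ℝ N w u) (fderiv ℝ F w v)]
    linear_combination e2 + d * e1 + om (F w) (N w) (fderiv ℝ F w u) (fderiv ℝ F w v) * hd2
  have := hpl.cartan ⟨z p, hV p ⟨hz, hp⟩⟩ (p₁ := c) (q₁ := 1) (p₂ := -c) (q₂ := 1)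
    (by linarith) (hcomb c rfl) (hcomb (-c) (by ring))
  linarith [sq_nonneg c]

/-! ### Comparison of two unit normal fields -/

theorem IsFrontOn.normal_eq_or_eq_neg {ν' : M → R41} {U' : Set M} (h : IsFrontOn f ν U)
    (hU : IsOpen U) (h' : IsFrontOn f ν' U') {p : M} (hp : p ∈ U) (hp' : p ∈ U')
    (hreg : IsRegularAt f p) : ν' p = ν p ∨ ν' p = - ν p := by
  have hpt := h.ptFront hU hp
  set t := lor (ν p) (ν' p) with ht
  have hperp : Perp (f p) (ν p) (ν' p - t • ν p) := by
    constructor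
    · rw [lor_sub_right, lor_smul_right, h'.orth p hp', h.orth p hp]; ring
    · rw [lor_sub_right, lor_smul_right, h.unit p hp]; ring
  have horth : ∀ u, lor (dmap f p u) (ν' p - t • ν p) = 0 := by
    intro u
    rw [lor_sub_right, lor_smul_right, h'.normal p hp', h.normal p hp]; ring
  have h0 := sub_eq_zero.1 (hpt.pair.eq_zero_of_lor_eq_zero (hpt.perp (tvec 0))
    (hpt.perp (tvec 1)) hperp (hpt.om_tvec_ne_zero hreg) (horth _) (horth _))
  have h1 := h'.unit p hp'
  rw [h0, lor_smul_left, lor_smul_right, h.unit p hp] at h1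
  have h2 : (t - 1) * (t + 1) = 0 := by linarith
  rcases mul_eq_zero.1 h2 with h3 | h3
  · left; rw [h0, sub_eq_zero.1 h3, one_smul]
  · right; rw [h0, eq_neg_of_add_eq_zero_left h3, neg_one_smul]

/-- At regular points the normals agree up to sign, and the sign is locally constant; a negative
sign would hold on an open set, against `not_rel_neg`. -/
theorem IsFrontOn.normal_eq_of_isRegularAt {ν' : M → R41} {U' : Set M} (hε : 0 < ε)
    (h : IsFrontOn f ν U) (hU : IsOpen U) (hw : WeingartenRel ε f ν U)
    (h' : IsFrontOn f ν' U') (hU' : IsOpen U') (hw' : WeingartenRel ε f ν' U')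
    {p : M} (hp : p ∈ U) (hp' : p ∈ U') (hreg : IsRegularAt f p) : ν' p = ν p := by
  rcases h.normal_eq_or_eq_neg hU h' hp hp' hreg with h0 | h0
  · exact h0
  exfalso
  have hc : ContinuousAt (fun x => lorL (ν x) (ν' x)) p :=
    (lorL.continuous.continuousAt.comp (h.contMDiffAt_normal hU hp).continuousAt).clm_apply
      (h'.contMDiffAt_normal hU' hp').continuousAt
  have hneg : lorL (ν p) (ν' p) < 0 := by
    rw [lorL_apply, h0, lor_neg_right, h.unit p hp]; norm_num
  have hnhds : ∀ᶠ x in 𝓝 p, (x ∈ U ∧ x ∈ U') ∧ IsRegularAt f x ∧ ν' x = - ν x := by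
    filter_upwards [hU.mem_nhds hp, hU'.mem_nhds hp', h.eventually_isRegularAt hU hp hreg,
      hc.eventually_lt continuousAt_const hneg] with x h1 h2 h3 h4
    refine ⟨⟨h1, h2⟩, h3, (h.normal_eq_or_eq_neg hU h' h1 h2 h3).resolve_left fun h5 => ?_⟩
    rw [lorL_apply, h5, h.unit x h1] at h4
    norm_num at h4
  obtain ⟨S, hS, hSo, hpS⟩ := mem_nhds_iff.1 hnhds
  refine (h.mono fun x hx => (hS hx).1.1).not_rel_neg hSo ⟨p, hpS⟩ hε (fun x hx => (hS hx).2.1)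
    (fun x hx => (h.weingartenRel_iff hU ε).1 hw x (hS hx).1.1 (hS hx).2.1) (fun x hx => ?_)
  have h1 := (h'.weingartenRel_iff hU' ε).1 hw' x (hS hx).1.2 (hS hx).2.1
  have h2 : ν' =ᶠ[𝓝 x] fun x => - ν x := by
    filter_upwards [hSo.mem_nhds hx] with y hy using (hS hy).2.2
  rw [RelAt] at h1 ⊢
  have h3 : dmap ν' x = dmap (fun x => - ν x) x := h2.mfderiv_eq
  rwa [h3, h2.eq_of_nhds] at h1

theorem IsFrontOn.normal_eq {ν' : M → R41} {U' : Set M} (hε : 0 < ε)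
    (hdense : ∀ p, ∃ᶠ x in 𝓝 p, IsRegularAt f x)
    (h : IsFrontOn f ν U) (hU : IsOpen U) (hw : WeingartenRel ε f ν U)
    (h' : IsFrontOn f ν' U') (hU' : IsOpen U') (hw' : WeingartenRel ε f ν' U')
    {p : M} (hp : p ∈ U) (hp' : p ∈ U') : ν' p = ν p := by
  by_contra hne
  have hev : ∀ᶠ x in 𝓝 p, (ν' x ≠ ν x ∧ x ∈ U ∧ x ∈ U') := by
    filter_upwards [((h'.contMDiffAt_normal hU' hp').continuousAt.ne_iff_eventually_ne
      (h.contMDiffAt_normal hU hp).continuousAt).1 hne, hU.mem_nhds hp, hU'.mem_nhds hp']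
      with x h1 h2 h3 using ⟨h1, h2, h3⟩
  obtain ⟨x, hx, h1, h2, h3⟩ := ((hdense p).and_eventually hev).exists
  exact h1 (h.normal_eq_of_isRegularAt hε hU hw h' hU' hw' h2 h3 hx)

end Global

end LWFront

namespace LWFront

section Main

/-! ### Density of the regular points -/

variable {M : Type*} [TopologicalSpace M] [ChartedSpace (EuclideanSpace ℝ (Fin 2)) M]
  [IsManifold (𝓡 2) ∞ M] {f ν : M → R41} {U : Set M} {ε : ℝ}

theorem IsFrontOn.dmap_add_eq_zero_of_relAt (h : IsFrontOn f ν U) (hU : IsOpen U) {p : M}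
    (hp : p ∈ U) {α β α' β' : ℝ} (hne : α * β' - β * α' ≠ 0) (h1 : RelAt α β f ν p)
    (h2 : RelAt α' β' f ν p) : dmap f p + dmap ν p = 0 := by
  refine (h.ptFront hU hp).add_eq_zero_of_linRel (by simp) (fun u v => ?_) (fun u v => ?_)
  · refine (mul_eq_zero.1 (?_ : (α * β' - β * α') * _ = 0)).resolve_left hne
    linear_combination β' * h1 u v - β * h2 u v
  · refine (mul_eq_zero.1 (?_ : (α * β' - β * α') * _ = 0)).resolve_left hne
    linear_combination α * h2 u v - α' * h1 u v

/-- The parallel front is immersed, so its Weingarten equation holds everywhere on U in the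
nondegenerate form; pulled back to f it covers the singular points of f as well. -/
theorem IsFrontOn.exists_relAt (h : IsFrontOn f ν U) (hU : IsOpen U) {δ : ℝ}
    (hi : IsHLWImmersionOn (LWFront.parallel f ν δ) (parallelNormal f ν δ) U) :
    ∃ α β : ℝ, (α ≠ 0 ∨ β ≠ 0) ∧ ∀ p ∈ U, RelAt α β f ν p := by
  obtain ⟨hreg, a, b, hab, hr⟩ := hi
  have hE := Real.exp_pos (2 * δ)
  set E := Real.exp (2 * δ) with hEdef
  refine ⟨a / 2 + b, (a / 2 + b) * (E - 1) + -b * E, ?_, fun p hp => ?_⟩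
  · by_contra! h0
    have hαz := h0.1
    rw [h0.1] at h0
    have hb : b = 0 := by
      have : b * E = 0 := by linarith [h0.2]
      exact (mul_eq_zero.1 this).resolve_right hE.ne'
    have ha : a = 0 := by rw [hb] at hαz; linarith
    exact hab (by rw [ha, hb]; norm_num)
  · rw [← h.relAt_parallel hU hp]
    exact ((h.parallel hU δ).curvature_rel_iff hU hp (hreg p hp) a b).1 (hr p hp)

/-- Compares the relation inherited from the immersed parallel front with the one assumed at regular
points. If they are proportional, the latter holds on all of U, and `not_forall_singular` (ε ≠ 1) or
the Hopf differential (ε = 1) applies. If they are independent, C vanishes at regular points of U,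
hence at `p` in their closure, so `p` is regular. -/
theorem IsFrontOn.eventually_frequently_isRegularAt (h : IsFrontOn f ν U) (hU : IsOpen U)
    (hε : 0 < ε) {δ : ℝ}
    (hi : IsHLWImmersionOn (LWFront.parallel f ν δ) (parallelNormal f ν δ) U)
    (hw : WeingartenRel ε f ν U) {p : M} (hp : p ∈ U) (hd : ∃ᶠ x in 𝓝 p, IsRegularAt f x) :
    ∀ᶠ y in 𝓝 p, ∃ᶠ x in 𝓝 y, IsRegularAt f x := by
  have hself : ∀ y, IsRegularAt f y → ∃ᶠ x in 𝓝 y, IsRegularAt f x := fun y hy hev =>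
    hev.self_of_nhds hy
  have hregular : IsRegularAt f p → ∀ᶠ y in 𝓝 p, ∃ᶠ x in 𝓝 y, IsRegularAt f x := fun hreg =>
    (h.eventually_isRegularAt hU hp hreg).mono hself
  obtain ⟨α, β, hne, hr⟩ := h.exists_relAt hU hi
  rw [h.weingartenRel_iff hU] at hw
  by_cases hprop : α * (ε - 1) - β * 1 = 0
  · have hα : α ≠ 0 := by
      rintro rfl
      rcases hne with h0 | h0
      · exact h0 rfl
      · exact h0 (by linarith)
    have hr1 : ∀ p ∈ U, RelAt 1 (ε - 1) f ν p := by
      intro p hp u v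
      refine (mul_eq_zero.1 (?_ : α * _ = 0)).resolve_left hα
      have hβ : β = α * (ε - 1) := by linarith
      have := hr p hp u v
      rw [hβ] at this
      linear_combination this
    by_cases hε1 : ε = 1
    · subst hε1
      rw [sub_self] at hr1
      rcases h.dichotomy hU hr1 hp with h0 | h0
      · by_cases hp0 : dmap f p = 0
        · have hC : dmap f p + dmap ν p ≠ 0 := fun h1 =>
            ((h.not_isRegularAt_iff hU hp (hr1 p hp)).2 hp0)
              (h.isRegularAt_of_dmap_add_eq_zero hp h1)
          exfalso
          apply hd
          -- If A = 0 at `p`, then C ≠ 0 nearby, so A = 0 nearby, and `p` is not a limit of regular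
          -- points.
          filter_upwards [h0, h.eventually_dmap_add_ne_zero hU hp hC, hU.mem_nhds hp]
            with x h1 h2 h3
          exact (h.not_isRegularAt_iff hU h3 (hr1 x h3)).2 (h1.resolve_right h2)
        · exact hregular (not_not.1 fun h1 =>
            hp0 ((h.not_isRegularAt_iff hU hp (hr1 p hp)).1 h1))
      · rw [eventually_nhdsWithin_iff] at h0
        filter_upwards [h0, hU.mem_nhds hp] with x h1 h2
        by_cases hx : x = p
        · rwa [hx]
        · exact hself x (not_not.1 fun h3 => h1 hx
            (Or.inl ((h.not_isRegularAt_iff hU h2 (hr1 x h2)).1 h3)))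
    · filter_upwards [hU.mem_nhds hp] with y hy hev
      obtain ⟨S, hS, hSo, hyS⟩ := mem_nhds_iff.1 (Filter.inter_mem hev (hU.mem_nhds hy))
      exact (h.mono fun x hx => (hS hx).2).not_forall_singular hSo ⟨y, hyS⟩ hε.ne' hε1
        (fun x hx => hr1 x (hS hx).2) (fun x hx => (hS hx).1)
  · refine hregular (h.isRegularAt_of_dmap_add_eq_zero hp ?_)
    by_contra hC
    apply hd
    filter_upwards [h.eventually_dmap_add_ne_zero hU hp hC, hU.mem_nhds hp] with x h1 h2 h3
    exact h1 (h.dmap_add_eq_zero_of_relAt hU h2 hprop (hr x h2) (hw x h2 h3))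

theorem frequently_isRegularAt [ConnectedSpace M] (hε : 0 < ε) (hf : f ∈ W (M := M) ε) (p : M) :
    ∃ᶠ x in 𝓝 p, IsRegularAt f x := by
  obtain ⟨⟨p₀, hp₀⟩, hloc⟩ := hf
  have hclopen : IsClopen {p | ∃ᶠ x in 𝓝 p, IsRegularAt f x} := by
    refine ⟨?_, isOpen_iff_eventually.2 fun p hp => ?_⟩
    · have : {p | ∃ᶠ x in 𝓝 p, IsRegularAt f x} = closure {x | IsRegularAt f x} := by
        ext p; exact mem_closure_iff_frequently.symm
      rw [this]
      exact isClosed_closure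
    · obtain ⟨U, hU, hpU, ν, h, ⟨δ, hi⟩, hw⟩ := hloc p
      exact h.eventually_frequently_isRegularAt hU hε hi hw hpU hp
  have := hclopen.eq_univ ⟨p₀, fun hev => hev.self_of_nhds hp₀⟩
  exact (this ▸ Set.mem_univ p : p ∈ {p | ∃ᶠ x in 𝓝 p, IsRegularAt f x})

/-! ### The global unit normal field -/

omit [IsManifold (𝓡 2) ∞ M] in
theorem IsFrontOn.congr_normal {ν' : M → R41} (h : IsFrontOn f ν U) (hU : IsOpen U)
    (he : ∀ x ∈ U, ν' x = ν x) : IsFrontOn f ν' U := by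
  have hd : ∀ p ∈ U, dmap ν' p = dmap ν p := fun p hp =>
    Filter.EventuallyEq.mfderiv_eq (Filter.eventually_of_mem (hU.mem_nhds hp) he)
  refine ⟨h.smooth, h.smooth_normal.congr he, h.mem_H3, fun p hp => ?_, fun p hp => ?_,
    fun p hp => ?_, fun p hp => ?_⟩
  · rw [he p hp]; exact h.unit p hp
  · rw [he p hp]; exact h.orth p hp
  · rw [he p hp]; exact h.normal p hp
  · rw [hd p hp]; exact h.immersion p hp

theorem exists_isWeingartenNormal (hε : 0 < ε) (hf : f ∈ W (M := M) ε)
    (hdense : ∀ p, ∃ᶠ x in 𝓝 p, IsRegularAt f x) : ∃ ν, IsWeingartenNormal ε f ν := by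
  have hloc : ∀ p, ∃ (U : Set M) (ν : M → R41), IsOpen U ∧ p ∈ U ∧ IsFrontOn f ν U ∧
      WeingartenRel ε f ν U := fun p => by
    obtain ⟨U, hU, hpU, ν, h, -, hw⟩ := hf.2 p
    exact ⟨U, ν, hU, hpU, h, hw⟩
  choose U ν hU hpU h hw using hloc
  have he : ∀ q, ∀ x ∈ U q, ν x x = ν q x := fun q x hx =>
    (h q).normal_eq hε hdense (hU q) (hw q) (h x) (hU x) (hw x) hx (hpU x)
  have hg : ∀ q, IsFrontOn f (fun x => ν x x) (U q) := fun q => (h q).congr_normal (hU q) (he q)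
  have hfront : IsFrontOn f (fun x => ν x x) Set.univ :=
    ⟨fun p _ => ((hg p).contMDiffAt (hU p) (hpU p)).contMDiffWithinAt,
      fun p _ => ((hg p).contMDiffAt_normal (hU p) (hpU p)).contMDiffWithinAt,
      fun p _ => (hg p).mem_H3 p (hpU p), fun p _ => (hg p).unit p (hpU p),
      fun p _ => (hg p).orth p (hpU p), fun p _ => (hg p).normal p (hpU p),
      fun p _ => (hg p).immersion p (hpU p)⟩
  refine ⟨_, hfront, fun p _ hreg => ?_⟩
  have hd : dmap (fun x => ν x x) p = dmap (ν p) p :=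
    Filter.EventuallyEq.mfderiv_eq (Filter.eventually_of_mem ((hU p).mem_nhds (hpU p)) (he p))
  have := hw p p (hpU p) hreg
  rw [meanCurv, gaussCurv, secondFF] at this ⊢
  rwa [hd]

theorem IsWeingartenNormal.unique (hε : 0 < ε)
    (hdense : ∀ p, ∃ᶠ x in 𝓝 p, IsRegularAt f x) {ν' : M → R41} (h : IsWeingartenNormal ε f ν)
    (h' : IsWeingartenNormal ε f ν') : ν' = ν :=
  funext fun p => h.1.normal_eq hε hdense isOpen_univ h.2 h'.1 isOpen_univ h'.2
    (Set.mem_univ p) (Set.mem_univ p)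

/-- The nondegenerate relation is a closed condition, so it passes from the dense set of regular
points to all points. -/
theorem IsWeingartenNormal.relAt (hdense : ∀ p, ∃ᶠ x in 𝓝 p, IsRegularAt f x)
    (h : IsWeingartenNormal ε f ν) (p : M) : RelAt 1 (ε - 1) f ν p := by
  by_contra h0
  obtain ⟨x, h1, h2⟩ := ((hdense p).and_eventually
    (h.1.eventually_not_relAt isOpen_univ (Set.mem_univ p) h0)).exists
  exact h2 ((h.1.weingartenRel_iff isOpen_univ ε).1 h.2 x (Set.mem_univ x) h1)

/-! ### Maps with vanishing differential -/

theorem eq_const_of_dmap_eq_zero [ConnectedSpace M] {g : M → R41}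
    (hg : ContMDiffOn (𝓡 2) 𝓘(ℝ, R41) ∞ g Set.univ) (h0 : ∀ p, dmap g p = 0) (p q : M) :
    g p = g q := by
  have hg' : ∀ p, ContMDiffAt (𝓡 2) 𝓘(ℝ, R41) ∞ g p := fun p => hg.contMDiffAt Filter.univ_mem
  have hlc : IsLocallyConstant g := by
    rw [IsLocallyConstant.iff_eventually_eq]
    intro p
    obtain ⟨z, hz, hzs⟩ := exists_smoothCoord p
    obtain ⟨r, hr, hball⟩ := Metric.isOpen_iff.1 z.open_target (z p) (z.map_source hz)
    have hder : ∀ w ∈ z.target, fderiv ℝ (g ∘ z.symm) w = 0 := by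
      intro w hw
      obtain ⟨T, hT⟩ := hzs.exists_equiv (z.map_target hw)
      have h1 := hT g (hg' _)
      rw [h0, z.right_inv hw] at h1
      ext1 v
      have := congrArg (fun L : EuclideanSpace ℝ (Fin 2) →L[ℝ] R41 => L (T.symm v)) h1
      simpa using this.symm
    have hdiff : DifferentiableOn ℝ (g ∘ z.symm) z.target := by
      have := (hzs.smooth_comp hg).differentiableOn (by simp)
      simpa using this
    have hev : ∀ᶠ w in 𝓝 (z p), (g ∘ z.symm) w = (g ∘ z.symm) (z p) := by
      filter_upwards [Metric.ball_mem_nhds (z p) hr] with w hw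
      refine (convex_ball (z p) r).is_const_of_fderivWithin_eq_zero (𝕜 := ℝ) (hdiff.mono hball)
        (fun x hx => ?_) hw (Metric.mem_ball_self hr)
      rw [fderivWithin_of_isOpen Metric.isOpen_ball hx]
      exact hder x (hball hx)
    filter_upwards [z.open_source.mem_nhds hz, (z.continuousAt hz).eventually hev] with x hx h1
    simpa [z.left_inv hx, z.left_inv hz] using h1
  exact hlc.apply_eq_of_preconnectedSpace p q

theorem inGeodesicSphere_of_dmap_parallel_eq_zero [ConnectedSpace M]
    (h : IsFrontOn f ν Set.univ) {δ : ℝ} (h0 : ∀ p, dmap (parallel f ν δ) p = 0) :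
    InGeodesicSphere f := by
  have hh := h.parallel isOpen_univ δ
  obtain ⟨p₀⟩ : Nonempty M := inferInstance
  refine ⟨parallel f ν δ p₀, hh.mem_H3 p₀ (Set.mem_univ _), δ, fun p => ?_⟩
  rw [eq_const_of_dmap_eq_zero hh.smooth h0 p₀ p, parallel, lor_add_right, lor_smul_right,
    lor_smul_right, (h.mem_H3 p (Set.mem_univ _)).1, h.orth p (Set.mem_univ _)]
  ring

theorem inHorosphere_of_dmap_add_eq_zero [ConnectedSpace M]
    (h : IsFrontOn f ν Set.univ) (h0 : ∀ p, dmap f p + dmap ν p = 0) : InHorosphere f := by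
  obtain ⟨p₀⟩ : Nonempty M := inferInstance
  have hs : ContMDiffOn (𝓡 2) 𝓘(ℝ, R41) ∞ (fun x => f x + ν x) Set.univ :=
    h.smooth.add h.smooth_normal
  have hd : ∀ p, dmap (fun x => f x + ν x) p = 0 := fun p => by
    have := dmap_add (h.contMDiffAt isOpen_univ (Set.mem_univ p))
      (h.contMDiffAt_normal isOpen_univ (Set.mem_univ p)) 1 1
    simpa [h0] using this
  have hm : ∀ p, lor (f p) (f p + ν p) = -1 := fun p => by
    rw [lor_add_right, (h.mem_H3 p (Set.mem_univ _)).1, h.orth p (Set.mem_univ _), add_zero]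
  refine ⟨f p₀ + ν p₀, fun hz => ?_, ?_, fun p => ?_⟩
  · have := hm p₀
    rw [hz, lor_zero_right] at this
    norm_num at this
  · rw [lor_add_left, hm, lor_add_right, h.unit p₀ (Set.mem_univ _), lor_comm,
      h.orth p₀ (Set.mem_univ _)]
    norm_num
  · rw [← hm p]
    exact congrArg _ (eq_const_of_dmap_eq_zero hs hd p₀ p)

/-! ### Zeros of the Hopf differential -/

/-- By the local dichotomy, the points near which the Hopf differential vanishes form a clopen set.
If it is everything, the zero sets of A and C cover M and are disjoint, hence clopen, so one of them
is all of M. -/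
theorem IsFrontOn.forall_or_forall_isolated [ConnectedSpace M] (h : IsFrontOn f ν Set.univ)
    (hr : ∀ p, RelAt 1 0 f ν p) :
    (∀ p, dmap f p = 0) ∨ (∀ p, dmap f p + dmap ν p = 0) ∨
      ∀ p, (¬ ∀ᶠ x in 𝓝 p, dmap f x = 0 ∨ dmap f x + dmap ν x = 0) ∧
        ∀ᶠ x in 𝓝[≠] p, ¬ (dmap f x = 0 ∨ dmap f x + dmap ν x = 0) := by
  have hfront := fun p : M => h.isRegularAt_of_dmap_add_eq_zero (Set.mem_univ p)
  have hnot : ∀ p, dmap f p = 0 → dmap f p + dmap ν p ≠ 0 := fun p h0 h1 =>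
    (h.not_isRegularAt_iff isOpen_univ (Set.mem_univ p) (hr p)).2 h0 (hfront p h1)
  have hdich := fun p => h.dichotomy isOpen_univ (fun p _ => hr p) (Set.mem_univ p)
  have hO : IsClopen {p | ∀ᶠ x in 𝓝 p, dmap f x = 0 ∨ dmap f x + dmap ν x = 0} := by
    refine ⟨isOpen_compl_iff.1 (isOpen_iff_eventually.2 fun p hp => ?_),
      isOpen_iff_eventually.2 fun p hp => eventually_eventually_nhds.2 hp⟩
    have h1 := eventually_nhdsWithin_iff.1 ((hdich p).resolve_left hp)
    filter_upwards [h1] with x hx hxO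
    by_cases hxp : x = p
    · exact hp (hxp ▸ hxO)
    · exact hx hxp hxO.self_of_nhds
  rcases isClopen_iff.1 hO with h0 | h0
  · have hn : ∀ p, ¬ ∀ᶠ x in 𝓝 p, dmap f x = 0 ∨ dmap f x + dmap ν x = 0 := fun p h1 =>
      (h0 ▸ (show p ∈ {p | ∀ᶠ x in 𝓝 p, dmap f x = 0 ∨ dmap f x + dmap ν x = 0} from h1) :
        p ∈ (∅ : Set M))
    exact Or.inr (Or.inr fun p => ⟨hn p, (hdich p).resolve_left (hn p)⟩)
  have hall : ∀ p, dmap f p = 0 ∨ dmap f p + dmap ν p = 0 := fun p => by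
    have : p ∈ {p | ∀ᶠ x in 𝓝 p, dmap f x = 0 ∨ dmap f x + dmap ν x = 0} := h0 ▸ Set.mem_univ p
    have hev : ∀ᶠ x in 𝓝 p, dmap f x = 0 ∨ dmap f x + dmap ν x = 0 := this
    exact hev.self_of_nhds
  have hA : IsClopen {p | dmap f p = 0} := by
    refine ⟨isOpen_compl_iff.1 (isOpen_iff_eventually.2 fun p hp =>
      h.eventually_dmap_ne_zero isOpen_univ (Set.mem_univ p) hp),
      isOpen_iff_eventually.2 fun p hp => ?_⟩
    filter_upwards [h.eventually_dmap_add_ne_zero isOpen_univ (Set.mem_univ p) (hnot p hp)]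
      with x hx using (hall x).resolve_right hx
  rcases isClopen_iff.1 hA with h1 | h1
  · exact Or.inr (Or.inl fun p => (hall p).resolve_left fun h2 =>
      (h1 ▸ (show p ∈ {p | dmap f p = 0} from h2) : p ∈ (∅ : Set M)))
  · exact Or.inl fun p => (h1.symm ▸ Set.mem_univ p : p ∈ {p | dmap f p = 0})

theorem IsFrontOn.isCMC1Front_iff (h : IsFrontOn f ν Set.univ) :
    IsCMC1Front f ν ↔ (∃ p, IsRegularAt f p) ∧ ∀ p, IsRegularAt f p → RelAt 1 0 f ν p :=
  ⟨fun h1 => ⟨h1.2.1, fun p hp =>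
    (h.meanCurv_eq_one_iff isOpen_univ (Set.mem_univ p) hp).1 (h1.2.2 p hp)⟩,
    fun h1 => ⟨h, h1.1, fun p hp =>
      (h.meanCurv_eq_one_iff isOpen_univ (Set.mem_univ p) hp).2 (h1.2 p hp)⟩⟩

omit [IsManifold (𝓡 2) ∞ M] in
theorem IsFrontOn.dmap_parallel_add (h : IsFrontOn f ν U) (hU : IsOpen U) {p : M} (hp : p ∈ U)
    (δ : ℝ) : dmap (LWFront.parallel f ν δ) p + dmap (parallelNormal f ν δ) p
      = Real.exp δ • (dmap f p + dmap ν p) := by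
  rw [(h.dmap_parallel hU hp δ).1, (h.dmap_parallel hU hp δ).2, ← Real.cosh_add_sinh]
  module

end Main

end LWFront

end

/-! ### The main theorem -/

theorem corollary3p1 {M : Type*} [TopologicalSpace M] [T2Space M] [SecondCountableTopology M]
    [ConnectedSpace M] [ChartedSpace (EuclideanSpace ℝ (Fin 2)) M] [IsManifold (𝓡 2) ∞ M]
    (ε : ℝ) (hε : 0 < ε) (f : M → LWFront.R41) (hf : f ∈ LWFront.W (M := M) ε)
    (hsphere : ¬ LWFront.InGeodesicSphere f) :
    ∃ ν : M → LWFront.R41,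
      LWFront.IsWeingartenNormal ε f ν ∧
      (∀ ν' : M → LWFront.R41, LWFront.IsWeingartenNormal ε f ν' → ν' = ν) ∧
      ∃ δ : ℝ,
        LWFront.IsCMC1Front (LWFront.parallel f ν δ) (LWFront.parallelNormal f ν δ) ∧
        (¬ LWFront.InHorosphere f → ∀ δ' : ℝ,
          LWFront.IsCMC1Front (LWFront.parallel f ν δ') (LWFront.parallelNormal f ν δ') →
            δ' = δ) ∧
        (∀ p ∈ LWFront.singularSet (LWFront.parallel f ν δ),
          ∀ᶠ x in 𝓝[≠] p, x ∉ LWFront.singularSet (LWFront.parallel f ν δ)) ∧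
        (∀ p ∈ LWFront.singularSet (LWFront.parallel f ν δ),
          ∃ z : OpenPartialHomeomorph M ℂ,
            p ∈ z.source ∧ LWFront.IsConformalCoord z (LWFront.parallel f ν δ)) ∧
        (∀ z : OpenPartialHomeomorph M ℂ,
          LWFront.IsConformalCoord z (LWFront.parallel f ν δ) →
            DifferentiableOn ℂ
              (LWFront.hopf z (LWFront.parallel f ν δ) (LWFront.parallelNormal f ν δ))
              z.target ∧
            ∀ p ∈ z.source,
              (p ∈ LWFront.singularSet (LWFront.parallel f ν δ) ↔
                LWFront.hopf z (LWFront.parallel f ν δ) (LWFront.parallelNormal f ν δ) (z p) = 0 ∧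
                LWFront.dmap (fun x => f x + ν x) p ≠ 0)) := by
  have hdense := LWFront.frequently_isRegularAt hε hf
  obtain ⟨ν, hν⟩ := LWFront.exists_isWeingartenNormal hε hf hdense
  have h := hν.1
  have hrel := hν.relAt hdense
  -- The parallel distance is fixed by e^(2δ) - 1 = ε - 1, which turns the relation of f into H = 1
  -- for the parallel front.
  have hexp : Real.exp (2 * (Real.log ε / 2)) = ε := by
    rw [mul_div_cancel₀ _ two_ne_zero, Real.exp_log hε]
  refine ⟨ν, hν, fun ν' hν' => hν.unique hε hdense hν', Real.log ε / 2, ?_⟩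
  generalize Real.log ε / 2 = δ at hexp
  have hP := h.parallel isOpen_univ δ
  have hPrel : ∀ p, LWFront.RelAt 1 0 (LWFront.parallel f ν δ) (LWFront.parallelNormal f ν δ) p := by
    intro p
    rw [h.relAt_parallel isOpen_univ (Set.mem_univ p), hexp]
    simpa using hrel p
  have hsing : ∀ p, p ∈ LWFront.singularSet (LWFront.parallel f ν δ) ↔
      LWFront.dmap (LWFront.parallel f ν δ) p = 0 := fun p =>
    hP.not_isRegularAt_iff isOpen_univ (Set.mem_univ p) (hPrel p)
  have hadd : ∀ p, LWFront.dmap (LWFront.parallel f ν δ) p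
      + LWFront.dmap (LWFront.parallelNormal f ν δ) p = 0 ↔
        LWFront.dmap f p + LWFront.dmap ν p = 0 := fun p => by
    rw [h.dmap_parallel_add isOpen_univ (Set.mem_univ p), smul_eq_zero,
      or_iff_right (Real.exp_pos δ).ne']
  have hnotconst : ¬ ∀ p, LWFront.dmap (LWFront.parallel f ν δ) p = 0 := fun h0 =>
    hsphere (LWFront.inGeodesicSphere_of_dmap_parallel_eq_zero h h0)
  have hcases := hP.forall_or_forall_isolated hPrel
  refine ⟨?_, fun hhoro δ' hδ' => ?_, fun p hp => ?_, fun p hp => ?_, fun z hz => ?_⟩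
  · rw [hP.isCMC1Front_iff]
    refine ⟨?_, fun p _ => hPrel p⟩
    by_contra! h0
    exact hnotconst fun p => (hsing p).1 (h0 p)
  · by_contra hne
    have hP' := h.parallel isOpen_univ δ'
    obtain ⟨⟨p, hp⟩, hrel'⟩ := hP'.isCMC1Front_iff.1 hδ'
    have hexp' : Real.exp (2 * δ') ≠ ε := by
      rw [← hexp]
      intro h0
      apply hne
      linarith [Real.exp_injective h0]
    -- The relations with coefficients (1, ε - 1) and (1, e^(2δ') - 1) are independent, so C = 0
    -- near a regular point of the second parallel front.
    have hev : ∀ᶠ x in 𝓝 p, LWFront.dmap f x + LWFront.dmap ν x = 0 := by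
      filter_upwards [hP'.eventually_isRegularAt isOpen_univ (Set.mem_univ p) hp] with x hx
      have h1 := (h.relAt_parallel isOpen_univ (Set.mem_univ x) δ' 1 0).1 (hrel' x hx)
      refine h.dmap_add_eq_zero_of_relAt isOpen_univ (Set.mem_univ x) ?_ (hrel x) h1
      intro h0
      exact hexp' (by linarith)
    rcases hcases with h0 | h0 | h0
    · exact hnotconst h0
    · exact hhoro (LWFront.inHorosphere_of_dmap_add_eq_zero h fun q => (hadd q).1 (h0 q))
    · exact (h0 p).1 (hev.mono fun x hx => Or.inr ((hadd x).2 hx))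
  · rcases hcases with h0 | h0 | h0
    · exact absurd h0 hnotconst
    · exact absurd (hP.isRegularAt_of_dmap_add_eq_zero (Set.mem_univ p) (h0 p)) hp
    · filter_upwards [(h0 p).2] with x hx hxs
      exact hx (Or.inl ((hsing x).1 hxs))
  · obtain ⟨z, hz, -, hzc⟩ := hP.exists_conformalCoord isOpen_univ (fun p _ => hPrel p)
      (Set.mem_univ p)
    exact ⟨z, hz, hzc⟩
  · obtain ⟨hd, hiff⟩ := hP.hopf_properties isOpen_univ (fun p _ => hPrel p) hz
      (Set.subset_univ _)
    refine ⟨hd, fun p hp => ?_⟩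
    have hsum : LWFront.dmap (fun x => f x + ν x) p = LWFront.dmap f p + LWFront.dmap ν p := by
      simpa using LWFront.dmap_add (h.contMDiffAt isOpen_univ (Set.mem_univ p))
        (h.contMDiffAt_normal isOpen_univ (Set.mem_univ p)) 1 1
    -- The zeros of Q are the points with df_δ = 0 or d(f + ν) = 0; the second kind are regular
    -- points of f_δ, so the nonvanishing condition removes exactly them.
    rw [hsum, hiff p hp, hadd, ← hsing]
    constructor
    · intro h0
      exact ⟨Or.inl h0, fun h1 =>
        h0 (hP.isRegularAt_of_dmap_add_eq_zero (Set.mem_univ p) ((hadd p).2 h1))⟩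
    · rintro ⟨h0, h1⟩
      exact h0.resolve_right h1
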